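/- **Theorem.** Let $Y$ be a closed (compact, without boundary) smooth manifold with a Riemannian metric, let $\Delta_Y\ge 0$ be its positive Laplace–Beltrami operator, let $n\ge 1$, and let $\Delta_X=-\sum_j\partial_{x_j}^2$ be the positive Laplacian on $X=\mathbb R^n$. Let $\Psi^d(Y)$ denote the space of classical pseudodifferential operators of order $d$ on $Y$. The space $H^s(\mathbb R^n\times Y)$ carries the norm $$\|u\|_{H^s}^2=\|(1+\Delta_X+\Delta_Y)^{s/2}u\|_{L^2}^2=(2\pi)^{-n}\int_{\mathbb R^n}\big\|(1+\Delta_Y+|\zeta|^2)^{s/2}\,\widehat u(\zeta)\big\|^2_{L^2(Y)}\,d\zeta ,\qquad \widehat u(\zeta)=\int_{\mathbb R^n} e^{-ix\cdot\zeta}u(x,\cdot)\,dx .$$ Let $s,d,N\in\mathbb R$ with $N>(n+|s-d|)/2$, and let $K\subset\mathbb R^n$ be compact. There is a constant $C=C(s,d)$, which may also depend on $n$, $N$, $Y$ and $K$, with the following property. Let $\widehat p(x,\xi)\in\Psi^d(Y)$, $x\in\mathbb R^n$, $\xi\in\mathbb R^n\setminus\{0\}$, be an operator-valued symbol of order $d$,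 depending smoothly on $(x,\xi)$, which vanishes for $x\notin K$ and satisfies, with a constant $C_p\ge 0$, $$\big\|(1+\Delta_X)^N(1+\Delta_Y+|\xi|^2)^{(s-d)/2}\,\widehat p(x,\xi)\,(1+\Delta_Y+|\xi|^2)^{-s/2}\big\|_{L^2(Y)\to L^2(Y)}\le C_p\qquad\text{for all }x\in\mathbb R^n,\ \xi\ne 0,$$ where $(1+\Delta_X)^N$ acts on the dependence on $x$ (as the Fourier multiplier $(1+|\eta|^2)^N$). Then the operator with symbol $\widehat p$, $$Pu(x)=(2\pi)^{-n}\int_{\mathbb R^n}e^{ix\cdot\xi}\,\widehat p(x,\xi)\,\widehat u(\xi)\,d\xi,\qquad u\in C_c^\infty(\mathbb R^n\times Y),$$ is well defined (the integral being understood weakly on $Y$: its pairing with every smooth eigenfunction of $\Delta_Y$ converges absolutely for every $x$ and is an integrable function of $x$), the test functions $C_c^\infty(\mathbb R^n\times Y)$ lie in $H^s(\mathbb R^n\times Y)$, and $P$ extends to a bounded operator $H^s(\mathbb R^n\times Y)\to H^{s-d}(\mathbb R^n\times Y)$ with $$\|P\|_{H^s\to H^{s-d}}\le C_p\cdot C(s,d).$$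 -/

import Mathlib

open MeasureTheory Set Filter Topology Manifold
open scoped ContDiff ComplexConjugate

noncomputable section

/-- The Euclidean space `ℝᵏ`. -/
abbrev Euc (k : ℕ) : Type := EuclideanSpace ℝ (Fin k)

/-! ### Smooth functions -/

section Smooth

variable (m : ℕ) (Y : Type*) [TopologicalSpace Y] [ChartedSpace (Euc m) Y]

/-- `C^∞(Y)`, the algebra of smooth complex-valued functions on `Y`. -/
def SmoothFn : Subalgebra ℂ (Y → ℂ) where
  carrier := {v | ContMDiff 𝓘(ℝ, Euc m) 𝓘(ℝ, ℂ) ∞ v}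
  mul_mem' := fun ha hb => contDiff_mul.contMDiff.comp (ha.prodMk_space hb)
  add_mem' := fun ha hb => ContMDiff.add ha hb
  algebraMap_mem' := fun _ => contMDiff_const

/-- `C_c^∞(ℝⁿ × Y)`, the space of smooth compactly supported functions on `ℝⁿ × Y`. -/
def TestFn (n : ℕ) : Submodule ℂ (Euc n × Y → ℂ) where
  carrier := {u | ContMDiff (𝓘(ℝ, Euc n).prod 𝓘(ℝ, Euc m)) 𝓘(ℝ, ℂ) ∞ u ∧ HasCompactSupport u}
  add_mem' := fun ha hb => ⟨ha.1.add hb.1, ha.2.add hb.2⟩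
  zero_mem' := ⟨contMDiff_const, HasCompactSupport.zero⟩
  smul_mem' := fun c _ hu => ⟨(contDiff_const_smul c).contMDiff.comp hu.1, hu.2.smul_left (f := fun _ => c)⟩

end Smooth

/-! ### Fourier transforms in the convention `û(ξ) = ∫ e^{-i x·ξ} u(x) dx` -/

/-- The Fourier transform `∫ e^{-i x·ξ} f(x) dx` on `ℝᵏ`. -/
def fourierR {k : ℕ} (f : Euc k → ℂ) (ξ : Euc k) : ℂ :=
  ∫ x, Complex.exp (-(Complex.I * (inner ℝ x ξ : ℝ))) * f x

/-- The inverse Fourier transform `(2π)^{-k} ∫ e^{i x·ξ} f(ξ) dξ` on `ℝᵏ`. -/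
def fourierInvR {k : ℕ} (f : Euc k → ℂ) (x : Euc k) : ℂ :=
  (((2 * Real.pi) ^ k : ℝ) : ℂ)⁻¹ * ∫ ξ, Complex.exp (Complex.I * (inner ℝ x ξ : ℝ)) * f ξ

/-- The operator `(1 + Δ_X)^N` on `ℝⁿ`, where `Δ_X = -∑ ∂²/∂x_j²` is the positive Laplacian and `N`
is real: the Fourier multiplier `(1 + |η|²)^N`. -/
def besselPower {n : ℕ} (N : ℝ) (f : Euc n → ℂ) : Euc n → ℂ :=
  fourierInvR fun η => (((1 + ‖η‖ ^ 2) ^ N : ℝ) : ℂ) * fourierR f η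

section PartialFourier

variable {n m : ℕ} {Y : Type*} [TopologicalSpace Y] [ChartedSpace (Euc m) Y]

theorem contMDiff_partialFourier [IsManifold 𝓘(ℝ, Euc m) ∞ Y] (u : TestFn m Y n) (ξ : Euc n) :
    ContMDiff 𝓘(ℝ, Euc m) 𝓘(ℝ, ℂ) ∞ (fun y : Y => fourierR (fun x => u.1 (x, y)) ξ) := by
  obtain ⟨u, hu, hc⟩ := u
  have hk : IsCompact (-(Prod.fst '' tsupport u) : Set (Euc n)) := (hc.image continuous_fst).neg
  intro y₀
  let κ := chartAt (Euc m) y₀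
  let G : Euc m → Euc n → ℂ := fun z x =>
    Complex.exp (-(Complex.I * (inner ℝ (-x) ξ : ℝ))) * u (-x, κ.symm z)
  have hG : ContDiffOn ℝ ∞ (Function.uncurry G) (κ.target ×ˢ univ) := by
    refine ContDiffOn.mul (ContDiff.contDiffOn ?_) ?_
    · refine Complex.contDiff_exp.comp (contDiff_const.mul ?_).neg
      exact Complex.ofRealCLM.contDiff.comp (contDiff_snd.neg.inner ℝ contDiff_const)
    · rw [← contMDiffOn_iff_contDiffOn]
      have h1 : ContMDiffOn 𝓘(ℝ, Euc m × Euc n) 𝓘(ℝ, Euc m) ∞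
          (fun q : Euc m × Euc n => κ.symm q.1) (κ.target ×ˢ univ) :=
        (contMDiffOn_chart_symm (I := 𝓘(ℝ, Euc m)) (x := y₀)).comp
          (contDiff_fst.contMDiff.contMDiffOn) (fun q hq => hq.1)
      have h2 : ContMDiffOn 𝓘(ℝ, Euc m × Euc n) 𝓘(ℝ, Euc n) ∞
          (fun q : Euc m × Euc n => -q.2) (κ.target ×ˢ univ) :=
        contDiff_snd.neg.contMDiff.contMDiffOn
      exact hu.comp_contMDiffOn (h2.prodMk h1)
  have hG0 : ∀ z x, z ∈ κ.target → x ∉ (-(Prod.fst '' tsupport u) : Set (Euc n)) → G z x = 0 := by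
    intro z x _ hx
    have : u (-x, κ.symm z) = 0 := by
      by_contra h
      exact hx ⟨(-x, κ.symm z), subset_tsupport u h, rfl⟩
    simp [G, this]
  have key := contDiffOn_convolution_right_with_param_comp (μ := (volume : Measure (Euc n)))
    (ContinuousLinearMap.mul ℝ ℂ) (v := fun _ : Euc m => (0 : Euc n)) contDiffOn_const
    (f := fun _ => (1 : ℂ)) κ.open_target hk hG0 (locallyIntegrable_const _) hG
  have h3 := (key.contMDiffOn.comp (contMDiffOn_chart (I := 𝓘(ℝ, Euc m)) (x := y₀) (n := ∞))
    (fun y hy => κ.map_source hy)).contMDiffAt (κ.open_source.mem_nhds (mem_chart_source _ y₀))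
  refine h3.congr_of_eventuallyEq ?_
  filter_upwards [κ.open_source.mem_nhds (mem_chart_source _ y₀)] with y hy
  simp only [Function.comp, fourierR, convolution, G, ContinuousLinearMap.mul_apply', one_mul,
    zero_sub, neg_neg, κ]
  rw [(chartAt (Euc m) y₀).left_inv hy]

/-- The partial Fourier transform `û(ξ) ∈ C^∞(Y)`, in the variable `x ∈ ℝⁿ`, of a test function `u`
on `ℝⁿ × Y`. -/
def partialFourier [IsManifold 𝓘(ℝ, Euc m) ∞ Y] (u : TestFn m Y n) (ξ : Euc n) : SmoothFn m Y :=
  ⟨fun y => fourierR (fun x => u.1 (x, y)) ξ, contMDiff_partialFourier u ξ⟩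

end PartialFourier

/-! ### The Laplacian of a Riemannian manifold -/

section Riemannian

variable {m : ℕ} {Y : Type*} [TopologicalSpace Y] [ChartedSpace (Euc m) Y]
  [IsManifold 𝓘(ℝ, Euc m) ∞ Y]

variable (m Y) in
/-- A smooth Riemannian metric on `Y`. -/
abbrev RMetric : Type _ :=
  Bundle.ContMDiffRiemannianMetric 𝓘(ℝ, Euc m) ∞ (Euc m)
    (fun y : Y => TangentSpace 𝓘(ℝ, Euc m) y)

/-- The Gram matrix `g_y(b_i, b_j)` of tangent vectors `b_1, …, b_m` at `y`. -/
def RMetric.gram (g : RMetric m Y) (y : Y) (b : Fin m → TangentSpace 𝓘(ℝ, Euc m) y) :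
    Matrix (Fin m) (Fin m) ℝ :=
  Matrix.of fun i j => g.inner y (b i) (b j)

/-- `μ` is the Riemannian volume of `g`: in every chart it is `√(det g_ij) dz`. -/
def IsRiemannianVolume [MeasurableSpace Y] (g : RMetric m Y) (μ : Measure Y) : Prop :=
  ∀ κ ∈ atlas (Euc m) Y, ∀ A : Set Y, MeasurableSet A → A ⊆ κ.source →
    μ A = ∫⁻ z in κ '' A, ENNReal.ofReal (Real.sqrt (g.gram (κ.symm z) (fun i =>
      mfderiv 𝓘(ℝ, Euc m) 𝓘(ℝ, Euc m) κ.symm z (EuclideanSpace.single i (1 : ℝ)))).det)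

/-- The standard basis of the tangent space at `y`, identified with `ℝᵐ` by the preferred chart. -/
def tangentBasis (y : Y) (i : Fin m) : TangentSpace 𝓘(ℝ, Euc m) y :=
  (EuclideanSpace.single i (1 : ℝ) : Euc m)

/-- The derivative `∂_i v (y) = dv(y)(b_i)` along the standard basis of the tangent space at `y`. -/
def partialDeriv (v : Y → ℂ) (i : Fin m) (y : Y) : ℂ :=
  mfderiv 𝓘(ℝ, Euc m) 𝓘(ℝ, ℂ) v y (tangentBasis y i)

/-- The function `y ↦ ⟨dv, dw⟩_g (y) = ∑ g^{ij} ∂_i v ∂_j w` (complex bilinear in `v` and `w`). -/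
def gradPair (g : RMetric m Y) (v w : Y → ℂ) (y : Y) : ℂ :=
  ∑ i, ∑ j, (((g.gram y (tangentBasis y))⁻¹ i j : ℝ) : ℂ) *
    (partialDeriv v i y * partialDeriv w j y)

variable [MeasurableSpace Y]

/-- `f = Δ_Y v` for the positive Laplace–Beltrami operator `Δ_Y` of `g` (with Riemannian volume `μ`)
and smooth functions `v`, `f`: `∫ ⟨dφ, dv⟩_g dμ = ∫ φ f dμ` for all `φ ∈ C^∞(Y)`. -/
def IsLaplacian (g : RMetric m Y) (μ : Measure Y) (v f : SmoothFn m Y) : Prop :=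
  ∀ φ : SmoothFn m Y, ∫ y, gradPair g φ.1 v.1 y ∂μ = ∫ y, φ.1 y * f.1 y ∂μ

/-- `Δ_Y e = lam e`. -/
def IsEigenfn (g : RMetric m Y) (μ : Measure Y) (lam : ℝ) (e : SmoothFn m Y) : Prop :=
  IsLaplacian g μ e ((lam : ℂ) • e)

/-- The scalar product `⟨φ, v⟩ = ∫ conj φ · v dμ` of `L²(Y)`. -/
def pairing (μ : Measure Y) (φ v : Y → ℂ) : ℂ := ∫ y, conj (φ y) * v y ∂μ

/-- `w = (1 + Δ_Y + |ξ|²)^t v`, with `w ∈ L²(Y)`. The power is that of the spectral calculus of the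
self-adjoint operator `Δ_Y`: on every eigenspace `Δ_Y = lam` it is multiplication by
`(1 + lam + |ξ|²)^t`. As the smooth eigenfunctions span a dense subspace of `L²(Y)`, there is at most
one such `w`. -/
def IsLaplacePower {n : ℕ} (g : RMetric m Y) (μ : Measure Y) (t : ℝ) (ξ : Euc n) (v : Y → ℂ)
    (w : Lp ℂ 2 μ) : Prop :=
  ∀ (lam : ℝ) (e : SmoothFn m Y), IsEigenfn g μ lam e →
    pairing μ e.1 w = (((1 + lam + ‖ξ‖ ^ 2) ^ t : ℝ) : ℂ) * pairing μ e.1 v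

end Riemannian

/-! ### Classical pseudodifferential operators on `Y` -/

section PsiDO

/-- The symbol estimates of order `d` on `{|η| ≥ r}`, uniform in `z`: all derivatives satisfy
`|∂_z^k ∂_η^l a(z, η)| ≤ C_{k,l} (1 + |η|)^{d - l}`. -/
def SymbolEstimates {m : ℕ} (d r : ℝ) (a : Euc m → Euc m → ℂ) : Prop :=
  ∀ k l : ℕ, ∃ C : ℝ, ∀ z η : Euc m, r ≤ ‖η‖ →
    ‖iteratedFDeriv ℝ k (fun z' => iteratedFDeriv ℝ l (a z') η) z‖ ≤ C * (1 + ‖η‖) ^ (d - l)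

/-- Classical symbols of order `d` on `ℝᵐ`: symbols `a ∈ S^d` with an asymptotic expansion
`a ~ ∑ a_{d-j}`, where `a_{d-j}` is smooth and homogeneous of degree `d - j` for `η ≠ 0`. -/
structure IsClassicalSymbol {m : ℕ} (d : ℝ) (a : Euc m → Euc m → ℂ) : Prop where
  smooth : ContDiff ℝ ∞ (fun q : Euc m × Euc m => a q.1 q.2)
  estimates : SymbolEstimates d 0 a
  expansion : ∃ b : ℕ → Euc m → Euc m → ℂ,
    (∀ j, ContDiffOn ℝ ∞ (fun q : Euc m × Euc m => b j q.1 q.2) {q | q.2 ≠ 0}) ∧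
    (∀ j z η, η ≠ 0 → ∀ t : ℝ, 0 < t → b j z (t • η) = ((t ^ (d - j) : ℝ) : ℂ) * b j z η) ∧
    ∀ J : ℕ, SymbolEstimates (d - J) 1 (fun z η => a z η - ∑ j ∈ Finset.range J, b j z η)

/-- The operator `Op(a) f (z) = (2π)^{-m} ∫ e^{i z·η} a(z, η) f̂(η) dη` on `ℝᵐ`. -/
def opR {m : ℕ} (a : Euc m → Euc m → ℂ) (f : Euc m → ℂ) (z : Euc m) : ℂ :=
  fourierInvR (fun η => a z η * fourierR f η) z

variable {m : ℕ} {Y : Type*} [TopologicalSpace Y] [ChartedSpace (Euc m) Y] [MeasurableSpace Y]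

/-- `A ∈ Ψ^d(Y)`: `A` is a classical pseudodifferential operator of order `d` on `Y`, that is,
localized to any chart it is `Op(a)` with a classical symbol `a` of order `d`, and between functions
with disjoint supports it has a smooth kernel. -/
structure IsPsiDO (μ : Measure Y) (d : ℝ) (A : SmoothFn m Y →ₗ[ℂ] SmoothFn m Y) : Prop where
  local_symbol : ∀ κ ∈ IsManifold.maximalAtlas 𝓘(ℝ, Euc m) ∞ Y, ∀ χ ψ : SmoothFn m Y,
    HasCompactSupport χ.1 → HasCompactSupport ψ.1 →
    tsupport χ.1 ⊆ κ.source → tsupport ψ.1 ⊆ κ.source →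
    ∃ a : Euc m → Euc m → ℂ, IsClassicalSymbol d a ∧ ∀ v : SmoothFn m Y, ∀ z ∈ κ.target,
      (ψ * A (χ * v)).1 (κ.symm z) =
        opR a (κ.target.indicator fun z' => (χ * v).1 (κ.symm z')) z
  pseudolocal : ∀ χ ψ : SmoothFn m Y, Disjoint (tsupport χ.1) (tsupport ψ.1) →
    ∃ k : Y × Y → ℂ, ContMDiff (𝓘(ℝ, Euc m).prod 𝓘(ℝ, Euc m)) 𝓘(ℝ, ℂ) ∞ k ∧
      ∀ (v : SmoothFn m Y) (y : Y), (ψ * A (χ * v)).1 y = ∫ y', k (y, y') * v.1 y' ∂μ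

/-- Operator-valued symbols of order `d` on `T*ℝⁿ ∖ 0`: families `p(x, ξ) ∈ Ψ^d(Y)`, `ξ ≠ 0`, that
depend smoothly on `(x, ξ)`. Of the smooth dependence only the smoothness of the functions
`(x, ξ, y) ↦ (p(x, ξ)v)(y)`, for `v ∈ C^∞(Y)`, is required. The values `p(x, 0)` are irrelevant. -/
structure IsOperatorSymbol {n : ℕ} (μ : Measure Y) (d : ℝ)
    (p : Euc n → Euc n → SmoothFn m Y →ₗ[ℂ] SmoothFn m Y) : Prop where
  mem : ∀ x ξ, ξ ≠ 0 → IsPsiDO μ d (p x ξ)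
  smooth : ∀ v : SmoothFn m Y,
    ContMDiffOn ((𝓘(ℝ, Euc n).prod 𝓘(ℝ, Euc n)).prod 𝓘(ℝ, Euc m)) 𝓘(ℝ, ℂ) ∞
      (fun q : (Euc n × Euc n) × Y => (p q.1.1 q.1.2 v).1 q.2) {q | q.1.2 ≠ 0}

end PsiDO

/-! ### The operator on `ℝⁿ × Y` and Sobolev spaces -/

section Operators

variable {n m : ℕ} {Y : Type*} [TopologicalSpace Y] [ChartedSpace (Euc m) Y]
  [IsManifold 𝓘(ℝ, Euc m) ∞ Y] [MeasurableSpace Y]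

/-- The estimate
`‖(1 + Δ_X)^N (1 + Δ_Y + |ξ|²)^{(s-d)/2} p(x, ξ) (1 + Δ_Y + |ξ|²)^{-s/2}‖_{L²(Y) → L²(Y)} ≤ Cp`,
uniform in `x` and `ξ ≠ 0`. The operator is evaluated at `w = (1 + Δ_Y + |ξ|²)^{s/2} v`, where `v` runs
through `C^∞(Y)`. -/
def WeightedBound (g : RMetric m Y) (μ : Measure Y) (s d N Cp : ℝ)
    (p : Euc n → Euc n → SmoothFn m Y →ₗ[ℂ] SmoothFn m Y) : Prop :=
  ∀ x ξ : Euc n, ξ ≠ 0 → ∀ (v : SmoothFn m Y) (w : Lp ℂ 2 μ), IsLaplacePower g μ (s / 2) ξ v.1 w →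
    ∃ w' : Lp ℂ 2 μ,
      IsLaplacePower g μ ((s - d) / 2) ξ
        (fun y => besselPower N (fun x' => (p x' ξ v).1 y) x) w' ∧
      ‖w'‖ ≤ Cp * ‖w‖

/-- Distributions on `ℝⁿ × Y` that are functions `U` of `x ∈ ℝⁿ` with values in distributions on `Y`;
`U x φ` stands for `⟨φ, U(x)⟩`, conjugate linear in `φ`. -/
abbrev DistFn (n : ℕ) (Y : Type*) : Type _ := Euc n → (Y → ℂ) → ℂ

/-- A function on `ℝⁿ × Y`, as a distribution. -/
def DistFn.ofFun (μ : Measure Y) (u : Euc n × Y → ℂ) : DistFn n Y :=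
  fun x φ => pairing μ φ fun y => u (x, y)

/-- The operator with operator-valued symbol `p`,
`(Pu)(x) = (2π)^{-n} ∫ e^{i x·ξ} p(x, ξ) û(ξ) dξ`; the integral is taken weakly on `Y`. -/
def quantize (μ : Measure Y) (p : Euc n → Euc n → SmoothFn m Y →ₗ[ℂ] SmoothFn m Y)
    (u : TestFn m Y n) : DistFn n Y :=
  fun x φ => fourierInvR (fun ξ => pairing μ φ (p x ξ (partialFourier u ξ)).1) x

/-- The Sobolev space `H^s(ℝⁿ × Y)`. A distribution `U` in `H^s(ℝⁿ × Y)` is stored as the element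
`(2π)^{-n/2} (1 + Δ_Y + |ζ|²)^{s/2} Û(ζ)` of `L²(ℝⁿ × Y)`, the Fourier transform being taken in `ℝⁿ`;
this is an isometric isomorphism of `H^s(ℝⁿ × Y)`, with the norm `‖(1 + Δ_X + Δ_Y)^{s/2} U‖_{L²}`,
onto `L²(ℝⁿ × Y)`. -/
abbrev SobolevSpace (n : ℕ) (μ : Measure Y) (_s : ℝ) : Type _ :=
  Lp ℂ 2 ((volume : Measure (Euc n)).prod μ)

/-- The distribution `U` belongs to `H^s(ℝⁿ × Y)` and is the element `f` of it. -/
def IsSobolevElement (g : RMetric m Y) (μ : Measure Y) (s : ℝ) (U : DistFn n Y)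
    (f : SobolevSpace n μ s) : Prop :=
  ∀ (lam : ℝ) (e : SmoothFn m Y), IsEigenfn g μ lam e → ∀ᵐ ζ : Euc n,
    pairing μ e.1 (fun y => f (ζ, y)) =
      (((2 * Real.pi) ^ (-(n : ℝ) / 2) * (1 + lam + ‖ζ‖ ^ 2) ^ (s / 2) : ℝ) : ℂ) *
        fourierR (fun x => U x e.1) ζ

end Operators

end

noncomputable section

/-! ### The Bessel multiplier -/

section Multiplier

open scoped FourierTransform SchwartzMap

variable {H : Type*} [NormedAddCommGroup H]

/-! The Fourier transform in x turns P into an integral operator in the frequencies: the transform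
of Pu at ζ is (2π)^{-n} ∫ p̃(ζ - ξ, ξ) û(ξ) dξ, where p̃(·, ξ) is the Fourier transform of x ↦ p(x,
ξ) (`fourierR_quantize`). With the Sobolev weights, its kernel is (1 + Δ_Y + |ζ|²)^{(s-d)/2} p̃(ζ -
ξ, ξ) (1 + Δ_Y + |ξ|²)^{-s/2}. It suffices to bound the norm of this operator on L²(Y) by an
integrable function of ζ - ξ; Young's inequality `lintegral_conv_sq_le` does the rest.

The decay in η = ζ - ξ comes from the hypothesis on (1 + Δ_X)^N p. For general N this operator is
not local, so the hypothesis is only a sup bound over all x and cannot simply be integrated. Take a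
cutoff χ equal to 1 on K and move the inverse power onto the modulated cutoff: p̃(η, ξ) = ∫ κ_η(y)
((1 + Δ_X)^N p)(y, ξ) dy with κ_η = (1 + Δ_X)^{-N}(χ e^{-iy·η}), and κ_η has L¹ norm O((1 +
|η|²)^{-N}) (`exists_besselKernel`, `exists_fourier_symbol_bound`). The hypothesis has the weight at
ξ instead of ζ; Peetre's inequality exchanges them at the cost of (1 + |ζ - ξ|²)^{|s-d|/2}
(`exists_fourier_symbol_bound_shift`). What is left, (1 + |ζ - ξ|²)^{-(N - |s-d|/2)}, is integrable
precisely because N > (n + |s-d|)/2.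

The functional calculus of Δ_Y is used only weakly, through pairings with smooth eigenfunctions.
Needed are the orthogonality of eigenspaces and the nonnegativity of the eigenvalues, both from
Green's formula; neither the spectral theorem nor the completeness of the eigenfunctions enters.
Vectors with prescribed pairings are produced by the Riesz theorem (`exists_inner_eq`), and passing
to the closed span of the eigenfunctions makes them unique. The same device on ℝⁿ × Y, with the
vectors 1_A(ζ) e(y), assembles an L² function from pointwise data without a measurable selection
(`exists_eigenSpan_pairing_eq`).

Qualitative facts are needed for Fubini. Integration by parts in charts realizes Δ_Y on test
functions (`exists_laplacian`), so û(ξ) lies in the domain of every power of 1 + Δ_Y + |ξ|², with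
rapid decay in ξ. Joint continuity of (x, ξ) ↦ ⟨e, p(x, ξ) û(ξ)⟩ follows from the smoothness of p on
fixed functions together with the operator bound. -/

theorem peetre_aux (a b : H) : 1 + ‖a‖ ^ 2 ≤ 2 * (1 + ‖b‖ ^ 2) * (1 + ‖a - b‖ ^ 2) := by
  have h1 : ‖a‖ ≤ ‖b‖ + ‖a - b‖ := by simpa using norm_add_le b (a - b)
  nlinarith [sq_nonneg (‖b‖ - ‖a - b‖), norm_nonneg a, norm_nonneg b, norm_nonneg (a - b),
    mul_nonneg (sq_nonneg ‖b‖) (sq_nonneg ‖a - b‖), pow_le_pow_left₀ (norm_nonneg a) h1 2]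

/-- Peetre's inequality, with a spectral parameter `lam`. -/
theorem peetre {lam : ℝ} (hlam : 0 ≤ lam) (a b : H) (r : ℝ) :
    ((1 + lam + ‖a‖ ^ 2) / (1 + lam + ‖b‖ ^ 2)) ^ r ≤ (2 * (1 + ‖a - b‖ ^ 2)) ^ |r| := by
  have key : ∀ a b : H, (1 + lam + ‖a‖ ^ 2) / (1 + lam + ‖b‖ ^ 2) ≤ 2 * (1 + ‖a - b‖ ^ 2) := by
    intro a b
    rw [div_le_iff₀ (by positivity)]
    have := peetre_aux a b
    nlinarith [mul_nonneg hlam (sq_nonneg ‖a - b‖)]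
  have hpos : 0 < (1 + lam + ‖a‖ ^ 2) / (1 + lam + ‖b‖ ^ 2) := by positivity
  rcases le_total 0 r with hr | hr
  · rw [abs_of_nonneg hr]
    exact Real.rpow_le_rpow hpos.le (key a b) hr
  · rw [abs_of_nonpos hr]
    calc ((1 + lam + ‖a‖ ^ 2) / (1 + lam + ‖b‖ ^ 2)) ^ r
        = ((1 + lam + ‖b‖ ^ 2) / (1 + lam + ‖a‖ ^ 2)) ^ (-r) := by
          rw [Real.rpow_neg (by positivity), ← Real.inv_rpow (by positivity), inv_div]
      _ ≤ _ := by
          refine Real.rpow_le_rpow (by positivity) ?_ (by linarith)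
          rw [norm_sub_rev]; exact key b a

variable [InnerProductSpace ℝ H]

/-- Division by the value `R` at `a` makes the derivatives at `a` bounded independently of `a`: the
first is controlled by 2c|a| ≤ 1 + c²|a|², the second is constant up to R⁻¹ ≤ 1, the others vanish.
This is the inner function in the chain rule for powers of 1 + c²|x|². -/
theorem norm_iteratedFDeriv_scaled_sq_le (c R : ℝ) (hc : 0 < c) (a : H)
    (hR : R = 1 + c ^ 2 * ‖a‖ ^ 2) (i : ℕ) (hi : 1 ≤ i) :
    ‖iteratedFDeriv ℝ i (fun x : H => R⁻¹ * (1 + c ^ 2 * ‖x‖ ^ 2)) a‖ ≤ (2 * c) ^ i := by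
  have hR1 : 1 ≤ R := by rw [hR]; nlinarith [mul_nonneg (sq_nonneg c) (sq_nonneg ‖a‖)]
  have hfd : fderiv ℝ (fun x : H => R⁻¹ * (1 + c ^ 2 * ‖x‖ ^ 2))
      = fun x => ((R⁻¹ * (c ^ 2 * 2)) • (innerSL ℝ : H →L[ℝ] H →L[ℝ] ℝ)) x := by
    funext x
    have h1 : HasFDerivAt (fun x : H => ‖x‖ ^ 2) (2 • innerSL ℝ x) x :=
      (hasStrictFDerivAt_norm_sq x).hasFDerivAt
    have h2 := ((h1.const_mul (c ^ 2)).const_add 1).const_mul R⁻¹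
    rw [h2.fderiv]
    ext v
    simp
    ring
  obtain ⟨j, rfl⟩ : ∃ j, i = j + 1 := ⟨i - 1, by omega⟩
  rw [← norm_iteratedFDeriv_fderiv, hfd]
  have hcoef : 0 ≤ R⁻¹ * (c ^ 2 * 2) := by positivity
  have hRi : R⁻¹ ≤ 1 := inv_le_one_of_one_le₀ hR1
  rcases j with _ | j
  · rw [norm_iteratedFDeriv_zero]
    rw [smul_apply, norm_smul, innerSL_apply_norm, Real.norm_of_nonneg hcoef]
    rw [zero_add, pow_one, mul_assoc, inv_mul_le_iff₀ (by positivity), hR]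
    nlinarith [sq_nonneg (c * ‖a‖ - 1), mul_pos hc hc]
  · rw [← norm_iteratedFDeriv_fderiv]
    have : fderiv ℝ (fun x => ((R⁻¹ * (c ^ 2 * 2)) • (innerSL ℝ : H →L[ℝ] H →L[ℝ] ℝ)) x)
        = fun _ => ((R⁻¹ * (c ^ 2 * 2)) • (innerSL ℝ : H →L[ℝ] H →L[ℝ] ℝ)) := by
      funext x
      exact ContinuousLinearMap.fderiv _
    rw [this]
    rcases j with _ | j
    · rw [norm_iteratedFDeriv_zero, norm_smul, Real.norm_of_nonneg hcoef]
      have hn : ‖(innerSL ℝ : H →L[ℝ] H →L[ℝ] ℝ)‖ ≤ 1 := norm_innerSL_le ℝ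
      calc R⁻¹ * (c ^ 2 * 2) * ‖(innerSL ℝ : H →L[ℝ] H →L[ℝ] ℝ)‖ ≤ 1 * (c ^ 2 * 2) * 1 := by gcongr
        _ ≤ (2 * c) ^ (0 + 1 + 1) := by
          rw [show (2 * c) ^ (0 + 1 + 1) = 4 * (c * c) by ring]
          nlinarith [mul_pos hc hc]
    · rw [iteratedFDeriv_const_of_ne (by omega)]
      simp only [Pi.zero_apply, norm_zero]
      positivity

/-- All derivatives of `(1 + c²|x|²)^r` are bounded by multiples of the function. -/
theorem exists_norm_iteratedFDeriv_rpow_le (c : ℝ) (hc : 0 < c) (r : ℝ) (k : ℕ) :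
    ∃ C : ℝ, 0 ≤ C ∧ ∀ i ≤ k, ∀ x : H,
      ‖iteratedFDeriv ℝ i (fun x : H => (1 + c ^ 2 * ‖x‖ ^ 2) ^ r) x‖
        ≤ C * (1 + c ^ 2 * ‖x‖ ^ 2) ^ r := by
  set A : ℝ := ∑ j ∈ Finset.range (k + 1), ‖Polynomial.eval r (descPochhammer ℝ j)‖
  have hA : 0 ≤ A := by positivity
  set D : ℝ := ∑ i ∈ Finset.range (k + 1), (i.factorial : ℝ) * A * (2 * c) ^ i
  refine ⟨D, by positivity, fun i hi a => ?_⟩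
  set R := 1 + c ^ 2 * ‖a‖ ^ 2 with hR
  have hR0 : 0 < R := by positivity
  -- Homogeneity of the power: the outer function is evaluated only near 1, and the factor R^r is
  -- the desired bound.
  have hcomp : (fun x : H => (1 + c ^ 2 * ‖x‖ ^ 2) ^ r)
      = (fun s : ℝ => R ^ r * s ^ r) ∘ fun x : H => R⁻¹ * (1 + c ^ 2 * ‖x‖ ^ 2) := by
    funext x
    simp only [Function.comp]
    rw [← Real.mul_rpow hR0.le (by positivity)]
    congr 1
    field_simp
  have hopen : IsOpen (Ioi (0 : ℝ)) := isOpen_Ioi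
  have hg : ContDiffOn ℝ ∞ (fun s : ℝ => R ^ r * s ^ r) (Ioi 0) :=
    contDiffOn_const.mul (contDiffOn_fun_id.rpow_const_of_ne fun x hx => (ne_of_gt hx))
  have hf : ContDiff ℝ ∞ (fun x : H => R⁻¹ * (1 + c ^ 2 * ‖x‖ ^ 2)) :=
    contDiff_const.mul (contDiff_const.add (contDiff_const.mul (contDiff_norm_sq ℝ)))
  rw [hcomp]
  have hR1 : R⁻¹ * (1 + c ^ 2 * ‖a‖ ^ 2) = 1 := inv_mul_cancel₀ hR0.ne'
  have := norm_iteratedFDeriv_comp_le' (n := i) (C := A * R ^ r) (D := 2 * c)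
    (t := Ioi (0 : ℝ)) (by rintro - ⟨x, rfl⟩; exact mem_Ioi.2 (by positivity))
    hopen.uniqueDiffOn hg hf (mod_cast le_top) a ?_ ?_
  · refine this.trans ?_
    have hmem : i ∈ Finset.range (k + 1) := by simp; omega
    have hle : (i.factorial : ℝ) * A * (2 * c) ^ i ≤ D :=
      Finset.single_le_sum (f := fun i : ℕ => (i.factorial : ℝ) * A * (2 * c) ^ i)
        (fun i _ => by positivity) hmem
    calc (i.factorial : ℝ) * (A * R ^ r) * (2 * c) ^ i
        = ((i.factorial : ℝ) * A * (2 * c) ^ i) * R ^ r := by ring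
      _ ≤ D * R ^ r := by gcongr
  · intro j hj
    simp only [hR1]
    have hd : ContDiffAt ℝ j (fun x : ℝ => R ^ r * x ^ r) 1 :=
      contDiffAt_const.mul (Real.contDiffAt_rpow_const (Or.inl one_ne_zero))
    have hd' : ContDiffAt ℝ j (fun x : ℝ => x ^ r) 1 :=
      Real.contDiffAt_rpow_const (Or.inl one_ne_zero)
    rw [norm_iteratedFDerivWithin_eq_norm_iteratedDerivWithin,
      iteratedDerivWithin_eq_iteratedDeriv hopen.uniqueDiffOn hd (mem_Ioi.2 one_pos),
      iteratedDeriv_const_mul_field, iteratedDeriv_eq_iterate,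
      Real.iter_deriv_rpow_const, norm_mul, norm_mul]
    have hmem : j ∈ Finset.range (k + 1) := by simp; omega
    have hle : ‖Polynomial.eval r (descPochhammer ℝ j)‖ ≤ A :=
      Finset.single_le_sum (f := fun j : ℕ => ‖Polynomial.eval r (descPochhammer ℝ j)‖)
        (fun i _ => by positivity) hmem
    rw [Real.one_rpow, norm_one, mul_one, Real.norm_of_nonneg (by positivity), mul_comm]
    gcongr
  · intro j hj1 _
    exact norm_iteratedFDeriv_scaled_sq_le c R hc a hR j hj1

theorem hasTemperateGrowth_scaled_rpow (c : ℝ) (hc : 0 < c) (r : ℝ) (b : H) :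
    (fun x : H => (1 + c ^ 2 * ‖x + b‖ ^ 2) ^ r).HasTemperateGrowth := by
  have h := (Function.hasTemperateGrowth_one_add_norm_sq_rpow H r).comp
    (f := fun x : H => c • (x + b)) (by fun_prop)
  convert! h using 2 with x
  rw [Function.comp_apply, norm_smul, mul_pow, Real.norm_of_nonneg hc.le]

end Multiplier

/-! ### Kernel of the Bessel potential acting on a modulated cutoff -/

section Kernel

open scoped FourierTransform SchwartzMap Real

variable {k : ℕ}

/-- The two normalizations differ by the substitution ξ = 2πθ; (1 + |ξ|²)^N then becomes
`besselSymbol`. -/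
theorem fourierR_eq (f : Euc k → ℂ) (ξ : Euc k) : fourierR f ξ = 𝓕 f ((2 * π)⁻¹ • ξ) := by
  rw [fourierR, Real.fourier_eq']
  congr 1
  funext x
  rw [smul_eq_mul, inner_smul_right]
  congr 2
  have : (π : ℂ) ≠ 0 := by exact_mod_cast Real.pi_ne_zero
  push_cast
  field_simp

theorem fourier_eq_fourierR (f : Euc k → ℂ) (θ : Euc k) : 𝓕 f θ = fourierR f ((2 * π) • θ) := by
  rw [fourierR_eq, smul_smul, inv_mul_cancel₀ (by positivity), one_smul]

theorem fourierInvR_eq (f : Euc k → ℂ) (x : Euc k) :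
    fourierInvR f x = 𝓕⁻ (fun θ => f ((2 * π) • θ)) x := by
  rw [fourierInvR, Real.fourierInv_eq']
  have h := Measure.integral_comp_smul (volume : Measure (Euc k))
    (fun ξ => Complex.exp (Complex.I * (inner ℝ x ξ : ℝ)) * f ξ) (2 * π)
  rw [finrank_euclideanSpace_fin, abs_of_pos (by positivity)] at h
  rw [← Complex.ofReal_inv, ← Complex.real_smul, ← h]
  congr 1
  funext θ
  rw [smul_eq_mul, inner_smul_right, real_inner_comm]
  congr 2
  push_cast
  ring

/-- The multiplier of `(1 + Δ_X)^r` in the normalization of Mathlib's Fourier transform. -/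
abbrev besselSymbol (r : ℝ) (θ : Euc k) : ℝ := (1 + (2 * π) ^ 2 * ‖θ‖ ^ 2) ^ r

theorem besselPower_eq (N : ℝ) (f : Euc k → ℂ) (x : Euc k) :
    besselPower N f x = 𝓕⁻ (fun θ => (besselSymbol N θ : ℂ) * 𝓕 f θ) x := by
  rw [besselPower, fourierInvR_eq]
  congr! 2 with θ
  rw [fourier_eq_fourierR, besselSymbol, norm_smul, mul_pow, Real.norm_of_nonneg (by positivity)]

/-- Peetre's inequality with exponent -N: decay in the shift η is bought with growth in θ, which a
Schwartz function absorbs. -/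
theorem besselSymbol_shift_le {N : ℝ} (hN : 0 ≤ N) (θ η : Euc k) :
    besselSymbol (-N) (θ + η) ≤ 2 ^ N * besselSymbol (-N) η * besselSymbol N θ := by
  have h := peetre (lam := 0) le_rfl ((2 * π) • (θ + η)) ((2 * π) • η) (-N)
  rw [abs_neg, abs_of_nonneg hN, ← smul_sub, add_sub_cancel_right] at h
  simp only [norm_smul, mul_pow, add_zero, Real.norm_of_nonneg (by positivity : (0:ℝ) ≤ 2 * π)] at h
  rw [Real.div_rpow (by positivity) (by positivity), div_le_iff₀ (by positivity),
    Real.mul_rpow (by positivity) (by positivity)] at h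
  simp only [besselSymbol]
  simp only [mul_pow] at *
  linarith

/-- Multiplication by `(1 + |2π(θ + η)|²)^{-N}` is bounded on Schwartz space by
`(1 + |2πη|²)^{-N}`. -/
theorem exists_seminorm_besselSymbol_smul_le {N : ℝ} (hN : 0 ≤ N) (f : 𝓢(Euc k, ℂ)) (a b : ℕ) :
    ∃ C : ℝ, 0 ≤ C ∧ ∀ η : Euc k,
      SchwartzMap.seminorm ℝ a b
        (SchwartzMap.smulLeftCLM ℂ (fun θ : Euc k => besselSymbol (-N) (θ + η)) f)
        ≤ C * besselSymbol (-N) η := by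
  have hc : 0 < 2 * π := by positivity
  obtain ⟨C₁, hC₁, h₁⟩ := exists_norm_iteratedFDeriv_rpow_le (H := Euc k) (2 * π) hc (-N) b
  obtain ⟨M, hM⟩ := exists_nat_ge N
  set S : ℝ := 2 ^ (a + 2 * M) * ((Finset.Iic (a + 2 * M, b)).sup
    (fun m : ℕ × ℕ => SchwartzMap.seminorm ℝ m.1 m.2)) f with hS
  have hS0 : 0 ≤ S := mul_nonneg (by positivity) (apply_nonneg _ _)
  -- The growth of `besselSymbol N` is dominated by a polynomial of degree 2M with M ≥ N an integer,
  -- hence by a Schwartz seminorm of `f`.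
  have hf : ∀ j ≤ b, ∀ x : Euc k, ‖x‖ ^ a * besselSymbol N x * ‖iteratedFDeriv ℝ j f x‖
      ≤ ((2 * π) ^ 2) ^ M * S := by
    intro j hj x
    have h2 := SchwartzMap.one_add_le_sup_seminorm_apply (𝕜 := ℝ) (m := (a + 2 * M, b))
      (k := a + 2 * M) (n := j) le_rfl hj f x
    have hpi : 1 ≤ (2 * π) ^ 2 := by nlinarith [Real.pi_gt_three]
    have h3 : besselSymbol N x ≤ ((2 * π) ^ 2) ^ M * (1 + ‖x‖) ^ (2 * M) := by
      calc besselSymbol N x ≤ (1 + (2 * π) ^ 2 * ‖x‖ ^ 2) ^ (M : ℝ) :=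
            Real.rpow_le_rpow_of_exponent_le (le_add_of_nonneg_right (by positivity)) hM
        _ = (1 + (2 * π) ^ 2 * ‖x‖ ^ 2) ^ M := Real.rpow_natCast _ _
        _ ≤ ((2 * π) ^ 2 * (1 + ‖x‖) ^ 2) ^ M := by
            gcongr
            nlinarith [norm_nonneg x, mul_nonneg (sq_nonneg (2 * π)) (norm_nonneg x)]
        _ = _ := by rw [mul_pow, ← pow_mul (1 + ‖x‖)]
    calc ‖x‖ ^ a * besselSymbol N x * ‖iteratedFDeriv ℝ j f x‖
        ≤ (1 + ‖x‖) ^ a * (((2 * π) ^ 2) ^ M * (1 + ‖x‖) ^ (2 * M)) * ‖iteratedFDeriv ℝ j f x‖ := by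
          gcongr
          linarith
      _ = ((2 * π) ^ 2) ^ M * ((1 + ‖x‖) ^ (a + 2 * M) * ‖iteratedFDeriv ℝ j f x‖) := by ring
      _ ≤ _ := by gcongr
  refine ⟨(∑ i ∈ Finset.range (b + 1), (b.choose i : ℝ)) *
    (C₁ * 2 ^ N * (((2 * π) ^ 2) ^ M * S)), by positivity, fun η => ?_⟩
  refine SchwartzMap.seminorm_le_bound ℝ a b _ (by positivity) fun x => ?_
  have htg := hasTemperateGrowth_scaled_rpow (H := Euc k) (2 * π) hc (-N) η
  rw [SchwartzMap.smulLeftCLM_apply htg]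
  have hL := norm_iteratedFDeriv_smul_le (𝕜 := ℝ) (n := b) (N := ∞) htg.1 (f.smooth ⊤) x
    (mod_cast le_top)
  have hshift : ∀ i, iteratedFDeriv ℝ i (fun θ : Euc k => besselSymbol (-N) (θ + η)) x
      = iteratedFDeriv ℝ i (fun θ : Euc k => besselSymbol (-N) θ) (x + η) := by
    intro i
    exact iteratedFDeriv_comp_add_right i η x
  calc _ ≤ ‖x‖ ^ a * ∑ i ∈ Finset.range (b + 1), (b.choose i : ℝ) *
        ‖iteratedFDeriv ℝ i (fun θ : Euc k => besselSymbol (-N) (θ + η)) x‖ *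
          ‖iteratedFDeriv ℝ (b - i) f x‖ := by gcongr
    _ = ∑ i ∈ Finset.range (b + 1), (b.choose i : ℝ) * (‖x‖ ^ a *
        ‖iteratedFDeriv ℝ i (fun θ : Euc k => besselSymbol (-N) (θ + η)) x‖ *
          ‖iteratedFDeriv ℝ (b - i) f x‖) := by
        rw [Finset.mul_sum]; exact Finset.sum_congr rfl fun i _ => by ring
    _ ≤ ∑ i ∈ Finset.range (b + 1), (b.choose i : ℝ) *
        (C₁ * 2 ^ N * (((2 * π) ^ 2) ^ M * S) * besselSymbol (-N) η) := by
        refine Finset.sum_le_sum fun i hi => ?_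
        refine mul_le_mul_of_nonneg_left ?_ (Nat.cast_nonneg _)
        rw [hshift]
        have hi' : i ≤ b := by simp at hi; omega
        calc ‖x‖ ^ a * ‖iteratedFDeriv ℝ i (fun θ : Euc k => besselSymbol (-N) θ) (x + η)‖ *
              ‖iteratedFDeriv ℝ (b - i) f x‖
            ≤ ‖x‖ ^ a * (C₁ * (2 ^ N * besselSymbol (-N) η * besselSymbol N x)) *
              ‖iteratedFDeriv ℝ (b - i) f x‖ := by
              gcongr
              exact (h₁ i hi' _).trans (by gcongr; exact besselSymbol_shift_le hN x η)
          _ = C₁ * 2 ^ N * besselSymbol (-N) η *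
              (‖x‖ ^ a * besselSymbol N x * ‖iteratedFDeriv ℝ (b - i) f x‖) := by ring
          _ ≤ C₁ * 2 ^ N * besselSymbol (-N) η * (((2 * π) ^ 2) ^ M * S) := by
              refine mul_le_mul_of_nonneg_left (hf _ (by omega) x) (by positivity)
          _ = _ := by ring
    _ = _ := by rw [← Finset.sum_mul]; ring

/-- The `L¹` norm of the Fourier transform is bounded by finitely many Schwartz seminorms. -/
theorem exists_integral_norm_fourier_le_seminorm (k : ℕ) :
    ∃ (s : Finset (ℕ × ℕ)) (C : ℝ), 0 ≤ C ∧ ∀ f : 𝓢(Euc k, ℂ),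
      ∫ x, ‖𝓕 f x‖ ≤ C * ∑ m ∈ s, SchwartzMap.seminorm ℝ m.1 m.2 f := by
  -- The Fourier transform is continuous from Schwartz space to L¹, and continuity is the same as a
  -- bound by finitely many seminorms.
  let L : 𝓢(Euc k, ℂ) →L[ℝ] Lp ℂ 1 (volume : Measure (Euc k)) :=
    (SchwartzMap.toLpCLM ℝ ℂ 1 (volume : Measure (Euc k))).comp
      (FourierTransform.fourierCLM ℝ 𝓢(Euc k, ℂ))
  obtain ⟨s, C, hC, h⟩ := Seminorm.bound_of_continuous (schwartz_withSeminorms ℝ (Euc k) ℂ)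
    ((normSeminorm ℝ _).comp L.toLinearMap) (continuous_norm.comp L.continuous)
  refine ⟨s, C, C.2, fun f => ?_⟩
  have h1 : ‖L f‖ = ∫ x, ‖𝓕 f x‖ := by
    rw [L1.norm_eq_integral_norm]
    refine integral_congr_ae ?_
    filter_upwards [(𝓕 f).coeFn_toLp 1 (volume : Measure (Euc k))] with x hx
    rw [← hx]
    rfl
  rw [← h1]
  refine (h f).trans ?_
  rw [smul_apply]
  refine mul_le_mul_of_nonneg_left ?_ C.2
  refine Seminorm.finset_sup_apply_le (Finset.sum_nonneg fun _ _ => apply_nonneg _ _) fun m hm => ?_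
  exact Finset.single_le_sum (f := fun m : ℕ × ℕ => SchwartzMap.seminorm ℝ m.1 m.2 f)
    (fun _ _ => apply_nonneg _ _) hm

theorem fourierInv_comp_add (G : Euc k → ℂ) (b y : Euc k) :
    𝓕⁻ (fun θ => G (θ + b)) y
      = Complex.exp (-((2 * π * inner ℝ y b : ℝ) * Complex.I)) * 𝓕⁻ G y := by
  rw [Real.fourierInv_eq', Real.fourierInv_eq', ← integral_const_mul]
  rw [← integral_add_right_eq_self (fun θ => Complex.exp (-((2 * π * inner ℝ y b : ℝ) * Complex.I))
    * (Complex.exp ((2 * π * inner ℝ θ y : ℝ) * Complex.I) • G θ)) b]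
  congr 1
  funext θ
  rw [inner_add_left, smul_eq_mul, smul_eq_mul, ← mul_assoc, ← Complex.exp_add,
    real_inner_comm b y]
  congr 2
  push_cast
  ring

theorem fourier_apply_add (a : Euc k → ℂ) (θ b : Euc k) :
    𝓕 a (θ + b)
      = 𝓕 (fun x => Complex.exp (-((2 * π * inner ℝ x b : ℝ) * Complex.I)) * a x) θ := by
  rw [Real.fourier_eq', Real.fourier_eq']
  congr 1
  funext x
  rw [inner_add_right, smul_eq_mul, smul_eq_mul, ← mul_assoc, ← Complex.exp_add]
  congr 2
  push_cast
  ring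

theorem integral_fourier_mul_eq {f g : Euc k → ℂ} (hf : Integrable f) (hg : Integrable g) :
    ∫ ξ, 𝓕 f ξ * g ξ = ∫ x, f x * 𝓕 g x := by
  simpa using! VectorFourier.integral_bilin_fourierIntegral_eq_flip (.mul ℂ ℂ) (L := innerₗ (Euc k))
    Real.continuous_fourierChar continuous_inner hf hg

/-- Parseval's formula with a merely integrable `G`: inversion is applied to the Schwartz factor
only. -/
theorem integral_fourier_mul_fourierInv (φ : 𝓢(Euc k, ℂ)) {G : Euc k → ℂ} (hG : Integrable G) :
    ∫ y, 𝓕 φ y * 𝓕⁻ G y = ∫ θ, φ θ * G θ := by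
  have h := integral_fourier_mul_eq (𝓕⁻ φ : 𝓢(Euc k, ℂ)).integrable hG
  rw [← SchwartzMap.fourier_coe, FourierTransform.fourier_fourierInv_eq] at h
  rw [h, ← integral_neg_eq_self]
  congr 1
  funext y
  rw [SchwartzMap.fourierInv_coe, SchwartzMap.fourier_coe, Real.fourierInv_eq_fourier_neg,
    Real.fourierInv_eq_fourier_neg, neg_neg]

theorem exists_schwartz_eq_one_on {K : Set (Euc k)} (hK : IsCompact K) :
    ∃ χ : 𝓢(Euc k, ℂ), ∀ x ∈ K, χ x = 1 := by
  obtain ⟨R, hR⟩ := hK.isBounded.subset_closedBall 0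
  let χ : ContDiffBump (0 : Euc k) := ⟨max R 1, max R 1 + 1, by positivity, by linarith⟩
  have h1 : HasCompactSupport (fun x => (χ x : ℂ)) :=
    χ.hasCompactSupport.comp_left (g := fun t : ℝ => (t : ℂ)) Complex.ofReal_zero
  refine ⟨h1.toSchwartzMap (Complex.ofRealCLM.contDiff.comp χ.contDiff), fun x hx => ?_⟩
  have := χ.one_of_mem_closedBall (Metric.closedBall_subset_closedBall (le_max_left R 1) (hR hx))
  show (χ x : ℂ) = 1
  rw [this, Complex.ofReal_one]

/-- A function supported in a fixed compact set has the Fourier coefficient at `η` given by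
integrating `(1 + Δ_X)^N a` against a kernel whose `L¹` norm is `O((1 + |η|²)^{-N})`. -/
theorem exists_besselKernel {N : ℝ} (hN : 0 ≤ N) {K : Set (Euc k)} (hK : IsCompact K) :
    ∃ A : ℝ, 0 ≤ A ∧ ∀ η : Euc k, ∃ κ : Euc k → ℂ, Integrable κ ∧
      ∫ y, ‖κ y‖ ≤ A * (1 + ‖η‖ ^ 2) ^ (-N) ∧
      ∀ a : Euc k → ℂ, Continuous a → (∀ x ∉ K, a x = 0) →
        Integrable (fun θ => (((1 + ‖θ‖ ^ 2) ^ N : ℝ) : ℂ) * fourierR a θ) →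
        fourierR a η = ∫ y, κ y * besselPower N a y := by
  obtain ⟨χ, hχ⟩ := exists_schwartz_eq_one_on hK
  set g : 𝓢(Euc k, ℂ) := 𝓕⁻ χ with hg
  obtain ⟨s, C, hC, hL⟩ := exists_integral_norm_fourier_le_seminorm k
  choose D hD0 hD using fun m : ℕ × ℕ => exists_seminorm_besselSymbol_smul_le hN g m.1 m.2
  refine ⟨C * ∑ m ∈ s, D m, mul_nonneg hC (Finset.sum_nonneg fun m _ => hD0 m), fun η => ?_⟩
  set b : Euc k := (2 * π)⁻¹ • η with hb
  have hηb : η = (2 * π) • b := by rw [hb, smul_smul, mul_inv_cancel₀ (by positivity), one_smul]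
  have htg := hasTemperateGrowth_scaled_rpow (H := Euc k) (2 * π) (by positivity) (-N) b
  -- The kernel e · 𝓕φ is (1 + Δ)^{-N} applied to the modulated cutoff e · χ: the modulation by b =
  -- η/2π shifts the multiplier by b.
  set φ : 𝓢(Euc k, ℂ) := SchwartzMap.smulLeftCLM ℂ (fun θ => besselSymbol (-N) (θ + b)) g with hφ
  set e : Euc k → ℂ := fun y => Complex.exp (-((2 * π * inner ℝ y b : ℝ) * Complex.I)) with he
  have he1 : ∀ y, ‖e y‖ = 1 := fun y => by
    rw [he]; simp only [← neg_mul, ← Complex.ofReal_neg, Complex.norm_exp_ofReal_mul_I]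
  have hec : Continuous e := by fun_prop
  have hsymb : besselSymbol (-N) b = (1 + ‖η‖ ^ 2) ^ (-N) := by
    rw [hηb, norm_smul, mul_pow, Real.norm_of_nonneg (by positivity)]
  refine ⟨fun y => e y * 𝓕 φ y, ?_, ?_, fun a ha haK hai => ?_⟩
  · exact (𝓕 φ).integrable.bdd_mul hec.aestronglyMeasurable (Eventually.of_forall fun y => (he1 y).le)
  · simp only [norm_mul, he1, one_mul]
    refine (hL φ).trans ?_
    rw [← hsymb, mul_assoc, Finset.sum_mul]
    gcongr with m hm
    exact hD m b
  · have hac : HasCompactSupport a := HasCompactSupport.intro hK haK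
    have haint : Integrable a := ha.integrable_of_hasCompactSupport hac
    set G : Euc k → ℂ := fun θ => (besselSymbol N θ : ℂ) * 𝓕 a θ with hGdef
    have hG : Integrable G := by
      have := hai.comp_smul (R := 2 * π) (by positivity)
      refine this.congr (Eventually.of_forall fun θ => ?_)
      simp only [hGdef, fourier_eq_fourierR, besselSymbol, norm_smul, mul_pow,
        Real.norm_of_nonneg (by positivity : (0:ℝ) ≤ 2 * π)]
    have h1 : ∀ y, e y * 𝓕 φ y * besselPower N a y = 𝓕 φ y * 𝓕⁻ (fun θ => G (θ + b)) y := by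
      intro y
      rw [besselPower_eq, fourierInv_comp_add]
      ring
    simp only [h1]
    rw [integral_fourier_mul_fourierInv φ (hG.comp_add_right b)]
    -- The multipliers of exponents -N and N cancel. What remains is the transform of e · a paired
    -- with 𝓕⁻χ, that is ∫ e a χ, and χ = 1 where a ≠ 0.
    have h2 : ∀ θ, φ θ * G (θ + b) = 𝓕 (fun x => e x * a x) θ * g θ := by
      intro θ
      rw [hφ, SchwartzMap.smulLeftCLM_apply_apply htg, hGdef, Complex.real_smul]
      simp only
      rw [← fourier_apply_add]
      have : ((1 + (2 * π) ^ 2 * ‖θ + b‖ ^ 2) ^ (-N) : ℝ) * (besselSymbol N (θ + b)) = 1 := by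
        rw [besselSymbol, ← Real.rpow_add (by positivity), neg_add_cancel, Real.rpow_zero]
      have h3 : (((1 + (2 * π) ^ 2 * ‖θ + b‖ ^ 2) ^ (-N) : ℝ) : ℂ) * (besselSymbol N (θ + b) : ℂ)
          = 1 := by exact_mod_cast this
      linear_combination (g θ * 𝓕 a (θ + b)) * h3
    simp only [h2]
    have hea : Integrable (fun x => e x * a x) :=
      haint.bdd_mul hec.aestronglyMeasurable (Eventually.of_forall fun y => (he1 y).le)
    have h := integral_fourier_mul_eq hea g.integrable
    rw [h, ← SchwartzMap.fourier_coe, hg, FourierTransform.fourier_fourierInv_eq, fourierR]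
    congr 1
    funext x
    by_cases hx : x ∈ K
    · rw [hχ x hx, mul_one, he, hηb, inner_smul_right]
      simp only
      congr 3
      ring
    · rw [haK x hx]; simp

end Kernel

/-! ### The Riemannian metric in a chart -/

section ChartMetric

variable {m : ℕ} {Y : Type*} [TopologicalSpace Y] [ChartedSpace (Euc m) Y]
  [IsManifold 𝓘(ℝ, Euc m) ∞ Y]

/-- The coordinate vector fields of a chart. -/
def chartVec (κ : OpenPartialHomeomorph Y (Euc m)) (z : Euc m) (i : Fin m) :
    TangentSpace 𝓘(ℝ, Euc m) (κ.symm z) :=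
  mfderiv 𝓘(ℝ, Euc m) 𝓘(ℝ, Euc m) κ.symm z (EuclideanSpace.single i (1 : ℝ))

/-- The matrix `g_ij` of the metric in a chart. -/
def chartGram (g : RMetric m Y) (κ : OpenPartialHomeomorph Y (Euc m)) (z : Euc m) :
    Matrix (Fin m) (Fin m) ℝ :=
  g.gram (κ.symm z) (chartVec κ z)

variable {κ : OpenPartialHomeomorph Y (Euc m)}

theorem contMDiffOn_atlas_symm (hκ : κ ∈ atlas (Euc m) Y) :
    ContMDiffOn 𝓘(ℝ, Euc m) 𝓘(ℝ, Euc m) ∞ κ.symm κ.target :=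
  contMDiffOn_symm_of_mem_maximalAtlas (IsManifold.subset_maximalAtlas hκ)

theorem contMDiffOn_atlas (hκ : κ ∈ atlas (Euc m) Y) :
    ContMDiffOn 𝓘(ℝ, Euc m) 𝓘(ℝ, Euc m) ∞ κ κ.source :=
  contMDiffOn_of_mem_maximalAtlas (IsManifold.subset_maximalAtlas hκ)

theorem mdifferentiableAt_atlas_symm' (hκ : κ ∈ atlas (Euc m) Y) {z : Euc m} (hz : z ∈ κ.target) :
    MDifferentiableAt 𝓘(ℝ, Euc m) 𝓘(ℝ, Euc m) κ.symm z :=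
  ((contMDiffOn_atlas_symm hκ).contMDiffAt (κ.open_target.mem_nhds hz)).mdifferentiableAt (by simp)

/-- The coordinate fields are smooth sections along `κ.symm`, being the image of constant fields
under its tangent map; the smooth bundle metric is then evaluated on two of them. -/
theorem contDiffOn_chartGram (g : RMetric m Y) (hκ : κ ∈ atlas (Euc m) Y) (i j : Fin m) :
    ContDiffOn ℝ ∞ (fun z => chartGram g κ z i j) κ.target := by
  have h1 : ∀ i : Fin m, ContMDiffOn 𝓘(ℝ, Euc m) (𝓘(ℝ, Euc m).prod 𝓘(ℝ, Euc m)) ∞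
      (fun z => (⟨κ.symm z, chartVec κ z i⟩ : TangentBundle 𝓘(ℝ, Euc m) Y)) κ.target := by
    intro i
    have ht := (contMDiffOn_atlas_symm hκ).contMDiffOn_tangentMapWithin (m := ∞) (by simp)
      κ.open_target.uniqueMDiffOn
    have hs : ContMDiffOn 𝓘(ℝ, Euc m) (𝓘(ℝ, Euc m).prod 𝓘(ℝ, Euc m)) ∞
      (fun z : Euc m => (⟨z, (EuclideanSpace.single i (1 : ℝ) : Euc m)⟩ :
        TangentBundle 𝓘(ℝ, Euc m) (Euc m))) κ.target := by
      intro z _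
      rw [Bundle.contMDiffWithinAt_totalSpace]
      refine ⟨contMDiffWithinAt_id, ?_⟩
      simp
      exact contMDiffWithinAt_const
    refine (ht.comp hs (fun z hz => hz)).congr fun z hz => ?_
    simp only [Function.comp, tangentMapWithin, chartVec]
    rw [mfderivWithin_of_isOpen κ.open_target hz]
  rw [← contMDiffOn_iff_contDiffOn]
  have hb : ContMDiffOn 𝓘(ℝ, Euc m) 𝓘(ℝ, Euc m) ∞ κ.symm κ.target := contMDiffOn_atlas_symm hκ
  intro z hz
  have hG := (g.contMDiff.contMDiffAt (x := κ.symm z)).comp_contMDiffWithinAt z (hb z hz)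
  have := ContMDiffWithinAt.clm_bundle_apply₂ (F₁ := Euc m) (F₂ := Euc m) (F₃ := ℝ)
    (E₃ := Bundle.Trivial Y ℝ) hG (h1 i z hz) (h1 j z hz)
  simp only [Bundle.contMDiffWithinAt_totalSpace] at this
  exact this.2

/-- The coordinate vector fields, as vectors of `ℝᵐ` through the preferred chart. -/
def chartVecEuc (κ : OpenPartialHomeomorph Y (Euc m)) (z : Euc m) (i : Fin m) : Euc m :=
  chartVec κ z i

/-- The change of basis between the coordinate vectors of `κ` and the standard basis. -/
def chartJacobian (κ : OpenPartialHomeomorph Y (Euc m)) (z : Euc m) : Matrix (Fin m) (Fin m) ℝ :=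
  Matrix.of fun k i => chartVecEuc κ z i k

theorem chartVec_eq_sum (z : Euc m) (i : Fin m) :
    chartVec κ z i = ∑ k, chartJacobian κ z k i • tangentBasis (κ.symm z) k := by
  have := (EuclideanSpace.basisFun (Fin m) ℝ).sum_repr (chartVecEuc κ z i)
  simp only [EuclideanSpace.basisFun_repr, EuclideanSpace.basisFun_apply] at this
  exact this.symm

/-- The differential of `κ.symm` has the differential of `κ` as a left inverse, hence is injective;
its matrix in the standard bases is the Jacobian. -/
theorem isUnit_chartJacobian (hκ : κ ∈ atlas (Euc m) Y) {z : Euc m} (hz : z ∈ κ.target) :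
    IsUnit (chartJacobian κ z) := by
  have h1 := mdifferentiableAt_atlas_symm' hκ hz
  have h2 : MDifferentiableAt 𝓘(ℝ, Euc m) 𝓘(ℝ, Euc m) κ (κ.symm z) :=
    ((contMDiffOn_atlas hκ).contMDiffAt (κ.open_source.mem_nhds (κ.map_target hz))).mdifferentiableAt
      (by simp)
  have h3 : mfderiv 𝓘(ℝ, Euc m) 𝓘(ℝ, Euc m) (κ ∘ κ.symm) z
      = ContinuousLinearMap.id ℝ (TangentSpace 𝓘(ℝ, Euc m) z) := by
    rw [← mfderiv_id]
    refine Filter.EventuallyEq.mfderiv_eq ?_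
    filter_upwards [κ.open_target.mem_nhds hz] with x hx
    exact κ.right_inv hx
  rw [mfderiv_comp z h2 h1] at h3
  let L₀ : Euc m →L[ℝ] Euc m := mfderiv 𝓘(ℝ, Euc m) 𝓘(ℝ, Euc m) κ.symm z
  let L₁ : Euc m →L[ℝ] Euc m := mfderiv 𝓘(ℝ, Euc m) 𝓘(ℝ, Euc m) κ (κ.symm z)
  let L : Euc m →ₗ[ℝ] Euc m := L₀
  have h4 : L₁.comp L₀ = ContinuousLinearMap.id ℝ (Euc m) := h3
  have hinj : Function.Injective L := by
    intro a b hab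
    have ha := DFunLike.congr_fun h4 a
    have hb := DFunLike.congr_fun h4 b
    have hab' : L₀ a = L₀ b := hab
    rw [ContinuousLinearMap.comp_apply, hab'] at ha
    exact ha.symm.trans hb
  rw [← Matrix.mulVec_injective_iff_isUnit]
  intro a b hab
  have key : ∀ a : Fin m → ℝ, (chartJacobian κ z).mulVec a = L (WithLp.toLp 2 a) := by
    intro a
    have e : (WithLp.toLp 2 a : Euc m) = ∑ i, a i • EuclideanSpace.single i (1 : ℝ) := by
      have := (EuclideanSpace.basisFun (Fin m) ℝ).sum_repr (WithLp.toLp 2 a : Euc m)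
      simp only [EuclideanSpace.basisFun_repr, EuclideanSpace.basisFun_apply] at this
      exact this.symm
    rw [e, map_sum]
    funext k
    simp only [Matrix.mulVec, dotProduct, chartJacobian, Matrix.of_apply, map_smul]
    rw [WithLp.ofLp_sum, Finset.sum_apply]
    refine Finset.sum_congr rfl fun i _ => ?_
    rw [WithLp.ofLp_smul, Pi.smul_apply, smul_eq_mul, mul_comm]
    rfl
  rw [key, key] at hab
  have := hinj (WithLp.ofLp_injective 2 hab)
  exact WithLp.toLp_injective 2 this

theorem chartGram_eq (g : RMetric m Y) (z : Euc m) :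
    chartGram g κ z = (chartJacobian κ z).transpose * g.gram (κ.symm z) (tangentBasis (κ.symm z))
      * chartJacobian κ z := by
  ext i j
  rw [chartGram, RMetric.gram, Matrix.of_apply, chartVec_eq_sum, chartVec_eq_sum]
  simp only [map_sum, map_smul, sum_apply, smul_apply, Matrix.mul_apply, Matrix.transpose_apply,
    RMetric.gram, Matrix.of_apply, smul_eq_mul, Finset.sum_mul, Finset.mul_sum]
  refine Finset.sum_congr rfl fun a _ => ?_
  refine Finset.sum_congr rfl fun b _ => ?_
  ring

theorem gram_symm (g : RMetric m Y) (y : Y) (b : Fin m → TangentSpace 𝓘(ℝ, Euc m) y) :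
    (g.gram y b).transpose = g.gram y b := by
  ext i j
  exact g.symm y _ _

theorem gram_posDef (g : RMetric m Y) (y : Y) : (g.gram y (tangentBasis y)).PosDef := by
  rw [Matrix.posDef_iff_dotProduct_mulVec]
  refine ⟨gram_symm g y _, fun {x} hx => ?_⟩
  have hv : (∑ i, x i • tangentBasis y i : TangentSpace 𝓘(ℝ, Euc m) y)
      = (WithLp.toLp 2 x : Euc m) := by
    have := (EuclideanSpace.basisFun (Fin m) ℝ).sum_repr (WithLp.toLp 2 x : Euc m)
    simp only [EuclideanSpace.basisFun_repr, EuclideanSpace.basisFun_apply] at this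
    exact this
  have hne : (∑ i, x i • tangentBasis y i : TangentSpace 𝓘(ℝ, Euc m) y) ≠ 0 := by
    rw [hv]
    intro h
    exact hx ((WithLp.toLp_injective 2) h)
  have := g.pos y _ hne
  simp only [map_sum, map_smul, sum_apply, smul_apply, smul_eq_mul] at this
  refine this.trans_eq ?_
  simp only [dotProduct, Matrix.mulVec, RMetric.gram, Matrix.of_apply, Pi.star_apply, star_trivial,
    Finset.mul_sum]
  rw [Finset.sum_comm]
  refine Finset.sum_congr rfl fun a _ => Finset.sum_congr rfl fun b _ => ?_
  rw [g.symm]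
  ring

theorem chartGram_posDef (g : RMetric m Y) (hκ : κ ∈ atlas (Euc m) Y) {z : Euc m}
    (hz : z ∈ κ.target) : (chartGram g κ z).PosDef := by
  rw [chartGram_eq]
  have h := (gram_posDef g (κ.symm z)).conjTranspose_mul_mul_same (B := chartJacobian κ z)
    (Matrix.mulVec_injective_iff_isUnit.2 (isUnit_chartJacobian hκ hz))
  simpa [Matrix.conjTranspose_eq_transpose_of_trivial] using h

/-- The pairing of differentials does not depend on the basis: the inverse Gram matrices satisfy
G₀⁻¹ = J G⁻¹ Jᵀ while derivatives transform with Jᵀ. This replaces the preferred chart, which varies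
with the point, by one fixed chart. -/
theorem gradPair_chart (g : RMetric m Y) (hκ : κ ∈ atlas (Euc m) Y) {z : Euc m}
    (hz : z ∈ κ.target) {v w : Y → ℂ}
    (hv : MDifferentiableAt 𝓘(ℝ, Euc m) 𝓘(ℝ, ℂ) v (κ.symm z))
    (hw : MDifferentiableAt 𝓘(ℝ, Euc m) 𝓘(ℝ, ℂ) w (κ.symm z)) :
    gradPair g v w (κ.symm z) = ∑ i, ∑ j, (((chartGram g κ z)⁻¹ i j : ℝ) : ℂ) *
      (fderiv ℝ (v ∘ κ.symm) z (EuclideanSpace.single i 1) *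
        fderiv ℝ (w ∘ κ.symm) z (EuclideanSpace.single j 1)) := by
  have hd : ∀ {u : Y → ℂ}, MDifferentiableAt 𝓘(ℝ, Euc m) 𝓘(ℝ, ℂ) u (κ.symm z) → ∀ i,
      fderiv ℝ (u ∘ κ.symm) z (EuclideanSpace.single i 1)
        = ∑ k, (chartJacobian κ z k i : ℂ) * partialDeriv u k (κ.symm z) := by
    intro u hu i
    rw [← mfderiv_eq_fderiv, mfderiv_comp z hu (mdifferentiableAt_atlas_symm' hκ hz)]
    have := congrArg (mfderiv 𝓘(ℝ, Euc m) 𝓘(ℝ, ℂ) u (κ.symm z)) (chartVec_eq_sum (κ := κ) z i)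
    rw [map_sum] at this
    refine this.trans (Finset.sum_congr rfl fun k _ => ?_)
    rw [map_smul]
    exact Complex.real_smul
  set J := chartJacobian κ z with hJ
  set G₀ := g.gram (κ.symm z) (tangentBasis (κ.symm z)) with hG₀
  have hJu : IsUnit J.det := (Matrix.isUnit_iff_isUnit_det _).1 (isUnit_chartJacobian hκ hz)
  have hJt : IsUnit J.transpose.det := by rwa [Matrix.det_transpose]
  have hinv : G₀⁻¹ = J * (chartGram g κ z)⁻¹ * J.transpose := by
    rw [chartGram_eq, ← hJ, ← hG₀, Matrix.mul_inv_rev, Matrix.mul_inv_rev]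
    rw [← Matrix.mul_assoc, Matrix.mul_nonsing_inv _ hJu, Matrix.one_mul, Matrix.mul_assoc,
      Matrix.nonsing_inv_mul _ hJt, Matrix.mul_one]
  rw [gradPair, ← hG₀, hinv]
  simp only [hd hv, hd hw, Matrix.mul_apply, Matrix.transpose_apply]
  push_cast
  simp only [Finset.sum_mul, Finset.mul_sum]
  have comm4 : ∀ F : Fin m → Fin m → Fin m → Fin m → ℂ,
      ∑ a, ∑ b, ∑ j, ∑ i, F a b j i = ∑ i, ∑ j, ∑ a, ∑ b, F a b j i := by
    intro F
    calc _ = ∑ a, ∑ j, ∑ b, ∑ i, F a b j i := Finset.sum_congr rfl fun a _ => Finset.sum_comm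
      _ = ∑ a, ∑ j, ∑ i, ∑ b, F a b j i := Finset.sum_congr rfl fun a _ =>
          Finset.sum_congr rfl fun j _ => Finset.sum_comm
      _ = ∑ a, ∑ i, ∑ j, ∑ b, F a b j i := Finset.sum_congr rfl fun a _ => Finset.sum_comm
      _ = ∑ i, ∑ a, ∑ j, ∑ b, F a b j i := Finset.sum_comm
      _ = _ := Finset.sum_congr rfl fun i _ => Finset.sum_comm
  rw [comm4]
  refine Finset.sum_congr rfl fun i _ => Finset.sum_congr rfl fun j _ => ?_
  rw [Finset.sum_comm]
  refine Finset.sum_congr rfl fun a _ => Finset.sum_congr rfl fun b _ => ?_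
  ring

end ChartMetric

/-! ### Integration in a chart -/

section ChartIntegral

variable {m : ℕ} {Y : Type*} [TopologicalSpace Y] [ChartedSpace (Euc m) Y]
  [IsManifold 𝓘(ℝ, Euc m) ∞ Y]

theorem contDiffOn_matrix_det {E : Type*} [NormedAddCommGroup E] [NormedSpace ℝ E] {ι : Type*}
    [Fintype ι] [DecidableEq ι] {A : E → Matrix ι ι ℝ} {s : Set E}
    (hA : ∀ i j, ContDiffOn ℝ ∞ (fun z => A z i j) s) : ContDiffOn ℝ ∞ (fun z => (A z).det) s := by
  simp only [Matrix.det_apply, Units.smul_def, zsmul_eq_mul]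
  exact ContDiffOn.sum fun σ _ => contDiffOn_const.mul (contDiffOn_prod fun i _ => hA _ _)

theorem contDiffOn_matrix_inv {E : Type*} [NormedAddCommGroup E] [NormedSpace ℝ E] {ι : Type*}
    [Fintype ι] [DecidableEq ι] {A : E → Matrix ι ι ℝ} {s : Set E}
    (hA : ∀ i j, ContDiffOn ℝ ∞ (fun z => A z i j) s) (hdet : ∀ z ∈ s, (A z).det ≠ 0) (i j : ι) :
    ContDiffOn ℝ ∞ (fun z => (A z)⁻¹ i j) s := by
  simp only [Matrix.inv_def, Ring.inverse_eq_inv', Matrix.smul_apply, smul_eq_mul,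
    Matrix.adjugate_apply]
  refine ((contDiffOn_matrix_det hA).inv hdet).mul (contDiffOn_matrix_det fun a b => ?_)
  by_cases h : a = j
  · subst h
    simp only [Matrix.updateRow_self]
    exact contDiffOn_const
  · simp only [Matrix.updateRow_ne h]
    exact hA a b

/-- The density `√(det g_ij)` of the Riemannian volume in a chart. -/
def chartDensity (g : RMetric m Y) (κ : OpenPartialHomeomorph Y (Euc m)) (z : Euc m) : ℝ :=
  Real.sqrt (chartGram g κ z).det

variable {κ : OpenPartialHomeomorph Y (Euc m)}

theorem chartDensity_pos (g : RMetric m Y) (hκ : κ ∈ atlas (Euc m) Y) {z : Euc m}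
    (hz : z ∈ κ.target) : 0 < chartDensity g κ z :=
  Real.sqrt_pos.2 (chartGram_posDef g hκ hz).det_pos

theorem contDiffOn_chartDensity (g : RMetric m Y) (hκ : κ ∈ atlas (Euc m) Y) :
    ContDiffOn ℝ ∞ (chartDensity g κ) κ.target :=
  (contDiffOn_matrix_det (contDiffOn_chartGram g hκ)).sqrt
    fun _ hz => (chartGram_posDef g hκ hz).det_pos.ne'

theorem contDiffOn_chartGram_inv (g : RMetric m Y) (hκ : κ ∈ atlas (Euc m) Y) (i j : Fin m) :
    ContDiffOn ℝ ∞ (fun z => (chartGram g κ z)⁻¹ i j) κ.target :=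
  contDiffOn_matrix_inv (contDiffOn_chartGram g hκ)
    (fun _ hz => (chartGram_posDef g hκ hz).det_pos.ne') i j

variable [MeasurableSpace Y] [BorelSpace Y]

/-- Restatement of `IsRiemannianVolume` as an equality of measures, the form in which integrals can
be transported to the chart. -/
theorem measure_restrict_chart {g : RMetric m Y} {μ : Measure Y} (hμ : IsRiemannianVolume g μ)
    (hκ : κ ∈ atlas (Euc m) Y) :
    μ.restrict κ.source = Measure.map κ.symm ((volume.restrict κ.target).withDensity
      fun z => ENNReal.ofReal (chartDensity g κ z)) := by
  have hm : AEMeasurable κ.symm ((volume.restrict κ.target).withDensity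
      fun z => ENNReal.ofReal (chartDensity g κ z)) :=
    (κ.continuousOn_symm.aemeasurable κ.open_target.measurableSet).mono_ac
      (withDensity_absolutelyContinuous _ _)
  ext A hA
  rw [Measure.map_apply_of_aemeasurable hm hA, Measure.restrict_apply hA]
  have h1 := hμ κ hκ (A ∩ κ.source) (hA.inter κ.open_source.measurableSet) inter_subset_right
  have himg : κ '' (A ∩ κ.source) = κ.target ∩ κ.symm ⁻¹' A := by
    rw [inter_comm]; exact κ.image_source_inter_eq' A
  rw [himg] at h1
  rw [h1]
  -- `κ.symm` is continuous only on the target, so measurability is obtained on the subtype and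
  -- transferred back.
  have hms : MeasurableSet (κ.target ∩ κ.symm ⁻¹' A) := by
    obtain ⟨u, hu, hut⟩ := measurable_iff_comap_le.1 (κ.continuousOn_symm.domRestrict.measurable) _
      ⟨A, hA, rfl⟩
    have : κ.target ∩ κ.symm ⁻¹' A = κ.target ∩ u := by
      ext z
      constructor
      · rintro ⟨hz, hzA⟩
        refine ⟨hz, ?_⟩
        have : (⟨z, hz⟩ : κ.target) ∈ Subtype.val ⁻¹' u := by rw [hut]; exact hzA
        exact this
      · rintro ⟨hz, hzu⟩
        refine ⟨hz, ?_⟩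
        have : (⟨z, hz⟩ : κ.target) ∈ κ.target.domRestrict κ.symm ⁻¹' A := by rw [← hut]; exact hzu
        exact this
    rw [this]
    exact κ.open_target.measurableSet.inter hu
  rw [withDensity_apply']
  rw [Measure.restrict_restrict₀, inter_comm]
  · rfl
  · exact (κ.continuousOn_symm.aemeasurable κ.open_target.measurableSet).nullMeasurableSet_preimage hA

theorem integral_chart {g : RMetric m Y} {μ : Measure Y} (hμ : IsRiemannianVolume g μ)
    (hκ : κ ∈ atlas (Euc m) Y) {F : Y → ℂ} (hF : ContinuousOn F κ.source)
    (hF0 : ∀ y ∉ κ.source, F y = 0) :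
    ∫ y, F y ∂μ = ∫ z in κ.target, (chartDensity g κ z : ℂ) * F (κ.symm z) := by
  have hm : AEMeasurable κ.symm ((volume.restrict κ.target).withDensity
      fun z => ENNReal.ofReal (chartDensity g κ z)) :=
    (κ.continuousOn_symm.aemeasurable κ.open_target.measurableSet).mono_ac
      (withDensity_absolutelyContinuous _ _)
  have hFm : AEStronglyMeasurable F (μ.restrict κ.source) :=
    hF.aestronglyMeasurable κ.open_source.measurableSet
  rw [← setIntegral_eq_integral_of_forall_compl_eq_zero hF0]
  rw [measure_restrict_chart hμ hκ] at hFm ⊢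
  rw [integral_map hm hFm, integral_withDensity_eq_integral_toReal_smul₀]
  · refine setIntegral_congr_fun κ.open_target.measurableSet fun z hz => ?_
    simp only [ENNReal.toReal_ofReal (chartDensity_pos g hκ hz).le, Complex.real_smul]
  · exact ((contDiffOn_chartDensity g hκ).continuousOn.aemeasurable
      κ.open_target.measurableSet).ennreal_ofReal
  · exact Eventually.of_forall fun _ => ENNReal.ofReal_lt_top

/-- The density is bounded on compact subsets of a chart, so μ is locally finite, and Y is compact.
-/
theorem isFiniteMeasure_of_isRiemannianVolume [T2Space Y] [CompactSpace Y] {g : RMetric m Y}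
    {μ : Measure Y} (hμ : IsRiemannianVolume g μ) : IsFiniteMeasure μ := by
  have hloc : IsLocallyFiniteMeasure μ := by
    refine ⟨fun y => ?_⟩
    set κ := chartAt (Euc m) y
    have hκ : κ ∈ atlas (Euc m) Y := chart_mem_atlas _ y
    have : LocallyCompactSpace Y := ChartedSpace.locallyCompactSpace (Euc m) Y
    obtain ⟨A, hA, hAs, hAc⟩ := local_compact_nhds (κ.open_source.mem_nhds (mem_chart_source _ y))
    refine ⟨A, hA, ?_⟩
    rw [hμ κ hκ A hAc.isClosed.measurableSet hAs]
    have hc : IsCompact (κ '' A) := hAc.image_of_continuousOn (κ.continuousOn.mono hAs)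
    have hsub : κ '' A ⊆ κ.target := by
      rintro _ ⟨a, ha, rfl⟩
      exact κ.map_source (hAs ha)
    obtain ⟨C, hC⟩ := hc.exists_bound_of_continuousOn
      ((contDiffOn_chartDensity g hκ).continuousOn.mono hsub)
    calc _ ≤ ∫⁻ z in κ '' A, ENNReal.ofReal C := by
          refine setLIntegral_mono' hc.measurableSet fun z hz => ?_
          exact ENNReal.ofReal_le_ofReal ((le_abs_self _).trans (hC z hz))
      _ < ⊤ := by
          rw [setLIntegral_const]
          exact ENNReal.mul_lt_top ENNReal.ofReal_lt_top hc.measure_lt_top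
  exact ⟨isCompact_univ.measure_lt_top⟩

end ChartIntegral

/-! ### The Laplacian of smooth functions -/

section Laplacian

theorem contDiff_of_zero_off {E F : Type*} [NormedAddCommGroup E] [NormedSpace ℝ E]
    [NormedAddCommGroup F] [NormedSpace ℝ F] {f : E → F} {U S : Set E} (hU : IsOpen U)
    (hS : IsClosed S) (hSU : S ⊆ U) (hf : ContDiffOn ℝ ∞ f U) (h0 : ∀ x ∉ S, f x = 0) :
    ContDiff ℝ ∞ f := by
  rw [contDiff_iff_contDiffAt]
  intro x
  by_cases hx : x ∈ S
  · exact hf.contDiffAt (hU.mem_nhds (hSU hx))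
  · refine (contDiffAt_const (c := (0 : F))).congr_of_eventuallyEq ?_
    filter_upwards [hS.isOpen_compl.mem_nhds hx] with y hy
    exact h0 y hy

theorem fderiv_zero_off {E F : Type*} [NormedAddCommGroup E] [NormedSpace ℝ E]
    [NormedAddCommGroup F] [NormedSpace ℝ F] {f : E → F} {S : Set E}
    (hS : IsClosed S) (h0 : ∀ x ∉ S, f x = 0) {x : E} (hx : x ∉ S) : fderiv ℝ f x = 0 := by
  have : f =ᶠ[𝓝 x] fun _ => 0 := by
    filter_upwards [hS.isOpen_compl.mem_nhds hx] with y hy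
    exact h0 y hy
  rw [this.fderiv_eq]
  simp

theorem integrable_mul_of_zero_off {m : ℕ} {U S : Set (Euc m)} (hU : IsOpen U)
    (hS : IsCompact S) (hSU : S ⊆ U) {a b : Euc m → ℂ} (ha : ContinuousOn a U) (hb : Continuous b)
    (h0 : ∀ z ∉ S, b z = 0) : Integrable fun z => a z * b z := by
  have h1 : tsupport (fun z => a z * b z) ⊆ S := closure_minimal (fun z hz => by
    by_contra h; exact hz (by simp [h0 z h])) hS.isClosed
  have hc : Continuous (fun z => a z * b z) :=
    (ha.mul hb.continuousOn).continuous_of_tsupport_subset hU (h1.trans hSU)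
  exact hc.integrable_of_hasCompactSupport
    (HasCompactSupport.intro hS fun z hz => by simp [h0 z hz])

/-- Integration by parts on an open set without boundary terms: φ need only be smooth on `U`,
because `X` vanishes off a compact subset of `U`. -/
theorem setIntegral_fderiv_mul_eq_neg {m : ℕ} {U S : Set (Euc m)} (hU : IsOpen U)
    (hS : IsCompact S) (hSU : S ⊆ U) {φ X : Euc m → ℂ} (hφ : ContDiffOn ℝ ∞ φ U)
    (hX : ContDiff ℝ ∞ X) (h0 : ∀ z ∉ S, X z = 0) (e : Euc m) :
    ∫ z in U, fderiv ℝ φ z e * X z = -∫ z in U, φ z * fderiv ℝ X z e := by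
  have hXc : HasCompactSupport X := HasCompactSupport.intro hS h0
  have hts : tsupport X ⊆ S := closure_minimal (fun z hz => by
    by_contra h; exact hz (h0 z h)) hS.isClosed
  have hX' : ∀ z ∉ S, fderiv ℝ X z e = 0 := fun z hz => by
    rw [fderiv_zero_off hS.isClosed h0 hz]; rfl
  have hint := fun {a b : Euc m → ℂ} (ha : ContinuousOn a U) (hb : Continuous b) h =>
    integrable_mul_of_zero_off hU hS hSU ha hb h
  have hφ' : ContinuousOn (fun z => fderiv ℝ φ z e) U :=
    (hφ.continuousOn_fderiv_of_isOpen hU (by simp)).clm_apply continuousOn_const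
  have hXd : Continuous fun z => fderiv ℝ X z e :=
    (hX.continuous_fderiv (by simp)).clm_apply continuous_const
  have key := integral_mul_fderiv_eq_neg_fderiv_mul_of_integrable (μ := (volume : Measure (Euc m)))
    (f := φ) (g := X) (v := e) (hint hφ' hX.continuous h0)
    (hint hφ.continuousOn hXd hX') (hint hφ.continuousOn hX.continuous h0)
    (fun z hz => (hφ.contDiffAt (hU.mem_nhds (hSU (hts hz)))).differentiableAt (by simp))
    (fun z _ => hX.differentiable (by simp) z)
  rw [setIntegral_eq_integral_of_forall_compl_eq_zero
      (fun z hz => by rw [h0 z (fun h => hz (hSU h)), mul_zero]),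
    setIntegral_eq_integral_of_forall_compl_eq_zero
      (fun z hz => by rw [hX' z (fun h => hz (hSU h)), mul_zero]), key, neg_neg]

variable {n m : ℕ} {Y : Type*} [TopologicalSpace Y] [ChartedSpace (Euc m) Y]

theorem smoothFn_contMDiff (v : SmoothFn m Y) : ContMDiff 𝓘(ℝ, Euc m) 𝓘(ℝ, ℂ) ∞ v.1 := v.2

theorem smoothFn_mdifferentiableAt (v : SmoothFn m Y) (y : Y) :
    MDifferentiableAt 𝓘(ℝ, Euc m) 𝓘(ℝ, ℂ) v.1 y :=
  (smoothFn_contMDiff v y).mdifferentiableAt (by simp)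

variable [IsManifold 𝓘(ℝ, Euc m) ∞ Y]

theorem contDiffOn_comp_chart_symm {κ : OpenPartialHomeomorph Y (Euc m)}
    (hκ : κ ∈ atlas (Euc m) Y) {v : Y → ℂ} (hv : ContMDiff 𝓘(ℝ, Euc m) 𝓘(ℝ, ℂ) ∞ v) :
    ContDiffOn ℝ ∞ (v ∘ κ.symm) κ.target := by
  rw [← contMDiffOn_iff_contDiffOn]
  exact hv.comp_contMDiffOn (contMDiffOn_atlas_symm hκ)

theorem continuousOn_gradPair_chart (g : RMetric m Y) {κ : OpenPartialHomeomorph Y (Euc m)}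
    (hκ : κ ∈ atlas (Euc m) Y) {v w : Y → ℂ} (hv : ContMDiff 𝓘(ℝ, Euc m) 𝓘(ℝ, ℂ) ∞ v)
    (hw : ContMDiff 𝓘(ℝ, Euc m) 𝓘(ℝ, ℂ) ∞ w) : ContinuousOn (gradPair g v w) κ.source := by
  have h1 : ContinuousOn (fun z => gradPair g v w (κ.symm z)) κ.target := by
    have hd : ∀ {v : Y → ℂ}, ContMDiff 𝓘(ℝ, Euc m) 𝓘(ℝ, ℂ) ∞ v → ∀ i : Fin m,
        ContinuousOn (fun z => fderiv ℝ (v ∘ κ.symm) z (EuclideanSpace.single i 1)) κ.target :=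
      fun hv i => ((contDiffOn_comp_chart_symm hκ hv).continuousOn_fderiv_of_isOpen κ.open_target
        (by simp)).clm_apply continuousOn_const
    refine ContinuousOn.congr (f := fun z => ∑ i, ∑ j, (((chartGram g κ z)⁻¹ i j : ℝ) : ℂ) *
      (fderiv ℝ (v ∘ κ.symm) z (EuclideanSpace.single i 1) *
        fderiv ℝ (w ∘ κ.symm) z (EuclideanSpace.single j 1))) ?_ fun z hz =>
        gradPair_chart g hκ hz ((hv _).mdifferentiableAt (by simp))
          ((hw _).mdifferentiableAt (by simp))
    refine continuousOn_finsetSum _ fun i _ => continuousOn_finsetSum _ fun j _ => ?_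
    exact (Complex.continuous_ofReal.comp_continuousOn
      (contDiffOn_chartGram_inv g hκ i j).continuousOn).mul ((hd hv i).mul (hd hw j))
  refine (h1.comp κ.continuousOn κ.mapsTo).congr fun y hy => ?_
  simp only [Function.comp, κ.left_inv hy]

theorem gradPair_eq_zero_of_notMem_tsupport (g : RMetric m Y) {v w : Y → ℂ} {y : Y}
    (hy : y ∉ tsupport w) : gradPair g v w y = 0 := by
  have hw : w =ᶠ[𝓝 y] fun _ => 0 := notMem_tsupport_iff_eventuallyEq.1 hy
  have : ∀ j : Fin m, partialDeriv w j y = 0 := fun j => by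
    have h : mfderiv 𝓘(ℝ, Euc m) 𝓘(ℝ, ℂ) w y = 0 :=
      hw.mfderiv_eq.trans mfderiv_const
    exact DFunLike.congr_fun h (tangentBasis y j)
  simp [gradPair, this]

variable [MeasurableSpace Y] [BorelSpace Y]

/-- In a chart, Δ(ρu) = -(det g)^{-1/2} ∂_i((det g)^{1/2} g^{ij} ∂_j(ρu)), which extends by zero
since ρ is supported in the chart. The parameter x is carried along to have joint smoothness, and
the second conclusion keeps the support in x under control, so that test functions go to test
functions. -/
theorem exists_laplacian_of_tsupport_subset [CompactSpace Y] {g : RMetric m Y} {μ : Measure Y}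
    (hμ : IsRiemannianVolume g μ) {κ : OpenPartialHomeomorph Y (Euc m)}
    (hκ : κ ∈ atlas (Euc m) Y) {ρ : Y → ℝ} (hρ : ContMDiff 𝓘(ℝ, Euc m) 𝓘(ℝ, ℝ) ∞ ρ)
    (hρκ : tsupport ρ ⊆ κ.source) {u : Euc n × Y → ℂ}
    (hu : ContMDiff (𝓘(ℝ, Euc n).prod 𝓘(ℝ, Euc m)) 𝓘(ℝ, ℂ) ∞ u) :
    ∃ u' : Euc n × Y → ℂ, ContMDiff (𝓘(ℝ, Euc n).prod 𝓘(ℝ, Euc m)) 𝓘(ℝ, ℂ) ∞ u' ∧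
      (∀ x, (∀ y, u (x, y) = 0) → ∀ y, u' (x, y) = 0) ∧
      ∀ (x : Euc n) (φ : SmoothFn m Y),
        ∫ y, gradPair g φ.1 (fun y => ρ y * u (x, y)) y ∂μ = ∫ y, φ.1 y * u' (x, y) ∂μ := by
  classical
  set S : Set (Euc m) := κ '' tsupport ρ with hS
  have hScomp : IsCompact S :=
    ((isClosed_tsupport ρ).isCompact).image_of_continuousOn (κ.continuousOn.mono hρκ)
  have hST : S ⊆ κ.target := by
    rintro _ ⟨a, ha, rfl⟩
    exact κ.map_source (hρκ ha)
  have hρS : ∀ z ∈ κ.target, z ∉ S → ρ (κ.symm z) = 0 := by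
    intro z hz hzS
    by_contra h
    exact hzS ⟨κ.symm z, subset_tsupport ρ h, κ.right_inv hz⟩
  set V : Set (Euc n × Euc m) := {q | q.2 ∈ κ.target} with hV
  have hVo : IsOpen V := κ.open_target.preimage continuous_snd
  set W : Set (Euc n × Euc m) := {q | q.2 ∈ S} with hW
  have hWc : IsClosed W := hScomp.isClosed.preimage continuous_snd
  have hWV : W ⊆ V := fun q hq => hST hq
  -- the localized function in coordinates
  set w : Euc n × Euc m → ℂ :=
    V.indicator fun q => (ρ (κ.symm q.2) : ℂ) * u (q.1, κ.symm q.2) with hw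
  have hw0 : ∀ q ∉ W, w q = 0 := by
    intro q hq
    by_cases hqV : q ∈ V
    · rw [hw, indicator_of_mem hqV, hρS q.2 hqV hq]; simp
    · rw [hw, indicator_of_notMem hqV]
  have hsymm : ContMDiffOn 𝓘(ℝ, Euc n × Euc m) 𝓘(ℝ, Euc m) ∞
      (fun q : Euc n × Euc m => κ.symm q.2) V :=
    (contMDiffOn_atlas_symm hκ).comp contDiff_snd.contMDiff.contMDiffOn (fun q hq => hq)
  have hws : ContDiff ℝ ∞ w := by
    refine contDiff_of_zero_off hVo hWc hWV ?_ hw0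
    rw [← contMDiffOn_iff_contDiffOn]
    have h1 : ContMDiffOn 𝓘(ℝ, Euc n × Euc m) 𝓘(ℝ, ℂ) ∞
        (fun q : Euc n × Euc m => u (q.1, κ.symm q.2)) V :=
      hu.comp_contMDiffOn (contDiff_fst.contMDiff.contMDiffOn.prodMk hsymm)
    have h2 : ContMDiffOn 𝓘(ℝ, Euc n × Euc m) 𝓘(ℝ, ℂ) ∞
        (fun q : Euc n × Euc m => (ρ (κ.symm q.2) : ℂ)) V :=
      Complex.ofRealCLM.contDiff.contMDiff.comp_contMDiffOn (hρ.comp_contMDiffOn hsymm)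
    rw [contMDiffOn_iff_contDiffOn] at h1 h2 ⊢
    exact (h2.mul h1).congr fun q hq => by rw [hw, indicator_of_mem hq]
  have hder : ∀ {f : Euc n × Euc m → ℂ}, ContDiff ℝ ∞ f → ∀ e : Euc n × Euc m,
      ContDiff ℝ ∞ fun q => fderiv ℝ f q e := fun hf e =>
    (hf.fderiv_right (by simp)).clm_apply contDiff_const
  have hder0 : ∀ {f : Euc n × Euc m → ℂ}, (∀ q ∉ W, f q = 0) → ∀ (e : Euc n × Euc m),
      ∀ q ∉ W, fderiv ℝ f q e = 0 := fun hf e q hq => by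
    rw [fderiv_zero_off hWc hf hq]; rfl
  let bas : Fin m → Euc n × Euc m := fun i => (0, EuclideanSpace.single i 1)
  -- the vector field `√det g · g^{ij} ∂_j w`
  set X : Fin m → Euc n × Euc m → ℂ := fun i q =>
    ∑ j, ((chartDensity g κ q.2 * (chartGram g κ q.2)⁻¹ i j : ℝ) : ℂ) * fderiv ℝ w q (bas j) with hX
  have hX0 : ∀ i, ∀ q ∉ W, X i q = 0 := fun i q hq => by
    simp only [hX]
    exact Finset.sum_eq_zero fun j _ => by rw [hder0 hw0 _ q hq, mul_zero]
  have hXs : ∀ i, ContDiff ℝ ∞ (X i) := by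
    intro i
    refine contDiff_of_zero_off hVo hWc hWV ?_ (hX0 i)
    refine ContDiffOn.sum fun j _ => ContDiffOn.mul ?_ (hder hws _).contDiffOn
    refine Complex.ofRealCLM.contDiff.comp_contDiffOn ?_
    exact ((contDiffOn_chartDensity g hκ).mul (contDiffOn_chartGram_inv g hκ i j)).comp
      contDiff_snd.contDiffOn (fun q hq => hq)
  set dv : Euc n × Euc m → ℂ := fun q => ∑ i, fderiv ℝ (X i) q (bas i) with hdv
  have hdv0 : ∀ q ∉ W, dv q = 0 := fun q hq =>
    Finset.sum_eq_zero fun i _ => hder0 (hX0 i) _ q hq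
  have hdvs : ContDiff ℝ ∞ dv := ContDiff.sum fun i _ => hder (hXs i) _
  -- Minus the divergence divided by the density: the density reappears from the volume when the
  -- pairing with φ is written in the chart.
  set u' : Euc n × Y → ℂ := fun q =>
    if q.2 ∈ κ.source then -((chartDensity g κ (κ q.2))⁻¹ : ℝ) * dv (q.1, κ q.2) else 0 with hu'
  have hu'0 : ∀ q : Euc n × Y, q.2 ∉ tsupport ρ → u' q = 0 := by
    intro q hq
    simp only [hu']
    split_ifs with h
    · rw [hdv0, mul_zero]
      rintro ⟨a, ha, hae⟩
      exact hq (κ.injOn (hρκ ha) h hae ▸ ha)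
    · rfl
  have hfder : ∀ {f : Euc n × Euc m → ℂ}, ContDiff ℝ ∞ f → ∀ (x : Euc n) (z : Euc m) (i : Fin m),
      fderiv ℝ (fun z => f (x, z)) z (EuclideanSpace.single i 1) = fderiv ℝ f (x, z) (bas i) := by
    intro f hf x z i
    have h1 : HasFDerivAt (fun z : Euc m => (x, z))
        ((0 : Euc m →L[ℝ] Euc n).prod (ContinuousLinearMap.id ℝ (Euc m))) z :=
      (hasFDerivAt_const x z).prodMk (hasFDerivAt_id z)
    have h2 := ((hf.differentiable (by simp) (x, z)).hasFDerivAt).comp z h1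
    have h3 : fderiv ℝ (fun z => f (x, z)) z = _ := h2.fderiv
    rw [h3]
    rfl
  have hu's : ContMDiff (𝓘(ℝ, Euc n).prod 𝓘(ℝ, Euc m)) 𝓘(ℝ, ℂ) ∞ u' := by
    intro q
    by_cases hq : q.2 ∈ κ.source
    · have hsrc : IsOpen {q : Euc n × Y | q.2 ∈ κ.source} := κ.open_source.preimage continuous_snd
      have hκs : ContMDiffOn (𝓘(ℝ, Euc n).prod 𝓘(ℝ, Euc m)) 𝓘(ℝ, Euc m) ∞
          (fun q : Euc n × Y => κ q.2) {q | q.2 ∈ κ.source} :=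
        (contMDiffOn_atlas hκ).comp contMDiff_snd.contMDiffOn (fun q hq => hq)
      have h1 : ContMDiffOn (𝓘(ℝ, Euc n).prod 𝓘(ℝ, Euc m)) 𝓘(ℝ, ℂ) ∞
          (fun q : Euc n × Y => dv (q.1, κ q.2)) {q | q.2 ∈ κ.source} :=
        hdvs.contMDiff.comp_contMDiffOn (contMDiff_fst.contMDiffOn.prodMk_space hκs)
      have h2 : ContMDiffOn (𝓘(ℝ, Euc n).prod 𝓘(ℝ, Euc m)) 𝓘(ℝ, ℂ) ∞
          (fun q : Euc n × Y => -(((chartDensity g κ (κ q.2))⁻¹ : ℝ) : ℂ)) {q | q.2 ∈ κ.source} := by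
        have h3 : ContDiffOn ℝ ∞ (fun z => -(((chartDensity g κ z)⁻¹ : ℝ) : ℂ)) κ.target :=
          (Complex.ofRealCLM.contDiff.comp_contDiffOn ((contDiffOn_chartDensity g hκ).inv
            fun z hz => (chartDensity_pos g hκ hz).ne')).neg
        exact h3.contMDiffOn.comp hκs (fun q hq => κ.map_source hq)
      have h4 : ContMDiffOn (𝓘(ℝ, Euc n).prod 𝓘(ℝ, Euc m)) 𝓘(ℝ, ℂ) ∞ u' {q | q.2 ∈ κ.source} :=
        (contDiff_mul.contMDiff.comp_contMDiffOn (h2.prodMk_space h1)).congr fun q hq => by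
          simp only [hu', Function.comp]
          exact if_pos hq
      exact h4.contMDiffAt (hsrc.mem_nhds hq)
    · refine (contMDiffAt_const (c := (0 : ℂ))).congr_of_eventuallyEq ?_
      have ho : IsOpen {q : Euc n × Y | q.2 ∉ tsupport ρ} :=
        ((isClosed_tsupport ρ).preimage continuous_snd).isOpen_compl
      filter_upwards [ho.mem_nhds (fun h => hq (hρκ h) : q.2 ∉ tsupport ρ)] with q' hq'
      exact hu'0 q' hq'
  refine ⟨u', hu's, ?_, ?_⟩
  · intro x hx y
    have hw' : ∀ z, w (x, z) = 0 := fun z => by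
      rw [hw]
      by_cases hz : (x, z) ∈ V
      · rw [indicator_of_mem hz, hx, mul_zero]
      · rw [indicator_of_notMem hz]
    have hX' : ∀ i z, X i (x, z) = 0 := fun i z => by
      simp only [hX]
      refine Finset.sum_eq_zero fun j _ => ?_
      rw [← hfder hws]
      simp [hw']
    have : ∀ z, dv (x, z) = 0 := fun z => by
      simp only [hdv]
      refine Finset.sum_eq_zero fun j _ => ?_
      rw [← hfder (hXs j)]
      simp [hX']
    simp only [hu', this, mul_zero, ite_self]
  · intro x φ
    have hvs : ContMDiff 𝓘(ℝ, Euc m) 𝓘(ℝ, ℂ) ∞ (fun y => (ρ y : ℂ) * u (x, y)) :=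
      contDiff_mul.contMDiff.comp ((Complex.ofRealCLM.contDiff.contMDiff.comp hρ).prodMk_space
        (hu.comp (contMDiff_const.prodMk contMDiff_id)))
    have hts : ∀ y ∉ κ.source, y ∉ tsupport fun y => (ρ y : ℂ) * u (x, y) := by
      intro y hy h
      refine hy (hρκ (closure_mono ?_ h))
      intro y hy h0
      exact hy (by simp [h0])
    have hu'c : Continuous fun y => u' (x, y) := hu's.continuous.comp (by fun_prop)
    rw [integral_chart hμ hκ (continuousOn_gradPair_chart g hκ (smoothFn_contMDiff φ) hvs)
        (fun y hy => gradPair_eq_zero_of_notMem_tsupport g (hts y hy)),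
      integral_chart hμ hκ (F := fun y => φ.1 y * u' (x, y))
        ((smoothFn_contMDiff φ).continuous.mul hu'c).continuousOn
        (fun y hy => by rw [hu'0 _ (fun h => hy (hρκ h)), mul_zero])]
    have hφs := contDiffOn_comp_chart_symm hκ (smoothFn_contMDiff φ)
    have hXx : ∀ i, ContDiff ℝ ∞ fun z => X i (x, z) := fun i =>
      (hXs i).comp (contDiff_const.prodMk contDiff_id)
    have e1 : ∀ z ∈ κ.target, (chartDensity g κ z : ℂ) *
        gradPair g φ.1 (fun y => (ρ y : ℂ) * u (x, y)) (κ.symm z) =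
        ∑ i, fderiv ℝ (φ.1 ∘ κ.symm) z (EuclideanSpace.single i 1) * X i (x, z) := by
      intro z hz
      rw [gradPair_chart g hκ hz (smoothFn_mdifferentiableAt φ _) ((hvs _).mdifferentiableAt (by simp))]
      have hwz : ((fun y => (ρ y : ℂ) * u (x, y)) ∘ κ.symm) =ᶠ[𝓝 z] fun z => w (x, z) := by
        filter_upwards [κ.open_target.mem_nhds hz] with z' hz'
        rw [hw, indicator_of_mem (show (x, z') ∈ V from hz')]
        rfl
      rw [hwz.fderiv_eq]
      simp only [hfder hws, hX, Finset.mul_sum]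
      refine Finset.sum_congr rfl fun i _ => Finset.sum_congr rfl fun j _ => ?_
      push_cast
      ring
    have e2 : ∀ z ∈ κ.target, (chartDensity g κ z : ℂ) * (φ.1 (κ.symm z) * u' (x, κ.symm z)) =
        -∑ i, (φ.1 ∘ κ.symm) z * fderiv ℝ (fun z => X i (x, z)) z (EuclideanSpace.single i 1) := by
      intro z hz
      have hne : (chartDensity g κ z : ℂ) ≠ 0 := by
        exact_mod_cast (chartDensity_pos g hκ hz).ne'
      simp only [hu', if_pos (κ.map_target hz), κ.right_inv hz, hdv, hfder (hXs _)]
      rw [← Finset.mul_sum]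
      push_cast
      field_simp
      exact congrArg Neg.neg (mul_comm _ _)
    rw [setIntegral_congr_fun κ.open_target.measurableSet e1,
      setIntegral_congr_fun κ.open_target.measurableSet e2, integral_neg]
    have hc1 : ∀ i ∈ Finset.univ, Integrable (fun z =>
        fderiv ℝ (φ.1 ∘ κ.symm) z (EuclideanSpace.single i 1) * X i (x, z))
        (volume.restrict κ.target) := fun i _ =>
      (integrable_mul_of_zero_off κ.open_target hScomp hST
        ((hφs.continuousOn_fderiv_of_isOpen κ.open_target (by simp)).clm_apply continuousOn_const)
        (hXx i).continuous (fun z hz => hX0 i _ hz)).restrict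
    have hc2 : ∀ i ∈ Finset.univ, Integrable (fun z =>
        (φ.1 ∘ κ.symm) z * fderiv ℝ (fun z => X i (x, z)) z (EuclideanSpace.single i 1))
        (volume.restrict κ.target) := fun i _ =>
      (integrable_mul_of_zero_off κ.open_target hScomp hST hφs.continuousOn
        (((hXx i).continuous_fderiv (by simp)).clm_apply continuous_const)
        (fun z hz => by rw [hfder (hXs i)]; exact hder0 (hX0 i) _ _ hz)).restrict
    rw [integral_finsetSum _ hc1, integral_finsetSum _ hc2, ← Finset.sum_neg_distrib]
    exact Finset.sum_congr rfl fun i _ => setIntegral_fderiv_mul_eq_neg κ.open_target hScomp hST hφs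
      (hXx i) (fun z hz => hX0 i _ hz) _

end Laplacian

/-! ### Eigenfunctions of the Laplacian -/

section Eigenfunctions

variable {n m : ℕ} {Y : Type*} [TopologicalSpace Y] [ChartedSpace (Euc m) Y]

/-- The complex conjugate of a smooth function. -/
def smoothConj (v : SmoothFn m Y) : SmoothFn m Y :=
  ⟨fun y => conj (v.1 y), Complex.conjCLE.contDiff.contMDiff.comp v.2⟩

theorem partialDeriv_smoothConj (v : SmoothFn m Y) (i : Fin m) (y : Y) :
    partialDeriv (smoothConj v).1 i y = conj (partialDeriv v.1 i y) := by
  have h1 : HasMFDerivAt 𝓘(ℝ, ℂ) 𝓘(ℝ, ℂ) (fun z : ℂ => conj z) (v.1 y)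
      (Complex.conjCLE : ℂ →L[ℝ] ℂ) := (Complex.conjCLE : ℂ →L[ℝ] ℂ).hasMFDerivAt
  have h2 := h1.comp y (smoothFn_mdifferentiableAt v y).hasMFDerivAt
  have h3 := h2.mfderiv
  exact DFunLike.congr_fun h3 (tangentBasis y i)

theorem partialDeriv_sum {ι : Type*} (s : Finset ι) (v : ι → SmoothFn m Y) (i : Fin m) (y : Y) :
    partialDeriv (∑ a ∈ s, v a).1 i y = ∑ a ∈ s, partialDeriv (v a).1 i y := by
  classical
  induction s using Finset.induction_on with
  | empty =>
    have h : mfderiv 𝓘(ℝ, Euc m) 𝓘(ℝ, ℂ) (fun _ : Y => (0 : ℂ)) y = 0 := mfderiv_const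
    exact DFunLike.congr_fun h (tangentBasis y i)
  | insert a s ha ih =>
    rw [Finset.sum_insert ha, Finset.sum_insert ha, ← ih]
    have h := mfderiv_add (smoothFn_mdifferentiableAt (v a) y)
      (smoothFn_mdifferentiableAt (∑ a ∈ s, v a) y)
    exact DFunLike.congr_fun h (tangentBasis y i)

variable [IsManifold 𝓘(ℝ, Euc m) ∞ Y]

theorem gradPair_comm (g : RMetric m Y) (v w : Y → ℂ) (y : Y) :
    gradPair g v w y = gradPair g w v y := by
  rw [gradPair, gradPair, Finset.sum_comm]
  refine Finset.sum_congr rfl fun i _ => Finset.sum_congr rfl fun j _ => ?_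
  have h : (g.gram y (tangentBasis y))⁻¹ j i = (g.gram y (tangentBasis y))⁻¹ i j := by
    conv_rhs => rw [← gram_symm, ← Matrix.transpose_nonsing_inv, Matrix.transpose_apply]
  rw [h]
  ring

theorem gradPair_smoothConj (g : RMetric m Y) (v w : SmoothFn m Y) (y : Y) :
    gradPair g (smoothConj v).1 (smoothConj w).1 y = conj (gradPair g v.1 w.1 y) := by
  simp only [gradPair, partialDeriv_smoothConj, map_sum, map_mul, Complex.conj_ofReal]

theorem gradPair_sum_right (g : RMetric m Y) (v : Y → ℂ) {ι : Type*} (s : Finset ι)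
    (w : ι → SmoothFn m Y) (y : Y) :
    gradPair g v (∑ a ∈ s, w a).1 y = ∑ a ∈ s, gradPair g v (w a).1 y := by
  simp only [gradPair, partialDeriv_sum, Finset.mul_sum]
  calc _ = ∑ i, ∑ a ∈ s, ∑ j, _ := Finset.sum_congr rfl fun i _ => Finset.sum_comm
    _ = _ := Finset.sum_comm

theorem continuous_gradPair (g : RMetric m Y) (v w : SmoothFn m Y) :
    Continuous (gradPair g v.1 w.1) := by
  rw [continuous_iff_continuousAt]
  intro y
  exact (continuousOn_gradPair_chart g (chart_mem_atlas (Euc m) y) v.2 w.2).continuousAt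
    ((chartAt (Euc m) y).open_source.mem_nhds (mem_chart_source _ y))

/-- The inverse Gram matrix is real and positive definite, so the real part splits into its values
on the real and on the imaginary part of dv. -/
theorem gradPair_smoothConj_self_nonneg (g : RMetric m Y) (v : SmoothFn m Y) (y : Y) :
    0 ≤ (gradPair g (smoothConj v).1 v.1 y).re := by
  have hpd : ((g.gram y (tangentBasis y))⁻¹).PosDef := (gram_posDef g y).inv
  have hq : ∀ x : Fin m → ℝ, 0 ≤ ∑ i, ∑ j, (g.gram y (tangentBasis y))⁻¹ i j * (x i * x j) := by
    intro x
    have := hpd.posSemidef.dotProduct_mulVec_nonneg x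
    refine this.trans_eq ?_
    simp only [dotProduct, Matrix.mulVec, Pi.star_apply, star_trivial, Finset.mul_sum]
    exact Finset.sum_congr rfl fun a _ => Finset.sum_congr rfl fun b _ => by ring
  have h : (gradPair g (smoothConj v).1 v.1 y).re
      = (∑ i, ∑ j, (g.gram y (tangentBasis y))⁻¹ i j *
          ((partialDeriv v.1 i y).re * (partialDeriv v.1 j y).re))
        + ∑ i, ∑ j, (g.gram y (tangentBasis y))⁻¹ i j *
          ((partialDeriv v.1 i y).im * (partialDeriv v.1 j y).im) := by
    simp only [gradPair, partialDeriv_smoothConj, Complex.re_sum, ← Finset.sum_add_distrib]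
    refine Finset.sum_congr rfl fun i _ => Finset.sum_congr rfl fun j _ => ?_
    simp
    ring
  rw [h]
  exact add_nonneg (hq _) (hq _)

variable [MeasurableSpace Y] {g : RMetric m Y} {μ : Measure Y}

/-- The metric and `lam` are real. This reconciles the bilinear weak form of the Laplacian with the
sesquilinear `pairing`. -/
theorem IsEigenfn.smoothConj {lam : ℝ} {e : SmoothFn m Y} (he : IsEigenfn g μ lam e) :
    IsEigenfn g μ lam (smoothConj e) := by
  intro φ
  have h := congrArg conj (he (_root_.smoothConj φ))
  rw [← integral_conj, ← integral_conj] at h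
  have hcc : _root_.smoothConj (_root_.smoothConj φ) = φ := by
    ext y; exact Complex.conj_conj _
  simp only [← gradPair_smoothConj, hcc] at h
  rw [h]
  congr 1
  funext y
  show conj (conj (φ.1 y) * ((lam : ℂ) * e.1 y)) = φ.1 y * ((lam : ℂ) * conj (e.1 y))
  simp

/-- Green's formula against an eigenfunction. -/
theorem IsEigenfn.pairing_laplacian {lam : ℝ} {e : SmoothFn m Y} (he : IsEigenfn g μ lam e)
    (v : SmoothFn m Y) {f : Y → ℂ}
    (hf : ∀ φ : SmoothFn m Y, ∫ y, gradPair g φ.1 v.1 y ∂μ = ∫ y, φ.1 y * f y ∂μ) :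
    pairing μ e.1 f = lam * pairing μ e.1 v.1 := by
  have h1 := hf (_root_.smoothConj e)
  have h2 := he.smoothConj v
  simp only [gradPair_comm g v.1] at h2
  rw [h2] at h1
  rw [pairing, pairing]
  refine h1.symm.trans ?_
  rw [← integral_const_mul]
  congr 1
  funext y
  show v.1 y * ((lam : ℂ) * conj (e.1 y)) = (lam : ℂ) * (conj (e.1 y) * v.1 y)
  ring

theorem IsEigenfn.pairing_eq_zero {lam lam' : ℝ} {e e' : SmoothFn m Y}
    (he : IsEigenfn g μ lam e) (he' : IsEigenfn g μ lam' e') (hne : lam ≠ lam') :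
    pairing μ e.1 e'.1 = 0 := by
  have h := he.pairing_laplacian e' he'
  have h2 : pairing μ e.1 ((lam' : ℂ) • e').1 = lam' * pairing μ e.1 e'.1 := by
    rw [pairing, pairing, ← integral_const_mul]
    congr 1
    funext y
    show conj (e.1 y) * ((lam' : ℂ) * e'.1 y) = (lam' : ℂ) * (conj (e.1 y) * e'.1 y)
    ring
  rw [h2] at h
  have h3 : ((lam : ℂ) - lam') * pairing μ e.1 e'.1 = 0 := by rw [sub_mul, h, sub_self]
  exact (mul_eq_zero.1 h3).resolve_left (sub_ne_zero.2 (by exact_mod_cast hne))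

variable [BorelSpace Y] [T2Space Y] [CompactSpace Y]

/-- Testing the equation with conj e gives lam ‖e‖² = ∫ |de|². The function 0 satisfies the
eigenvalue equation for every `lam`, which is why it is excluded here and treated separately later.
-/
theorem IsEigenfn.nonneg (hμ : IsRiemannianVolume g μ) {lam : ℝ} {e : SmoothFn m Y}
    (he : IsEigenfn g μ lam e) (hne : ¬ e.1 =ᵐ[μ] 0) : 0 ≤ lam := by
  have := isFiniteMeasure_of_isRiemannianVolume hμ
  have hint : ∀ {f : Y → ℂ}, Continuous f → Integrable f μ := fun hf =>
    hf.integrable_of_hasCompactSupport (HasCompactSupport.of_compactSpace _)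
  have h := congrArg Complex.re (he (_root_.smoothConj e))
  have h1 : 0 ≤ (∫ y, gradPair g (_root_.smoothConj e).1 e.1 y ∂μ).re := by
    have := integral_re (𝕜 := ℂ) (hint (continuous_gradPair g (_root_.smoothConj e) e))
    refine le_of_le_of_eq ?_ this
    exact integral_nonneg fun y => gradPair_smoothConj_self_nonneg g e y
  have h2 : ∫ y, (_root_.smoothConj e).1 y * ((lam : ℂ) • e).1 y ∂μ
      = ((lam * ∫ y, ‖e.1 y‖ ^ 2 ∂μ : ℝ) : ℂ) := by
    rw [Complex.ofReal_mul, ← integral_complex_ofReal, ← integral_const_mul]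
    congr 1
    funext y
    show conj (e.1 y) * ((lam : ℂ) * e.1 y) = _
    rw [mul_left_comm, Complex.conj_mul']
    push_cast
    rfl
  rw [h2, Complex.ofReal_re] at h
  rw [h] at h1
  have hc : Continuous fun y => ‖e.1 y‖ ^ 2 := (e.2.continuous.norm).pow 2
  have h3 : 0 < ∫ y, ‖e.1 y‖ ^ 2 ∂μ := by
    refine lt_of_le_of_ne (integral_nonneg fun y => by positivity) fun h0 => hne ?_
    have := (integral_eq_zero_iff_of_nonneg (fun y => by positivity)
      (hc.integrable_of_hasCompactSupport (HasCompactSupport.of_compactSpace _))).1 h0.symm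
    filter_upwards [this] with y hy
    simpa using hy
  exact nonneg_of_mul_nonneg_left h1 h3

/-- The Laplacian of a smooth function depending smoothly on parameters. -/
theorem exists_laplacian (hμ : IsRiemannianVolume g μ) {u : Euc n × Y → ℂ}
    (hu : ContMDiff (𝓘(ℝ, Euc n).prod 𝓘(ℝ, Euc m)) 𝓘(ℝ, ℂ) ∞ u) :
    ∃ u' : Euc n × Y → ℂ, ContMDiff (𝓘(ℝ, Euc n).prod 𝓘(ℝ, Euc m)) 𝓘(ℝ, ℂ) ∞ u' ∧
      (∀ x, (∀ y, u (x, y) = 0) → ∀ y, u' (x, y) = 0) ∧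
      ∀ (x : Euc n) (φ : SmoothFn m Y),
        ∫ y, gradPair g φ.1 (fun y => u (x, y)) y ∂μ = ∫ y, φ.1 y * u' (x, y) ∂μ := by
  have := isFiniteMeasure_of_isRiemannianVolume hμ
  have hint : ∀ {f : Y → ℂ}, Continuous f → Integrable f μ := fun hf =>
    hf.integrable_of_hasCompactSupport (HasCompactSupport.of_compactSpace _)
  -- By compactness only finitely many members of the partition of unity are nonzero, and the local
  -- Laplacians are added.
  obtain ⟨f, hf⟩ := SmoothPartitionOfUnity.exists_isSubordinate_chartAt_source 𝓘(ℝ, Euc m) Y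
  have hfin : {i | (Function.support (f i)).Nonempty}.Finite :=
    f.locallyFinite.finite_nonempty_of_compact
  set s := hfin.toFinset
  have hsum : ∀ y, ∑ i ∈ s, f i y = 1 := by
    intro y
    rw [← f.sum_eq_one (mem_univ y)]
    refine (finsum_eq_sum_of_support_subset _ ?_).symm
    intro i hi
    simp only [s, Finite.coe_toFinset]
    exact ⟨y, hi⟩
  choose w hws hw0 hw using fun i : Y => exists_laplacian_of_tsupport_subset (n := n) hμ
    (chart_mem_atlas (Euc m) i) (f i).contMDiff (hf i) hu
  refine ⟨fun q => ∑ i ∈ s, w i q, contMDiff_finsetSum fun i _ => hws i, fun x hx y =>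
    Finset.sum_eq_zero fun i _ => hw0 i x hx y, fun x φ => ?_⟩
  let v : Y → SmoothFn m Y := fun i => ⟨fun y => (f i y : ℂ) * u (x, y),
    contDiff_mul.contMDiff.comp ((Complex.ofRealCLM.contDiff.contMDiff.comp
      (f i).contMDiff).prodMk_space (hu.comp (contMDiff_const.prodMk contMDiff_id)))⟩
  have hv : (fun y => u (x, y)) = (∑ i ∈ s, v i).1 := by
    funext y
    have : (∑ i ∈ s, v i).1 y = ∑ i ∈ s, (v i).1 y := by
      rw [AddSubmonoidClass.coe_finsetSum, Finset.sum_apply]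
    rw [this]
    simp only [v, ← Finset.sum_mul, ← Complex.ofReal_sum, hsum, Complex.ofReal_one, one_mul]
  rw [hv]
  simp only [gradPair_sum_right, Finset.mul_sum]
  rw [integral_finsetSum _ fun i _ => hint (continuous_gradPair g φ (v i)),
    integral_finsetSum _ fun i _ => hint (f := fun y => φ.1 y * w i (x, y))
      (φ.2.continuous.mul ((hws i).continuous.comp (by fun_prop)))]
  exact Finset.sum_congr rfl fun i _ => hw i x φ

end Eigenfunctions

/-! ### Test functions on `ℝⁿ × Y` -/

section TestFunctions

theorem fourierR_fderiv {k : ℕ} {f : Euc k → ℂ} (hf : ContDiff ℝ ∞ f) (hc : HasCompactSupport f)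
    (v ξ : Euc k) :
    fourierR (fun x => fderiv ℝ f x v) ξ = Complex.I * (inner ℝ v ξ : ℝ) * fourierR f ξ := by
  set e : Euc k → ℂ := fun x => Complex.exp (-(Complex.I * (inner ℝ x ξ : ℝ))) with he
  have hes : ContDiff ℝ ∞ e := by
    refine Complex.contDiff_exp.comp (contDiff_const.mul ?_).neg
    exact Complex.ofRealCLM.contDiff.comp (contDiff_id.inner ℝ contDiff_const)
  have hed : ∀ x, fderiv ℝ e x v = -(Complex.I * (inner ℝ v ξ : ℝ)) * e x := by
    intro x
    have h1 : HasFDerivAt (fun x : Euc k => (inner ℝ x ξ : ℝ)) (innerSL ℝ ξ) x := by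
      have := (innerSL ℝ ξ).hasFDerivAt (x := x)
      refine this.congr_of_eventuallyEq (Eventually.of_forall fun x => ?_)
      exact real_inner_comm _ _
    have h2 : HasFDerivAt (fun x : Euc k => ((inner ℝ x ξ : ℝ) : ℂ))
        (Complex.ofRealCLM.comp (innerSL ℝ ξ)) x := Complex.ofRealCLM.hasFDerivAt.comp x h1
    have h3 : HasFDerivAt e _ x := ((h2.const_mul Complex.I).neg).cexp
    rw [h3.fderiv]
    simp [he, real_inner_comm]
    ring
  have hi : ∀ {a b : Euc k → ℂ}, Continuous a → Continuous b → HasCompactSupport b →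
      Integrable (fun x => a x * b x) := fun ha hb hbc =>
    (ha.mul hb).integrable_of_hasCompactSupport hbc.mul_left
  have hfd : Continuous fun x => fderiv ℝ f x v :=
    (hf.continuous_fderiv (by simp)).clm_apply continuous_const
  have hfdc : HasCompactSupport fun x => fderiv ℝ f x v := hc.fderiv_apply ℝ v
  have hedc : Continuous fun x => fderiv ℝ e x v :=
    (hes.continuous_fderiv (by simp)).clm_apply continuous_const
  have := integral_mul_fderiv_eq_neg_fderiv_mul_of_integrable (μ := (volume : Measure (Euc k)))
    (f := e) (g := f) (v := v) (hi hedc hf.continuous hc) (hi hes.continuous hfd hfdc)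
    (hi hes.continuous hf.continuous hc) (fun x _ => hes.differentiable (by simp) x)
    (fun x _ => hf.differentiable (by simp) x)
  rw [fourierR, this, fourierR, ← integral_neg, ← integral_const_mul]
  congr 1
  funext x
  rw [hed]
  ring

variable {n m : ℕ} {Y : Type*} [TopologicalSpace Y] [ChartedSpace (Euc m) Y]

/-- A compact set of `ℝⁿ` that contains the support of a test function. -/
def testFnBase (u : TestFn m Y n) : Set (Euc n) := Prod.fst '' tsupport u.1

theorem testFn_isCompact_base (u : TestFn m Y n) : IsCompact (testFnBase u) :=
  u.2.2.image continuous_fst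

theorem testFn_eq_zero_of_notMem_base (u : TestFn m Y n) {x : Euc n} (hx : x ∉ testFnBase u)
    (y : Y) : u.1 (x, y) = 0 := by
  by_contra h
  exact hx ⟨(x, y), subset_tsupport u.1 h, rfl⟩

theorem testFn_contDiff_left (u : TestFn m Y n) (y : Y) : ContDiff ℝ ∞ fun x => u.1 (x, y) := by
  rw [← contMDiff_iff_contDiff]
  exact u.2.1.comp (contMDiff_id.prodMk contMDiff_const)

theorem testFn_hasCompactSupport_left (u : TestFn m Y n) (y : Y) :
    HasCompactSupport fun x => u.1 (x, y) :=
  HasCompactSupport.intro (testFn_isCompact_base u) fun _ hx =>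
    testFn_eq_zero_of_notMem_base u hx y

/-- The restriction of a test function to `{x} × Y`. -/
def testFnSlice (u : TestFn m Y n) (x : Euc n) : SmoothFn m Y :=
  ⟨fun y => u.1 (x, y), u.2.1.comp (contMDiff_const.prodMk contMDiff_id)⟩

/-- A smooth function on `ℝⁿ × Y` supported over a compact set of `ℝⁿ`, as a test function. -/
def testFnOfSmooth [T2Space Y] [CompactSpace Y] (u : Euc n × Y → ℂ)
    (hu : ContMDiff (𝓘(ℝ, Euc n).prod 𝓘(ℝ, Euc m)) 𝓘(ℝ, ℂ) ∞ u) {K : Set (Euc n)}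
    (hK : IsCompact K) (h0 : ∀ x ∉ K, ∀ y, u (x, y) = 0) : TestFn m Y n :=
  ⟨u, hu, HasCompactSupport.intro (hK.prod isCompact_univ) fun q hq => h0 q.1
    (fun h => hq ⟨h, mem_univ _⟩) q.2⟩

theorem continuous_testFn_left (u : TestFn m Y n) (y : Y) : Continuous fun x => u.1 (x, y) :=
  (testFn_contDiff_left u y).continuous

/-! ### Derivatives of test functions in the Euclidean variable. -/

section Derivative

variable [IsManifold 𝓘(ℝ, Euc m) ∞ Y]

/-- Joint smoothness of a partial derivative, from the theorem on derivatives with parameters; its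
tangent coordinates are trivial because source and target of the derivative are vector spaces. -/
theorem contMDiff_fderiv_left {u : Euc n × Y → ℂ}
    (hu : ContMDiff (𝓘(ℝ, Euc n).prod 𝓘(ℝ, Euc m)) 𝓘(ℝ, ℂ) ∞ u) (v : Euc n) :
    ContMDiff (𝓘(ℝ, Euc n).prod 𝓘(ℝ, Euc m)) 𝓘(ℝ, ℂ) ∞
      (fun q : Euc n × Y => fderiv ℝ (fun x => u (x, q.2)) q.1 v) := by
  intro q
  have : IsManifold (𝓘(ℝ, Euc n).prod 𝓘(ℝ, Euc m)) 1 (Euc n × Y) :=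
    IsManifold.of_le (n := ∞) (by simp)
  have h := ContMDiffAt.mfderiv (I := 𝓘(ℝ, Euc n)) (I' := 𝓘(ℝ, ℂ))
    (J := 𝓘(ℝ, Euc n).prod 𝓘(ℝ, Euc m)) (x₀ := q) (m := ∞) (n := ∞)
    (fun (q : Euc n × Y) (x : Euc n) => u (x, q.2)) (fun q : Euc n × Y => q.1)
    ((hu.comp (contMDiff_snd.prodMk (contMDiff_snd.comp contMDiff_fst))) (q, q.1))
    contMDiff_fst.contMDiffAt (by simp)
  let ψ : Euc n × Y → (Euc n →L[ℝ] ℂ) := fun q => fderiv ℝ (fun x => u (x, q.2)) q.1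
  have e := inTangentCoordinates_model_space (I := 𝓘(ℝ, Euc n)) (I' := 𝓘(ℝ, ℂ))
    (fun q : Euc n × Y => q.1) (fun q : Euc n × Y => u (q.1, q.2)) ψ q
  have h1 : ContMDiffAt (𝓘(ℝ, Euc n).prod 𝓘(ℝ, Euc m)) 𝓘(ℝ, Euc n →L[ℝ] ℂ) ∞ ψ q := by
    rw [← e]
    simp only [mfderiv_eq_fderiv] at h
    exact h
  have h2 := h1.clm_apply (contMDiffAt_const (c := v))
  exact h2

theorem testFn_exists_fderiv [T2Space Y] [CompactSpace Y] (u : TestFn m Y n) (v : Euc n) :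
    ∃ u' : TestFn m Y n, ∀ ξ y, (partialFourier u' ξ).1 y
      = Complex.I * (inner ℝ v ξ : ℝ) * (partialFourier u ξ).1 y := by
  refine ⟨testFnOfSmooth _ (contMDiff_fderiv_left u.2.1 v) (testFn_isCompact_base u) fun x hx y => ?_,
    fun ξ y => ?_⟩
  · rw [fderiv_zero_off (testFn_isCompact_base u).isClosed
      (fun x hx => testFn_eq_zero_of_notMem_base u hx y) hx]
    rfl
  · exact fourierR_fderiv (testFn_contDiff_left u y) (testFn_hasCompactSupport_left u y) v ξ

theorem integrable_fourierR_integrand {k : ℕ} {f : Euc k → ℂ} (hf : Integrable f) (ξ : Euc k) :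
    Integrable fun x => Complex.exp (-(Complex.I * (inner ℝ x ξ : ℝ))) * f x := by
  refine hf.bdd_mul (c := 1) (Continuous.aestronglyMeasurable (by fun_prop))
    (Eventually.of_forall fun x => ?_)
  rw [mul_comm, ← neg_mul, ← Complex.ofReal_neg, Complex.norm_exp_ofReal_mul_I]

theorem fourierR_add {k : ℕ} {f g : Euc k → ℂ} (hf : Integrable f) (hg : Integrable g)
    (ξ : Euc k) : fourierR (fun x => f x + g x) ξ = fourierR f ξ + fourierR g ξ := by
  simp only [fourierR, mul_add]
  exact integral_add (integrable_fourierR_integrand hf ξ) (integrable_fourierR_integrand hg ξ)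

theorem fourierR_const_mul {k : ℕ} (c : ℂ) (f : Euc k → ℂ) (ξ : Euc k) :
    fourierR (fun x => c * f x) ξ = c * fourierR f ξ := by
  simp only [fourierR, mul_left_comm _ c]
  exact integral_const_mul _ _

theorem partialFourier_add (u v : TestFn m Y n) (ξ : Euc n) :
    partialFourier (u + v) ξ = partialFourier u ξ + partialFourier v ξ := by
  ext y
  exact fourierR_add ((continuous_testFn_left u y).integrable_of_hasCompactSupport
    (testFn_hasCompactSupport_left u y)) ((continuous_testFn_left v y).integrable_of_hasCompactSupport
    (testFn_hasCompactSupport_left v y)) ξ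

theorem partialFourier_smul (c : ℂ) (u : TestFn m Y n) (ξ : Euc n) :
    partialFourier (c • u) ξ = c • partialFourier u ξ := by
  ext y
  exact fourierR_const_mul c _ ξ

/-- The partial Fourier transform, as a linear map. -/
def partialFourierₗ (ξ : Euc n) : TestFn m Y n →ₗ[ℂ] SmoothFn m Y where
  toFun u := partialFourier u ξ
  map_add' u v := partialFourier_add u v ξ
  map_smul' c u := partialFourier_smul c u ξ

/-- `(1 + Δ_X) u` for a test function `u`. -/
theorem testFn_exists_one_add_laplacian_left [T2Space Y] [CompactSpace Y] (u : TestFn m Y n) :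
    ∃ u' : TestFn m Y n, ∀ ξ, partialFourier u' ξ = ((1 + ‖ξ‖ ^ 2 : ℝ) : ℂ) • partialFourier u ξ := by
  choose D hD using fun (u : TestFn m Y n) (v : Euc n) => testFn_exists_fderiv u v
  have hD' : ∀ u v ξ, partialFourierₗ ξ (D u v)
      = (Complex.I * (inner ℝ v ξ : ℝ)) • partialFourierₗ ξ u := fun u v ξ => by
    ext y; exact hD u v ξ y
  let b : Fin n → Euc n := fun i => EuclideanSpace.single i 1
  refine ⟨u - ∑ i, D (D u (b i)) (b i), fun ξ => ?_⟩
  show partialFourierₗ ξ _ = _ • partialFourierₗ ξ u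
  rw [map_sub, map_sum]
  simp only [hD', smul_smul]
  rw [← Finset.sum_smul]
  have h1 : ∑ i, Complex.I * (inner ℝ (b i) ξ : ℝ) * (Complex.I * (inner ℝ (b i) ξ : ℝ))
      = ((-‖ξ‖ ^ 2 : ℝ) : ℂ) := by
    rw [EuclideanSpace.norm_sq_eq]
    push_cast
    rw [← Finset.sum_neg_distrib]
    refine Finset.sum_congr rfl fun i _ => ?_
    have : (inner ℝ (b i) ξ : ℝ) = ξ i := by simp [b, EuclideanSpace.inner_single_left]
    rw [this, Real.norm_eq_abs, ← Complex.ofReal_pow, sq_abs]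
    push_cast
    linear_combination ((ξ i : ℂ)) ^ 2 * Complex.I_mul_I
  rw [h1]
  push_cast
  module

end Derivative

end TestFunctions

/-! ### The partial Fourier transform of test functions -/

section PartialFourierEstimates

theorem norm_exp_neg_I_mul (a : ℝ) : ‖Complex.exp (-(Complex.I * (a : ℝ)))‖ = 1 := by
  rw [mul_comm, ← neg_mul, ← Complex.ofReal_neg, Complex.norm_exp_ofReal_mul_I]

theorem norm_exp_I_mul (a : ℝ) : ‖Complex.exp (Complex.I * (a : ℝ))‖ = 1 := by
  rw [mul_comm, Complex.norm_exp_ofReal_mul_I]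

theorem norm_exp_neg_I_mul_sub_le (a b : ℝ) :
    ‖Complex.exp (-(Complex.I * (a : ℝ))) - Complex.exp (-(Complex.I * (b : ℝ)))‖ ≤ |a - b| := by
  have h1 : Complex.exp (-(Complex.I * (a : ℝ))) - Complex.exp (-(Complex.I * (b : ℝ)))
      = Complex.exp (-(Complex.I * (b : ℝ))) *
        (Complex.exp (Complex.I * ((b - a : ℝ) : ℂ)) - 1) := by
    rw [mul_sub, ← Complex.exp_add, mul_one]
    congr 2
    push_cast
    ring
  rw [h1, norm_mul, norm_exp_neg_I_mul, one_mul]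
  refine (Real.norm_exp_I_mul_ofReal_sub_one_le (x := b - a)).trans ?_
  rw [Real.norm_eq_abs, abs_sub_comm]

variable {n m : ℕ} {Y : Type*} [TopologicalSpace Y] [ChartedSpace (Euc m) Y]
  [IsManifold 𝓘(ℝ, Euc m) ∞ Y]

/-- The compact support in x gives a uniform bound, and also a Lipschitz bound in ξ, since e^{-ix·ξ}
is |x|-Lipschitz there. The latter is used for joint continuity in (x, ξ). -/
theorem exists_bound_partialFourier (u : TestFn m Y n) :
    ∃ C : ℝ, 0 ≤ C ∧ (∀ ξ y, ‖(partialFourier u ξ).1 y‖ ≤ C) ∧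
      ∀ ξ ξ' y, ‖(partialFourier u ξ).1 y - (partialFourier u ξ').1 y‖ ≤ C * ‖ξ - ξ'‖ := by
  obtain ⟨M, hM⟩ := u.2.1.continuous.bounded_above_of_compact_support u.2.2
  have hM' : ∀ q, ‖u.1 q‖ ≤ max M 0 := fun q => (hM q).trans (le_max_left _ _)
  set B := testFnBase u
  have hB : IsCompact B := testFn_isCompact_base u
  obtain ⟨R, hR⟩ := hB.isBounded.exists_norm_le
  set V : ℝ := (volume B).toReal
  have hint : ∀ y, Integrable fun x => u.1 (x, y) := fun y =>
    (continuous_testFn_left u y).integrable_of_hasCompactSupport (testFn_hasCompactSupport_left u y)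
  have key : ∀ (F : Euc n → ℂ) (c : ℝ), (∀ x ∈ B, ‖F x‖ ≤ c) → (∀ x ∉ B, F x = 0) →
      ‖∫ x, F x‖ ≤ c * V := by
    intro F c h1 h2
    rw [← setIntegral_eq_integral_of_forall_compl_eq_zero h2]
    exact norm_setIntegral_le_of_norm_le_const hB.measure_lt_top h1
  refine ⟨max M 0 * V + |R| * max M 0 * V, by positivity, fun ξ y => ?_, fun ξ ξ' y => ?_⟩
  · refine le_trans ?_ (le_add_of_nonneg_right (by positivity))
    refine key _ _ (fun x _ => ?_) fun x hx => ?_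
    · rw [norm_mul, norm_exp_neg_I_mul, one_mul]
      exact hM' _
    · show _ * u.1 (x, y) = 0
      rw [testFn_eq_zero_of_notMem_base u hx, mul_zero]
  · show ‖fourierR _ ξ - fourierR _ ξ'‖ ≤ _
    rw [fourierR, fourierR, ← integral_sub (integrable_fourierR_integrand (hint y) ξ)
      (integrable_fourierR_integrand (hint y) ξ')]
    have := key (fun x => Complex.exp (-(Complex.I * (inner ℝ x ξ : ℝ))) * u.1 (x, y)
      - Complex.exp (-(Complex.I * (inner ℝ x ξ' : ℝ))) * u.1 (x, y)) (|R| * ‖ξ - ξ'‖ * max M 0)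
      (fun x hx => ?_) fun x hx => ?_
    · refine this.trans ?_
      have h0 : 0 ≤ max M 0 * V * ‖ξ - ξ'‖ := by positivity
      nlinarith
    · rw [← sub_mul, norm_mul]
      refine mul_le_mul ((norm_exp_neg_I_mul_sub_le _ _).trans ?_) (hM' _) (norm_nonneg _)
        (by positivity)
      rw [← inner_sub_right]
      exact (abs_real_inner_le_norm _ _).trans
        (mul_le_mul_of_nonneg_right ((hR x hx).trans (le_abs_self R)) (norm_nonneg _))
    · rw [testFn_eq_zero_of_notMem_base u hx]; simp

theorem continuous_partialFourier (u : TestFn m Y n) :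
    Continuous fun q : Euc n × Y => (partialFourier u q.1).1 q.2 := by
  obtain ⟨C, hC0, -, hC⟩ := exists_bound_partialFourier u
  rw [continuous_iff_continuousAt]
  rintro ⟨ξ, y⟩
  rw [ContinuousAt, tendsto_iff_norm_sub_tendsto_zero]
  have h1 : Tendsto (fun q : Euc n × Y => C * ‖q.1 - ξ‖ +
      ‖(partialFourier u ξ).1 q.2 - (partialFourier u ξ).1 y‖) (𝓝 (ξ, y)) (𝓝 0) := by
    have : Continuous fun q : Euc n × Y => C * ‖q.1 - ξ‖ +
        ‖(partialFourier u ξ).1 q.2 - (partialFourier u ξ).1 y‖ := by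
      have := (partialFourier u ξ).2.continuous
      fun_prop
    convert! this.tendsto (ξ, y) using 2
    simp
  refine squeeze_zero (fun _ => norm_nonneg _) (fun q => ?_) h1
  calc _ = ‖((partialFourier u q.1).1 q.2 - (partialFourier u ξ).1 q.2)
        + ((partialFourier u ξ).1 q.2 - (partialFourier u ξ).1 y)‖ := by congr 1; ring
    _ ≤ _ := (norm_add_le _ _).trans (add_le_add_left (hC _ _ _) _)

variable [MeasurableSpace Y] {μ : Measure Y}

theorem pairing_smul (φ : Y → ℂ) (c : ℂ) (v : Y → ℂ) :
    pairing μ φ (c • v) = c * pairing μ φ v := by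
  rw [pairing, pairing, ← integral_const_mul]
  congr 1
  funext y
  rw [Pi.smul_apply, smul_eq_mul]
  ring

variable [BorelSpace Y] [T2Space Y] [CompactSpace Y]

theorem continuous_integrable_of_compact [IsFiniteMeasure μ] {f : Y → ℂ} (hf : Continuous f) :
    Integrable f μ :=
  hf.integrable_of_hasCompactSupport (HasCompactSupport.of_compactSpace _)

theorem pairing_add [IsFiniteMeasure μ] (φ v w : SmoothFn m Y) :
    pairing μ φ.1 (v + w).1 = pairing μ φ.1 v.1 + pairing μ φ.1 w.1 := by
  have hc : Continuous fun y => conj (φ.1 y) := Complex.continuous_conj.comp φ.2.continuous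
  have h := integral_add (μ := μ) (f := fun y => conj (φ.1 y) * v.1 y)
    (g := fun y => conj (φ.1 y) * w.1 y)
    (continuous_integrable_of_compact (hc.mul v.2.continuous))
    (continuous_integrable_of_compact (hc.mul w.2.continuous))
  refine Eq.trans ?_ h
  exact integral_congr_ae (Eventually.of_forall fun y => mul_add _ _ _)

theorem fourierR_pairing [IsFiniteMeasure μ] (φ : SmoothFn m Y) (u : TestFn m Y n) (ξ : Euc n) :
    fourierR (fun x => pairing μ φ.1 fun y => u.1 (x, y)) ξ
      = pairing μ φ.1 (partialFourier u ξ).1 := by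
  have hc : Continuous fun y => conj (φ.1 y) := Complex.continuous_conj.comp φ.2.continuous
  have hu := u.2.1.continuous
  have hF : Integrable (fun q : Euc n × Y => Complex.exp (-(Complex.I * (inner ℝ q.1 ξ : ℝ))) *
      (conj (φ.1 q.2) * u.1 q)) ((volume : Measure (Euc n)).prod μ) := by
    refine Continuous.integrable_of_hasCompactSupport ?_ ?_
    · have : Continuous fun q : Euc n × Y => conj (φ.1 q.2) := hc.comp continuous_snd
      fun_prop
    · exact (u.2.2.mul_left).mul_left
  show ∫ x, _ * pairing μ φ.1 (fun y => u.1 (x, y)) = ∫ y, conj (φ.1 y) * fourierR _ ξ ∂μ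
  simp only [pairing, fourierR, ← integral_const_mul]
  rw [integral_integral_swap hF]
  congr 1
  funext y
  congr 1
  funext x
  ring

theorem continuous_pairing_slice [IsFiniteMeasure μ] (φ : SmoothFn m Y) (u : TestFn m Y n) :
    Continuous fun x => pairing μ φ.1 fun y => u.1 (x, y) := by
  have hc : Continuous fun y => conj (φ.1 y) := Complex.continuous_conj.comp φ.2.continuous
  have hu := u.2.1.continuous
  have : Continuous (Function.uncurry fun (x : Euc n) (y : Y) => conj (φ.1 y) * u.1 (x, y)) := by
    have h : Continuous fun q : Euc n × Y => conj (φ.1 q.2) := hc.comp continuous_snd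
    exact h.mul hu
  simpa [pairing] using continuous_parametric_integral_of_continuous this isCompact_univ (μ := μ)

theorem exists_testFn_power_left (u : TestFn m Y n) (j : ℕ) :
    ∃ u' : TestFn m Y n, ∀ ξ, partialFourier u' ξ
      = (((1 + ‖ξ‖ ^ 2) ^ j : ℝ) : ℂ) • partialFourier u ξ := by
  induction j with
  | zero => exact ⟨u, fun ξ => by simp⟩
  | succ j ih =>
    obtain ⟨w, hw⟩ := ih
    obtain ⟨w', hw'⟩ := testFn_exists_one_add_laplacian_left w
    refine ⟨w', fun ξ => ?_⟩
    rw [hw', hw, smul_smul, ← Complex.ofReal_mul, pow_succ' (1 + ‖ξ‖ ^ 2)]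

/-- (1 + Δ_X)^j u with an integer j ≥ r is again a test function, and its transform is bounded. -/
theorem exists_decay_partialFourier (u : TestFn m Y n) (r : ℝ) :
    ∃ C : ℝ, 0 ≤ C ∧ ∀ ξ y, ‖(partialFourier u ξ).1 y‖ ≤ C * (1 + ‖ξ‖ ^ 2) ^ (-r) := by
  obtain ⟨j, hj⟩ := exists_nat_ge r
  obtain ⟨u', hu'⟩ := exists_testFn_power_left u j
  obtain ⟨C, hC0, hC, -⟩ := exists_bound_partialFourier u'
  refine ⟨C, hC0, fun ξ y => ?_⟩
  have h1 := hC ξ y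
  rw [hu'] at h1
  have h2 : ‖(((1 + ‖ξ‖ ^ 2) ^ j : ℝ) : ℂ) * (partialFourier u ξ).1 y‖ ≤ C := h1
  rw [norm_mul, Complex.norm_real, Real.norm_of_nonneg (by positivity)] at h2
  have h3 : (1 + ‖ξ‖ ^ 2) ^ r ≤ (1 + ‖ξ‖ ^ 2) ^ j := by
    rw [← Real.rpow_natCast (1 + ‖ξ‖ ^ 2)]
    exact Real.rpow_le_rpow_of_exponent_le (le_add_of_nonneg_right (sq_nonneg ‖ξ‖)) hj
  have hp : 0 < 1 + ‖ξ‖ ^ 2 := by positivity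
  rw [Real.rpow_neg hp.le, ← div_eq_mul_inv, le_div_iff₀ (Real.rpow_pos_of_pos hp _)]
  calc _ ≤ ‖(partialFourier u ξ).1 y‖ * (1 + ‖ξ‖ ^ 2) ^ j :=
        mul_le_mul_of_nonneg_left h3 (norm_nonneg _)
    _ ≤ C := by rwa [mul_comm]

theorem integrable_one_add_norm_sq_rpow {k : ℕ} {r : ℝ} (hr : (k : ℝ) < 2 * r) :
    Integrable fun x : Euc k => (1 + ‖x‖ ^ 2) ^ (-r) := by
  have := integrable_rpow_neg_one_add_norm_sq (E := Euc k) (μ := volume) (r := 2 * r) (by simpa)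
  convert! this using 3
  ring

/-- Absolute convergence that permits exchanging the real power (1 + Δ_X)^N with integration over Y.
-/
theorem integrable_besselPower_integrand (N : ℝ) (u : TestFn m Y n) {w : Y → ℂ}
    (hw : Continuous w) [IsFiniteMeasure μ] :
    Integrable (fun q : Y × Euc n => w q.1 * ((((1 + ‖q.2‖ ^ 2) ^ N : ℝ) : ℂ)
      * (partialFourier u q.2).1 q.1)) (μ.prod (volume : Measure (Euc n))) := by
  -- The part N of the exponent cancels the multiplier; (1 + |ξ|²)^{-(n+1)} is integrable.
  obtain ⟨C, hC0, hC⟩ := exists_decay_partialFourier u (N + (n + 1))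
  obtain ⟨M, hM⟩ := isCompact_univ.exists_bound_of_continuousOn hw.continuousOn
  have h1 : Integrable (fun q : Y × Euc n => (|M| * C) * (1 + ‖q.2‖ ^ 2) ^ (-(n + 1 : ℝ)))
      (μ.prod (volume : Measure (Euc n))) := by
    exact ((integrable_one_add_norm_sq_rpow (by
      have : (0 : ℝ) ≤ n := Nat.cast_nonneg n
      linarith)).comp_snd μ).const_mul _
  refine h1.mono' (Continuous.aestronglyMeasurable ?_) (Eventually.of_forall fun q => ?_)
  · refine (hw.comp continuous_fst).mul (Continuous.mul ?_ ?_)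
    · refine Complex.continuous_ofReal.comp (Continuous.rpow_const (by fun_prop) fun q => Or.inl ?_)
      exact (show 0 < 1 + ‖q.2‖ ^ 2 by positivity).ne'
    · have := (continuous_partialFourier u).comp
        (f := fun q : Y × Euc n => (q.2, q.1)) (continuous_snd.prodMk continuous_fst)
      exact this
  · have hp : 0 < 1 + ‖q.2‖ ^ 2 := by positivity
    have hpN : 0 ≤ (1 + ‖q.2‖ ^ 2) ^ N := (Real.rpow_pos_of_pos hp N).le
    have h2 : ‖w q.1‖ ≤ |M| := (hM _ (mem_univ _)).trans (le_abs_self M)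
    have h3 := mul_le_mul_of_nonneg_left (hC q.2 q.1) hpN
    rw [norm_mul, norm_mul, Complex.norm_real, Real.norm_of_nonneg hpN]
    refine (mul_le_mul h2 h3 (mul_nonneg hpN (norm_nonneg _)) (abs_nonneg _)).trans (le_of_eq ?_)
    rw [mul_left_comm ((1 + ‖q.2‖ ^ 2) ^ N), ← Real.rpow_add hp,
      show N + -(N + (n + 1)) = -(n + 1 : ℝ) by ring]
    ring

/-- `(1 + Δ_X)^N` commutes with pairings on `Y`. -/
theorem pairing_besselPower [IsFiniteMeasure μ] (N : ℝ) (φ : SmoothFn m Y) (u : TestFn m Y n)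
    (x : Euc n) :
    pairing μ φ.1 (fun y => besselPower N (fun x' => u.1 (x', y)) x)
      = besselPower N (fun x' => pairing μ φ.1 fun y => u.1 (x', y)) x := by
  have hc : Continuous fun y => conj (φ.1 y) := Complex.continuous_conj.comp φ.2.continuous
  have hF := integrable_besselPower_integrand (μ := μ) N u hc
  have hF' : Integrable (fun q : Y × Euc n => Complex.exp (Complex.I * (inner ℝ x q.2 : ℝ)) *
      (conj (φ.1 q.1) * ((((1 + ‖q.2‖ ^ 2) ^ N : ℝ) : ℂ) * (partialFourier u q.2).1 q.1)))
      (μ.prod (volume : Measure (Euc n))) :=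
    hF.bdd_mul (c := 1) (Continuous.aestronglyMeasurable (by fun_prop))
      (Eventually.of_forall fun q => (norm_exp_I_mul _).le)
  simp only [besselPower, fourierInvR, fourierR_pairing]
  simp only [pairing]
  simp only [mul_left_comm _ (((2 * Real.pi) ^ n : ℝ) : ℂ)⁻¹, integral_const_mul]
  congr 1
  simp only [← integral_const_mul]
  have e1 : ∀ (y : Y) (ξ : Euc n), conj (φ.1 y) * (Complex.exp (Complex.I * (inner ℝ x ξ : ℝ)) *
      ((((1 + ‖ξ‖ ^ 2) ^ N : ℝ) : ℂ) * fourierR (fun x' => u.1 (x', y)) ξ))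
      = Complex.exp (Complex.I * (inner ℝ x ξ : ℝ)) *
      (conj (φ.1 y) * ((((1 + ‖ξ‖ ^ 2) ^ N : ℝ) : ℂ) * (partialFourier u ξ).1 y)) := by
    intro y ξ
    show _ = Complex.exp (Complex.I * (inner ℝ x ξ : ℝ)) *
      (conj (φ.1 y) * ((((1 + ‖ξ‖ ^ 2) ^ N : ℝ) : ℂ) * fourierR (fun x' => u.1 (x', y)) ξ))
    ring
  simp only [e1]
  rw [integral_integral_swap hF']
  congr 1
  funext ξ
  congr 1
  funext y
  ring

theorem integrable_besselPower_pairing [IsFiniteMeasure μ] (N : ℝ) (φ : SmoothFn m Y)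
    (u : TestFn m Y n) :
    Integrable fun ξ => (((1 + ‖ξ‖ ^ 2) ^ N : ℝ) : ℂ) *
      fourierR (fun x => pairing μ φ.1 fun y => u.1 (x, y)) ξ := by
  have hc : Continuous fun y => conj (φ.1 y) := Complex.continuous_conj.comp φ.2.continuous
  have hF := (integrable_besselPower_integrand (μ := μ) N u hc).integral_prod_right
  refine hF.congr (Eventually.of_forall fun ξ => ?_)
  show _ = _ * fourierR (fun x => pairing μ φ.1 fun y => u.1 (x, y)) ξ
  rw [fourierR_pairing, pairing, ← integral_const_mul]
  refine integral_congr_ae (Eventually.of_forall fun y => ?_)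
  show _ = _
  ring

variable {g : RMetric m Y}

/-- Green's formula on every slice {x} × Y, followed by the Fourier transform in x, which commutes
with the pairing. -/
theorem exists_testFn_laplacian (hμ : IsRiemannianVolume g μ) (u : TestFn m Y n) :
    ∃ u' : TestFn m Y n, ∀ (lam : ℝ) (e : SmoothFn m Y), IsEigenfn g μ lam e → ∀ ξ,
      pairing μ e.1 (partialFourier u' ξ).1 = lam * pairing μ e.1 (partialFourier u ξ).1 := by
  have := isFiniteMeasure_of_isRiemannianVolume hμ
  obtain ⟨w, hws, hw0, hw⟩ := exists_laplacian hμ u.2.1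
  refine ⟨testFnOfSmooth w hws (testFn_isCompact_base u) fun x hx =>
    hw0 x (testFn_eq_zero_of_notMem_base u hx), fun lam e he ξ => ?_⟩
  rw [← fourierR_pairing, ← fourierR_pairing, ← fourierR_const_mul]
  congr 1
  funext x
  exact he.pairing_laplacian (testFnSlice u x) (hw x)

/-- `(1 + Δ_X)^j (1 + Δ_Y)^k u` for a test function `u`. -/
theorem exists_testFn_power (hμ : IsRiemannianVolume g μ) (u : TestFn m Y n) (j k : ℕ) :
    ∃ u' : TestFn m Y n, ∀ (lam : ℝ) (e : SmoothFn m Y), IsEigenfn g μ lam e → ∀ ξ,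
      pairing μ e.1 (partialFourier u' ξ).1
        = (((1 + ‖ξ‖ ^ 2) ^ j * (1 + lam) ^ k : ℝ) : ℂ) * pairing μ e.1 (partialFourier u ξ).1 := by
  have := isFiniteMeasure_of_isRiemannianVolume hμ
  induction k with
  | zero =>
    obtain ⟨w, hw⟩ := exists_testFn_power_left u j
    refine ⟨w, fun lam e _ ξ => ?_⟩
    rw [hw, pow_zero, mul_one]
    exact pairing_smul _ _ _
  | succ k ih =>
    obtain ⟨w, hw⟩ := ih
    obtain ⟨w', hw'⟩ := exists_testFn_laplacian hμ w
    refine ⟨w + w', fun lam e he ξ => ?_⟩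
    rw [partialFourier_add, pairing_add, hw' lam e he, hw lam e he]
    push_cast
    ring

end PartialFourierEstimates

/-! ### Moment problems in Hilbert spaces -/

section Hilbert

variable {H F : Type*} [NormedAddCommGroup H] [InnerProductSpace ℂ H] [CompleteSpace H]
  [NormedAddCommGroup F] [NormedSpace ℂ F] [CompleteSpace F] {ι : Type*}

/-- A linear relation `e x ↦ f x` with `‖f x‖ ≤ B ‖e x‖` extends to a bounded operator. -/
theorem exists_clm_of_norm_le {E : Type*} [AddCommGroup E] [Module ℂ E] (e : E →ₗ[ℂ] H)
    (f : E →ₗ[ℂ] F) {B : ℝ} (hB : 0 ≤ B) (h : ∀ x, ‖f x‖ ≤ B * ‖e x‖) :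
    ∃ T : H →L[ℂ] F, ‖T‖ ≤ B ∧ ∀ x, T (e x) = f x := by
  set V := (LinearMap.range e).topologicalClosure with hV
  have hmem : ∀ x, e x ∈ V := fun x =>
    (LinearMap.range e).le_topologicalClosure (LinearMap.mem_range_self e x)
  have : CompleteSpace V := (LinearMap.range e).isClosed_topologicalClosure.completeSpace_coe
  let e' : E →ₗ[ℂ] V := e.codRestrict V hmem
  have hd : DenseRange e' := by
    intro v
    rw [Metric.mem_closure_iff]
    intro ε hε
    have hv : (v : H) ∈ closure (LinearMap.range e : Set H) := v.2
    obtain ⟨b, ⟨x, rfl⟩, hb⟩ := Metric.mem_closure_iff.1 hv ε hε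
    exact ⟨e' x, ⟨x, rfl⟩, hb⟩
  have h' : ∀ x, ‖f x‖ ≤ B * ‖e' x‖ := h
  -- The extension by continuity lives on the closure of the range of `e`; the orthogonal projection
  -- extends it to `H` without increasing the norm.
  refine ⟨(f.extendOfNorm e').comp V.orthogonalProjectionOnto, ?_, fun x => ?_⟩
  · calc _ ≤ ‖f.extendOfNorm e'‖ * ‖V.orthogonalProjectionOnto‖ :=
          ContinuousLinearMap.opNorm_comp_le _ _
      _ ≤ B * 1 := mul_le_mul (LinearMap.opNorm_extendOfNorm_le hd hB h')
          V.orthogonalProjectionOnto_norm_le (ContinuousLinearMap.opNorm_nonneg _) hB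
      _ = B := mul_one B
  · rw [ContinuousLinearMap.comp_apply]
    have : V.orthogonalProjectionOnto (e x) = e' x :=
      V.orthogonalProjectionOnto_mem_subspace_eq_self (e' x)
    rw [this]
    exact LinearMap.extendOfNorm_eq hd ⟨B, h'⟩ x

/-- The moment problem ⟨x_i, w⟩ = c_i: the bound makes Σ t_i x_i ↦ Σ t_i conj(c_i) a well-defined
functional of norm at most B, and the Riesz theorem represents it. Projecting onto the closed span
keeps the moments and makes the solution unique (`eq_of_forall_inner_eq`). -/
theorem exists_inner_eq (x : ι → H) (c : ι → ℂ) {B : ℝ} (hB : 0 ≤ B)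
    (h : ∀ a : ι →₀ ℂ, ‖a.sum fun i t => conj t * c i‖ ≤ B * ‖a.sum fun i t => t • x i‖) :
    ∃ w ∈ (Submodule.span ℂ (range x)).topologicalClosure, ‖w‖ ≤ B ∧
      ∀ i, inner ℂ (x i) w = c i := by
  obtain ⟨T, hT, hTx⟩ := exists_clm_of_norm_le (Finsupp.linearCombination ℂ x)
    (Finsupp.linearCombination ℂ fun i => conj (c i)) hB (fun a => by
      refine le_trans (le_of_eq ?_) (h a)
      rw [← RCLike.norm_conj, Finsupp.linearCombination_apply, Finsupp.sum, Finsupp.sum, map_sum]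
      congr 1
      refine Finset.sum_congr rfl fun i _ => ?_
      simp)
  set V := (Submodule.span ℂ (range x)).topologicalClosure with hV
  have : CompleteSpace V :=
    (Submodule.span ℂ (range x)).isClosed_topologicalClosure.completeSpace_coe
  set w := (InnerProductSpace.toDual ℂ H).symm T with hw
  refine ⟨V.starProjection w, V.starProjection_apply_mem w, ?_, fun i => ?_⟩
  · refine (V.starProjection.le_opNorm w).trans ?_
    refine (mul_le_mul_of_nonneg_right V.starProjection_norm_le (norm_nonneg _)).trans ?_
    rwa [one_mul, hw, LinearIsometryEquiv.norm_map]
  · have hx : x i ∈ V := Submodule.le_topologicalClosure _ (Submodule.subset_span ⟨i, rfl⟩)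
    rw [← V.inner_starProjection_left_eq_right, Submodule.starProjection_eq_self_iff.2 hx,
      ← inner_conj_symm, hw, InnerProductSpace.toDual_symm_apply]
    have := hTx (Finsupp.single i 1)
    simp only [Finsupp.linearCombination_single, one_smul] at this
    rw [this, RingHomCompTriple.comp_apply, RingHom.id_apply]

theorem eq_of_forall_inner_eq {x : ι → H} {w w' : H}
    (hw : w ∈ (Submodule.span ℂ (range x)).topologicalClosure)
    (hw' : w' ∈ (Submodule.span ℂ (range x)).topologicalClosure)
    (h : ∀ i, inner ℂ (x i) w = inner ℂ (x i) w') : w = w' := by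
  rw [← sub_eq_zero]
  have h1 : w - w' ∈ (Submodule.span ℂ (range x))ᗮ := by
    rw [Submodule.mem_orthogonal]
    intro v hv
    induction hv using Submodule.span_induction with
    | mem v hv =>
      obtain ⟨i, rfl⟩ := hv
      rw [inner_sub_right, h, sub_self]
    | zero => simp
    | add v v' _ _ h1 h2 => rw [inner_add_left, h1, h2, add_zero]
    | smul c v _ h1 => rw [inner_smul_left, h1, mul_zero]
  rw [← Submodule.orthogonal_closure] at h1
  exact inner_self_eq_zero.1 (Submodule.inner_right_of_mem_orthogonal
    (Submodule.sub_mem _ hw hw') h1)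

theorem norm_sum_sq_of_orthogonal {T : Finset ι} {y : ι → H}
    (h : ∀ i ∈ T, ∀ j ∈ T, i ≠ j → inner ℂ (y i) (y j) = 0) :
    ‖∑ i ∈ T, y i‖ ^ 2 = ∑ i ∈ T, ‖y i‖ ^ 2 := by
  classical
  induction T using Finset.induction_on with
  | empty => simp
  | insert i T hi ih =>
    have h0 : inner ℂ (y i) (∑ j ∈ T, y j) = 0 := by
      rw [inner_sum]
      exact Finset.sum_eq_zero fun j hj => h i (Finset.mem_insert_self _ _) j
        (Finset.mem_insert_of_mem hj) fun e => hi (e ▸ hj)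
    rw [Finset.sum_insert hi, Finset.sum_insert hi, ← ih fun j hj k hk =>
      h j (Finset.mem_insert_of_mem hj) k (Finset.mem_insert_of_mem hk)]
    have := norm_add_sq_eq_norm_sq_add_norm_sq_of_inner_eq_zero _ _ h0
    simpa [sq] using this

/-- Spectral multipliers on sums of eigenvectors. -/
theorem norm_sum_smul_le_of_orthogonal {x : ι → H} {lam : ι → ℝ}
    (horth : ∀ i j, lam i ≠ lam j → inner ℂ (x i) (x j) = 0) {φ : ℝ → ℝ} {M : ℝ} (hM : 0 ≤ M)
    (hφ : ∀ i, x i ≠ 0 → |φ (lam i)| ≤ M) (a : ι →₀ ℂ) :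
    ‖a.sum fun i t => ((φ (lam i) : ℂ) * t) • x i‖ ≤ M * ‖a.sum fun i t => t • x i‖ := by
  classical
  set S := a.support
  -- Vectors with the same eigenvalue need not be orthogonal, so the sum is grouped by eigenvalue
  -- before Pythagoras is applied.
  set y : ℝ → H := fun l => ∑ i ∈ S with lam i = l, a i • x i with hy
  have hyo : ∀ l l', l ≠ l' → inner ℂ (y l) (y l') = 0 := by
    intro l l' hl
    simp only [hy, sum_inner, inner_sum]
    refine Finset.sum_eq_zero fun i hi => Finset.sum_eq_zero fun j hj => ?_
    rw [inner_smul_left, inner_smul_right, horth, mul_zero, mul_zero]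
    rw [(Finset.mem_filter.1 hi).2, (Finset.mem_filter.1 hj).2]
    exact hl
  have hyφ : ∀ l, ‖(φ l : ℂ) • y l‖ ^ 2 ≤ M ^ 2 * ‖y l‖ ^ 2 := by
    intro l
    by_cases h0 : y l = 0
    · simp [h0]
    · obtain ⟨i, hi, hne⟩ := Finset.exists_ne_zero_of_sum_ne_zero h0
      have hφl := hφ i fun e => hne (by rw [e, smul_zero])
      rw [(Finset.mem_filter.1 hi).2] at hφl
      rw [norm_smul, mul_pow, Complex.norm_real, Real.norm_eq_abs]
      exact mul_le_mul_of_nonneg_right (pow_le_pow_left₀ (abs_nonneg _) hφl 2) (sq_nonneg _)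
  have h1 : (a.sum fun i t => t • x i) = ∑ l ∈ S.image lam, y l :=
    (Finset.sum_fiberwise_of_maps_to (fun i hi => Finset.mem_image_of_mem lam hi) _).symm
  have h2 : (a.sum fun i t => ((φ (lam i) : ℂ) * t) • x i)
      = ∑ l ∈ S.image lam, (φ l : ℂ) • y l := by
    rw [Finsupp.sum, ← Finset.sum_fiberwise_of_maps_to
      (fun i hi => Finset.mem_image_of_mem lam hi)]
    refine Finset.sum_congr rfl fun l _ => ?_
    rw [hy, Finset.smul_sum]
    refine Finset.sum_congr rfl fun i hi => ?_
    rw [(Finset.mem_filter.1 hi).2, mul_smul]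
  refine le_of_sq_le_sq ?_ (by positivity)
  rw [h1, h2, mul_pow, norm_sum_sq_of_orthogonal fun l _ l' _ => hyo l l',
    norm_sum_sq_of_orthogonal fun l _ l' _ h => ?_, Finset.mul_sum]
  · exact Finset.sum_le_sum fun l _ => hyφ l
  · rw [inner_smul_left, inner_smul_right, hyo l l' h, mul_zero, mul_zero]

/-- The dual statement: the multiplier bound on finite sums of eigenvectors is exactly the
solvability condition of the moment problem for φ(lam) ⟨x, w⟩. -/
theorem exists_inner_eq_smul {x : ι → H} {lam : ι → ℝ}
    (horth : ∀ i j, lam i ≠ lam j → inner ℂ (x i) (x j) = 0) {φ : ℝ → ℝ} {M : ℝ} (hM : 0 ≤ M)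
    (hφ : ∀ i, x i ≠ 0 → |φ (lam i)| ≤ M) (w : H) :
    ∃ w' : H, ‖w'‖ ≤ M * ‖w‖ ∧ ∀ i, inner ℂ (x i) w' = φ (lam i) * inner ℂ (x i) w := by
  obtain ⟨w', -, hn, hw'⟩ := exists_inner_eq x (fun i => (φ (lam i) : ℂ) * inner ℂ (x i) w)
    (B := M * ‖w‖) (by positivity) fun a => by
      have h1 : (a.sum fun i t => conj t * ((φ (lam i) : ℂ) * inner ℂ (x i) w))
          = inner ℂ (a.sum fun i t => ((φ (lam i) : ℂ) * t) • x i) w := by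
        rw [Finsupp.sum, Finsupp.sum, sum_inner]
        refine Finset.sum_congr rfl fun i _ => ?_
        rw [inner_smul_left, map_mul, Complex.conj_ofReal]
        ring
      rw [h1]
      refine (norm_inner_le_norm _ _).trans ?_
      rw [mul_right_comm]
      exact mul_le_mul_of_nonneg_right (norm_sum_smul_le_of_orthogonal horth hM hφ a)
        (norm_nonneg _)
  exact ⟨w', hn, hw'⟩

end Hilbert

/-! ### Eigenfunctions as vectors of `L²(Y)` -/

section EigenVectors

theorem enorm_sq_eq_lintegral {α : Type*} [MeasurableSpace α] {ν : Measure α} (f : Lp ℂ 2 ν) :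
    ‖f‖ₑ ^ 2 = ∫⁻ z, ‖f z‖ₑ ^ 2 ∂ν := by
  rw [Lp.enorm_def, eLpNorm_eq_lintegral_rpow_enorm_toReal two_ne_zero ENNReal.ofNat_ne_top]
  rw [← ENNReal.rpow_natCast, ← ENNReal.rpow_mul]
  simp

variable {m : ℕ} {Y : Type*} [TopologicalSpace Y] [CompactSpace Y] [ChartedSpace (Euc m) Y]
  [MeasurableSpace Y] [BorelSpace Y] {μ : Measure Y} [IsFiniteMeasure μ]

theorem memLp_smoothFn (v : SmoothFn m Y) : MemLp v.1 2 μ := by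
  have hv : Continuous v.1 := v.2.continuous
  obtain ⟨C, hC⟩ := isCompact_univ.exists_bound_of_continuousOn hv.continuousOn
  exact MemLp.of_bound hv.aestronglyMeasurable C (Eventually.of_forall fun y => hC y (mem_univ y))

variable (μ) in
/-- Smooth functions as elements of `L²(Y)`. -/
def smoothToLp : SmoothFn m Y →ₗ[ℂ] Lp ℂ 2 μ where
  toFun v := (memLp_smoothFn v).toLp
  map_add' _ _ := rfl
  map_smul' _ _ := rfl

theorem coeFn_smoothToLp (v : SmoothFn m Y) : smoothToLp μ v =ᵐ[μ] v.1 :=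
  (memLp_smoothFn v).coeFn_toLp

theorem pairing_congr {φ v w : Y → ℂ} (h : v =ᵐ[μ] w) : pairing μ φ v = pairing μ φ w :=
  integral_congr_ae (h.mono fun y hy => by simp only [hy])

theorem inner_smoothToLp (v : SmoothFn m Y) (w : Lp ℂ 2 μ) :
    inner ℂ (smoothToLp μ v) w = pairing μ v.1 w := by
  rw [L2.inner_def, pairing]
  refine integral_congr_ae ((coeFn_smoothToLp v).mono fun y hy => ?_)
  simp only [hy, RCLike.inner_apply]
  exact mul_comm _ _

theorem inner_smoothToLp_smoothToLp (v w : SmoothFn m Y) :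
    inner ℂ (smoothToLp μ v) (smoothToLp μ w) = pairing μ v.1 w.1 := by
  rw [inner_smoothToLp]
  exact pairing_congr (coeFn_smoothToLp w)

theorem norm_smoothToLp_le (v : SmoothFn m Y) {C : ℝ} (hC : 0 ≤ C) (h : ∀ y, ‖v.1 y‖ ≤ C) :
    ‖smoothToLp μ v‖ ≤ μ.real univ ^ (2⁻¹ : ℝ) * C := by
  refine (Lp.norm_le_of_ae_bound (f := smoothToLp μ v) hC
    ((coeFn_smoothToLp v).mono fun y hy => hy ▸ h y)).trans (le_of_eq ?_)
  have : ((measureUnivNNReal μ : NNReal) : ℝ) = μ.real univ := rfl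
  simp [this]

variable [IsManifold 𝓘(ℝ, Euc m) ∞ Y]

/-- The pairs `(lam, e)` with `Δ_Y e = lam e`. -/
def EigenPair (g : RMetric m Y) (μ : Measure Y) : Type _ :=
  {q : ℝ × SmoothFn m Y // IsEigenfn g μ q.1 q.2}

variable {g : RMetric m Y}

/-- The eigenfunction of an eigenpair, in `L²(Y)`. -/
def eigenVec (q : EigenPair g μ) : Lp ℂ 2 μ := smoothToLp μ q.1.2

theorem inner_eigenVec (q : EigenPair g μ) (w : Lp ℂ 2 μ) :
    inner ℂ (eigenVec q) w = pairing μ q.1.2.1 w := inner_smoothToLp _ _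

theorem inner_eigenVec_smoothToLp (q : EigenPair g μ) (v : SmoothFn m Y) :
    inner ℂ (eigenVec q) (smoothToLp μ v) = pairing μ q.1.2.1 v.1 :=
  inner_smoothToLp_smoothToLp _ _

theorem inner_eigenVec_eigenVec (q q' : EigenPair g μ) (h : q.1.1 ≠ q'.1.1) :
    inner ℂ (eigenVec q) (eigenVec q') = 0 := by
  rw [eigenVec, eigenVec, inner_smoothToLp_smoothToLp]
  exact q.2.pairing_eq_zero q'.2 h

variable [T2Space Y]

theorem eigenVec_ne_zero (hμ : IsRiemannianVolume g μ) {q : EigenPair g μ}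
    (h : eigenVec q ≠ 0) : 0 ≤ q.1.1 := by
  refine q.2.nonneg hμ fun h0 => h ?_
  refine (Lp.eq_zero_iff_ae_eq_zero).2 ((coeFn_smoothToLp _).trans h0)

/-- The spectral calculus of `Δ_Y`: `φ(Δ_Y) w` for bounded `φ`. -/
theorem exists_spectral_multiplier (hμ : IsRiemannianVolume g μ) {φ : ℝ → ℝ} {M : ℝ} (hM : 0 ≤ M)
    (hφ : ∀ l, 0 ≤ l → |φ l| ≤ M) (w : Lp ℂ 2 μ) :
    ∃ w' : Lp ℂ 2 μ, ‖w'‖ ≤ M * ‖w‖ ∧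
      ∀ q : EigenPair g μ, inner ℂ (eigenVec q) w' = φ q.1.1 * inner ℂ (eigenVec q) w :=
  exists_inner_eq_smul (lam := fun q : EigenPair g μ => q.1.1)
    (fun q q' h => inner_eigenVec_eigenVec q q' h) hM
    (fun _ hq => hφ _ (eigenVec_ne_zero hμ hq)) w

/-- From 1 + l + b ≤ (1 + b)(1 + l). It makes (1 + Δ_Y + |ξ|²)^t (1 + Δ_Y)^{-k} a bounded multiplier
for k ≥ t, with polynomial growth in ξ. -/
theorem one_add_add_rpow_mul_le {l b t : ℝ} (hl : 0 ≤ l) (hb : 0 ≤ b) {k : ℕ} (hk : t ≤ k) :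
    |(1 + l + b) ^ t * ((1 + l) ^ k)⁻¹| ≤ (1 + b) ^ |t| := by
  have h1 : (0 : ℝ) < 1 + l := by positivity
  have h2 : (0 : ℝ) < 1 + b := by positivity
  rw [abs_of_nonneg (by positivity), ← div_eq_mul_inv, div_le_iff₀ (by positivity)]
  rcases le_total 0 t with ht | ht
  · calc (1 + l + b) ^ t ≤ ((1 + b) * (1 + l)) ^ t :=
          Real.rpow_le_rpow (by positivity) (by nlinarith [mul_nonneg hl hb]) ht
      _ = (1 + b) ^ t * (1 + l) ^ t := Real.mul_rpow h2.le h1.le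
      _ ≤ _ := by
        rw [abs_of_nonneg ht, ← Real.rpow_natCast (1 + l)]
        exact mul_le_mul_of_nonneg_left (Real.rpow_le_rpow_of_exponent_le (by linarith) hk)
          (by positivity)
  · calc (1 + l + b) ^ t ≤ 1 := Real.rpow_le_one_of_one_le_of_nonpos (by linarith) ht
      _ ≤ (1 + b) ^ |t| * (1 + l) ^ k := one_le_mul_of_one_le_of_one_le
        (Real.one_le_rpow (by linarith) (abs_nonneg _)) (one_le_pow₀ (by linarith))

/-- `(1 + Δ_Y + |ξ|²)^t v`, bounded by means of `v' = (1 + Δ_Y)^k v`. -/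
theorem exists_laplacePower (hμ : IsRiemannianVolume g μ) {n : ℕ} {t : ℝ} {k : ℕ} (hk : t ≤ k)
    {v v' : SmoothFn m Y} (hv : ∀ (lam : ℝ) (e : SmoothFn m Y), IsEigenfn g μ lam e →
      pairing μ e.1 v'.1 = (((1 + lam) ^ k : ℝ) : ℂ) * pairing μ e.1 v.1) (ξ : Euc n) :
    ∃ w : Lp ℂ 2 μ, IsLaplacePower g μ t ξ v.1 w ∧
      ‖w‖ ≤ (1 + ‖ξ‖ ^ 2) ^ |t| * ‖smoothToLp μ v'‖ := by
  obtain ⟨w, hw, hw'⟩ := exists_spectral_multiplier hμ (g := g)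
    (φ := fun l => (1 + l + ‖ξ‖ ^ 2) ^ t * ((1 + l) ^ k)⁻¹) (M := (1 + ‖ξ‖ ^ 2) ^ |t|)
    (by positivity) (fun l hl => one_add_add_rpow_mul_le hl (by positivity) hk) (smoothToLp μ v')
  refine ⟨w, fun lam e he => ?_, hw⟩
  let q : EigenPair g μ := ⟨(lam, e), he⟩
  have h := hw' q
  rw [inner_eigenVec q, inner_eigenVec_smoothToLp q] at h
  change pairing μ e.1 w = (((1 + lam + ‖ξ‖ ^ 2) ^ t * ((1 + lam) ^ k)⁻¹ : ℝ) : ℂ)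
    * pairing μ e.1 v'.1 at h
  rw [h, hv lam e he]
  -- If the eigenfunction is null, `lam` is arbitrary and (1 + lam)^k may vanish, but then both
  -- pairings are zero.
  by_cases h0 : eigenVec q = 0
  · have : 0 = pairing μ e.1 v.1 := by
      have := inner_eigenVec_smoothToLp q v
      rwa [h0, inner_zero_left] at this
    rw [← this]
    simp
  · have hl : 0 ≤ lam := eigenVec_ne_zero hμ h0
    have : ((1 + lam) ^ k : ℝ) ≠ 0 := by positivity
    rw [← mul_assoc, ← Complex.ofReal_mul, mul_assoc, inv_mul_cancel₀ this, mul_one]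

end EigenVectors

/-! ### Functions on `ℝⁿ × Y` with prescribed spectral components -/

section Tensor

variable {n m : ℕ} {Y : Type*} [TopologicalSpace Y] [CompactSpace Y] [ChartedSpace (Euc m) Y]
  [MeasurableSpace Y] [BorelSpace Y] {μ : Measure Y} [IsFiniteMeasure μ]

variable (n) in
/-- Measurable sets of finite volume in `ℝⁿ`. -/
def FinVolSet : Type := {A : Set (Euc n) // MeasurableSet A ∧ volume A < ⊤}

theorem memLp_boxTensor (A : FinVolSet n) (v : SmoothFn m Y) :
    MemLp (fun z : Euc n × Y => A.1.indicator (fun _ => v.1 z.2) z.1) 2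
      ((volume : Measure (Euc n)).prod μ) := by
  have hv : Continuous v.1 := v.2.continuous
  obtain ⟨C, hC⟩ := isCompact_univ.exists_bound_of_continuousOn hv.continuousOn
  have hA : MeasurableSet (A.1 ×ˢ (univ : Set Y)) := A.2.1.prod MeasurableSet.univ
  have h : MemLp ((A.1 ×ˢ (univ : Set Y)).indicator fun z => v.1 z.2) 2
      ((volume : Measure (Euc n)).prod μ) := by
    rw [memLp_indicator_iff_restrict hA]
    have : IsFiniteMeasure (((volume : Measure (Euc n)).prod μ).restrict (A.1 ×ˢ univ)) := by
      refine ⟨?_⟩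
      rw [Measure.restrict_apply_univ, Measure.prod_prod]
      exact ENNReal.mul_lt_top A.2.2 (measure_lt_top _ _)
    exact MemLp.of_bound (hv.comp continuous_snd).aestronglyMeasurable C
      (Eventually.of_forall fun z => hC z.2 (mem_univ _))
  convert! h using 2 with z
  by_cases hz : z.1 ∈ A.1 <;> simp [hz]

variable (μ) in
/-- The function `1_A(ζ) v(y)`. -/
def boxTensor (A : FinVolSet n) (v : SmoothFn m Y) : Lp ℂ 2 ((volume : Measure (Euc n)).prod μ) :=
  (memLp_boxTensor A v).toLp

theorem coeFn_boxTensor (A : FinVolSet n) (v : SmoothFn m Y) :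
    boxTensor μ A v =ᵐ[(volume : Measure (Euc n)).prod μ]
      fun z => A.1.indicator (fun _ => v.1 z.2) z.1 :=
  (memLp_boxTensor A v).coeFn_toLp

theorem inner_boxTensor (A : FinVolSet n) (v : SmoothFn m Y)
    (f : Lp ℂ 2 ((volume : Measure (Euc n)).prod μ)) :
    IntegrableOn (fun ζ => pairing μ v.1 fun y => f (ζ, y)) A.1 ∧
      inner ℂ (boxTensor μ A v) f = ∫ ζ in A.1, pairing μ v.1 fun y => f (ζ, y) := by
  have h1 : (fun z => inner ℂ (boxTensor μ A v z) (f z)) =ᵐ[(volume : Measure (Euc n)).prod μ]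
      fun z => A.1.indicator (fun _ => conj (v.1 z.2) * f z) z.1 := by
    filter_upwards [coeFn_boxTensor A v] with z hz
    rw [hz, RCLike.inner_apply, mul_comm]
    by_cases hA : z.1 ∈ A.1 <;> simp [hA]
  have hint := (L2.integrable_inner (𝕜 := ℂ) (boxTensor μ A v) f).congr h1
  have h2 : (fun ζ => ∫ y, A.1.indicator (fun _ => conj (v.1 y) * f (ζ, y)) ζ ∂μ)
      = A.1.indicator fun ζ => pairing μ v.1 fun y => f (ζ, y) := by
    funext ζ
    by_cases hA : ζ ∈ A.1 <;> simp [hA, pairing]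
  refine ⟨?_, ?_⟩
  · rw [← integrable_indicator_iff A.2.1, ← h2]
    exact hint.integral_prod_left
  · rw [L2.inner_def, integral_congr_ae h1, integral_prod _ hint, ← integral_indicator A.2.1]
    exact congrArg (fun F : Euc n → ℂ => ∫ ζ, F ζ) h2

/-- Spectral components are known only almost everywhere in ζ; they are identified by their
integrals over sets of finite volume, which are inner products in L²(ℝⁿ × Y). -/
theorem ae_pairing_eq {v : SmoothFn m Y} {f : Lp ℂ 2 ((volume : Measure (Euc n)).prod μ)}
    {Φ : Euc n → ℂ} (hΦ : ∀ A : FinVolSet n, IntegrableOn Φ A.1)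
    (h : ∀ A, inner ℂ (boxTensor μ A v) f = ∫ ζ in A.1, Φ ζ) :
    (fun ζ => pairing μ v.1 fun y => f (ζ, y)) =ᵐ[volume] Φ :=
  ae_eq_of_forall_setIntegral_eq_of_sigmaFinite
    (fun A hA hA' => (inner_boxTensor ⟨A, hA, hA'⟩ v f).1) (fun A hA hA' => hΦ ⟨A, hA, hA'⟩)
    fun A hA hA' => by
      rw [← h ⟨A, hA, hA'⟩, (inner_boxTensor ⟨A, hA, hA'⟩ v f).2]

theorem ae_pairing_add (v : SmoothFn m Y) (f f' : Lp ℂ 2 ((volume : Measure (Euc n)).prod μ)) :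
    (fun ζ => pairing μ v.1 fun y => (f + f' : Lp ℂ 2 _) (ζ, y)) =ᵐ[volume]
      fun ζ => (pairing μ v.1 fun y => f (ζ, y)) + pairing μ v.1 fun y => f' (ζ, y) :=
  ae_pairing_eq (fun A => (inner_boxTensor A v f).1.add (inner_boxTensor A v f').1) fun A => by
    rw [inner_add_right, (inner_boxTensor A v f).2, (inner_boxTensor A v f').2,
      integral_add (inner_boxTensor A v f).1 (inner_boxTensor A v f').1]

theorem ae_pairing_smul (v : SmoothFn m Y) (c : ℂ)
    (f : Lp ℂ 2 ((volume : Measure (Euc n)).prod μ)) :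
    (fun ζ => pairing μ v.1 fun y => (c • f : Lp ℂ 2 _) (ζ, y)) =ᵐ[volume]
      fun ζ => c * pairing μ v.1 fun y => f (ζ, y) :=
  ae_pairing_eq (fun A => (inner_boxTensor A v f).1.const_mul c) fun A => by
    rw [inner_smul_right, (inner_boxTensor A v f).2, integral_const_mul]

theorem ae_memLp_slice (f : Lp ℂ 2 ((volume : Measure (Euc n)).prod μ)) :
    ∀ᵐ ζ, MemLp (fun y => f (ζ, y)) 2 μ := by
  have h1 := (Lp.memLp f)
  have h2 := (memLp_two_iff_integrable_sq_norm h1.1).1 h1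
  filter_upwards [h1.1.prodMk_left, h2.prod_right_ae] with ζ h3 h4
  exact (memLp_two_iff_integrable_sq_norm h3).2 h4

variable [IsManifold 𝓘(ℝ, Euc m) ∞ Y] {g : RMetric m Y}

variable (n μ g) in
/-- The closed span of the functions `1_A(ζ) e(y)` with eigenfunctions `e`. -/
def eigenSpan : Submodule ℂ (Lp ℂ 2 ((volume : Measure (Euc n)).prod μ)) :=
  (Submodule.span ℂ (range fun j : FinVolSet n × EigenPair g μ =>
    boxTensor μ j.1 j.2.1.2)).topologicalClosure

/-- Uniqueness within the closed span of the eigenfunctions. Restricting to this span dispenses with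
the completeness of the eigenfunctions in L²(Y). -/
theorem eq_of_mem_eigenSpan {f f' : Lp ℂ 2 ((volume : Measure (Euc n)).prod μ)}
    (hf : f ∈ eigenSpan n μ g) (hf' : f' ∈ eigenSpan n μ g)
    (h : ∀ q : EigenPair g μ, (fun ζ => pairing μ q.1.2.1 fun y => f (ζ, y)) =ᵐ[volume]
      fun ζ => pairing μ q.1.2.1 fun y => f' (ζ, y)) : f = f' := by
  refine eq_of_forall_inner_eq hf hf' fun j => ?_
  rw [(inner_boxTensor j.1 _ f).2, (inner_boxTensor j.1 _ f').2]
  exact integral_congr_ae (ae_restrict_of_ae (h j.2))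

/-- Fubini: L²(ℝⁿ × Y) seen as the L² functions of ζ with values in L²(Y). -/
theorem enorm_sum_boxTensor (a : FinVolSet n × EigenPair g μ →₀ ℂ) :
    ‖a.sum fun j t => t • boxTensor μ j.1 j.2.1.2‖ₑ ^ 2
      = ∫⁻ ζ, ‖a.sum fun j t => (j.1.1.indicator (fun _ => t) ζ) • eigenVec j.2‖ₑ ^ 2 := by
  set G : Euc n × Y → ℂ := fun z =>
    a.sum fun j t => t * j.1.1.indicator (fun _ => j.2.1.2.1 z.2) z.1 with hG
  have h1 : (a.sum fun j t => t • boxTensor μ j.1 j.2.1.2 :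
      Lp ℂ 2 ((volume : Measure (Euc n)).prod μ)) =ᵐ[(volume : Measure (Euc n)).prod μ] G := by
    refine (Lp.coeFn_fun_finsetSum _ _).trans ?_
    have : ∀ j ∈ a.support, ∀ᵐ z ∂(volume : Measure (Euc n)).prod μ,
        (a j • boxTensor μ j.1 j.2.1.2 : Lp ℂ 2 _) z
          = a j * j.1.1.indicator (fun _ => j.2.1.2.1 z.2) z.1 := fun j _ => by
      filter_upwards [Lp.coeFn_smul (a j) (boxTensor μ j.1 j.2.1.2), coeFn_boxTensor j.1 j.2.1.2]
        with z h1 h2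
      rw [h1, Pi.smul_apply, h2, smul_eq_mul]
    filter_upwards [(Finset.eventually_all a.support).2 this] with z hz
    exact Finset.sum_congr rfl hz
  have hGm : AEStronglyMeasurable G ((volume : Measure (Euc n)).prod μ) :=
    (Lp.aestronglyMeasurable _).congr h1
  rw [enorm_sq_eq_lintegral, lintegral_congr_ae (h1.mono fun z hz => by rw [hz]),
    lintegral_prod _ (by fun_prop)]
  refine lintegral_congr fun ζ => ?_
  have h2 : (a.sum fun j t => (j.1.1.indicator (fun _ => t) ζ) • eigenVec j.2)
      = smoothToLp μ (a.sum fun j t => (j.1.1.indicator (fun _ => t) ζ) • j.2.1.2 :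
          SmoothFn m Y) := by
    simp only [Finsupp.sum, map_sum, map_smul, eigenVec]
  have h3 := coeFn_smoothToLp (μ := μ)
    (a.sum fun j t => (j.1.1.indicator (fun _ => t) ζ) • j.2.1.2 : SmoothFn m Y)
  rw [h2, enorm_sq_eq_lintegral]
  refine lintegral_congr_ae (h3.mono fun y hy => ?_)
  simp only [hy, hG]
  congr 2
  simp only [Finsupp.sum, AddSubmonoidClass.coe_finsetSum, Finset.sum_apply]
  refine Finset.sum_congr rfl fun j _ => ?_
  by_cases hζ : ζ ∈ j.1.1 <;> simp [hζ]

/-- For every finite combination, the pointwise solutions w(ζ) give |Σ conj(t) Φ| ≤ B(ζ) ‖S(ζ)‖;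
integrating with Cauchy–Schwarz yields the solvability condition of the moment problem on ℝⁿ × Y.
The w(ζ) are never integrated, so they need not depend measurably on ζ. -/
theorem exists_eigenSpan_pairing_eq {Φ : EigenPair g μ → Euc n → ℂ}
    (hΦ : ∀ q, AEStronglyMeasurable (Φ q)) {B : Euc n → ENNReal} (hB : AEMeasurable B) {M : ℝ}
    (hM : 0 ≤ M) (hBM : ∫⁻ ζ, B ζ ^ 2 ≤ ENNReal.ofReal M ^ 2)
    (h : ∀ᵐ ζ, ∃ w : Lp ℂ 2 μ, ‖w‖ₑ ≤ B ζ ∧ ∀ q, inner ℂ (eigenVec q) w = Φ q ζ) :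
    ∃ f ∈ eigenSpan n μ g, ‖f‖ ≤ M ∧
      ∀ q : EigenPair g μ, (fun ζ => pairing μ q.1.2.1 fun y => f (ζ, y)) =ᵐ[volume] Φ q := by
  have hΦb : ∀ q, ∀ᵐ ζ, ‖Φ q ζ‖ₑ ≤ ‖eigenVec q‖ₑ * B ζ := fun q => by
    filter_upwards [h] with ζ ⟨w, hw, hw'⟩
    rw [← hw' q]
    refine le_trans ?_ (mul_le_mul_right hw _)
    rw [← enorm_norm, ← enorm_norm (eigenVec q), ← enorm_norm w, ← enorm_mul]
    rw [Real.enorm_of_nonneg (norm_nonneg _), Real.enorm_of_nonneg (by positivity)]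
    exact ENNReal.ofReal_le_ofReal (norm_inner_le_norm _ _)
  have hΦ2 : ∀ q, MemLp (Φ q) 2 := fun q => by
    refine ⟨hΦ q, ?_⟩
    rw [eLpNorm_lt_top_iff_lintegral_rpow_enorm_lt_top two_ne_zero ENNReal.ofNat_ne_top]
    refine lt_of_le_of_lt (lintegral_mono_ae (g := fun ζ => ‖eigenVec q‖ₑ ^ 2 * B ζ ^ 2)
      ((hΦb q).mono fun ζ hζ => ?_)) ?_
    · simp only [ENNReal.toReal_ofNat, ENNReal.rpow_ofNat, ← mul_pow]
      gcongr
    · rw [lintegral_const_mul'' _ (hB.pow_const 2)]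
      refine ENNReal.mul_lt_top (by finiteness) (hBM.trans_lt (by finiteness))
  have hΦi : ∀ q (A : FinVolSet n), IntegrableOn (Φ q) A.1 := fun q A => by
    have : IsFiniteMeasure (volume.restrict A.1) := ⟨by
      rw [Measure.restrict_apply_univ]; exact A.2.2⟩
    exact ((hΦ2 q).restrict A.1).integrable (by norm_num)
  have key : ∀ a : FinVolSet n × EigenPair g μ →₀ ℂ,
      ‖a.sum fun j t => conj t * ∫ ζ in j.1.1, Φ j.2 ζ‖
        ≤ M * ‖a.sum fun j t => t • boxTensor μ j.1 j.2.1.2‖ := by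
    intro a
    set S : Euc n → Lp ℂ 2 μ := fun ζ =>
      a.sum fun j t => (j.1.1.indicator (fun _ => t) ζ) • eigenVec j.2 with hS
    have hSm : AEMeasurable fun ζ => ‖S ζ‖ₑ := by
      refine StronglyMeasurable.aemeasurable (StronglyMeasurable.enorm ?_).stronglyMeasurable
      refine Finset.stronglyMeasurable_fun_sum _ fun j _ => ?_
      exact (stronglyMeasurable_const.indicator j.1.2.1).smul_const _
    have e1 : (a.sum fun j t => conj t * ∫ ζ in j.1.1, Φ j.2 ζ)
        = ∫ ζ, a.sum fun j t => conj (j.1.1.indicator (fun _ => t) ζ) * Φ j.2 ζ := by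
      simp only [Finsupp.sum]
      rw [integral_finsetSum]
      · refine Finset.sum_congr rfl fun j _ => ?_
        rw [← integral_indicator j.1.2.1, ← integral_const_mul]
        refine integral_congr_ae (Eventually.of_forall fun ζ => ?_)
        by_cases hζ : ζ ∈ j.1.1 <;> simp [hζ]
      · intro j _
        refine (((integrable_indicator_iff j.1.2.1).2 (hΦi j.2 j.1)).const_mul (conj (a j))).congr
          (Eventually.of_forall fun ζ => ?_)
        by_cases hζ : ζ ∈ j.1.1 <;> simp [hζ]
    have e2 : ∀ᵐ ζ, ‖a.sum fun j t => conj (j.1.1.indicator (fun _ => t) ζ) * Φ j.2 ζ‖ₑ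
        ≤ B ζ * ‖S ζ‖ₑ := by
      filter_upwards [h] with ζ ⟨w, hw, hw'⟩
      have : (a.sum fun j t => conj (j.1.1.indicator (fun _ => t) ζ) * Φ j.2 ζ)
          = inner ℂ (S ζ) w := by
        simp only [hS, Finsupp.sum, sum_inner, inner_smul_left, hw']
      rw [this, mul_comm]
      refine le_trans ?_ (mul_le_mul_right hw _)
      rw [← enorm_norm, ← enorm_norm (S ζ), ← enorm_norm w, ← enorm_mul]
      rw [Real.enorm_of_nonneg (norm_nonneg _), Real.enorm_of_nonneg (by positivity)]
      exact ENNReal.ofReal_le_ofReal (norm_inner_le_norm _ _)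
    set X : Lp ℂ 2 ((volume : Measure (Euc n)).prod μ) :=
      a.sum fun j t => t • boxTensor μ j.1 j.2.1.2 with hX
    have e3 : ‖a.sum fun j t => conj t * ∫ ζ in j.1.1, Φ j.2 ζ‖ₑ ≤ ENNReal.ofReal M * ‖X‖ₑ := by
      rw [e1]
      refine (enorm_integral_le_lintegral_enorm _).trans ((lintegral_mono_ae e2).trans ?_)
      -- Cauchy–Schwarz in ζ: the L² norm of B is at most M, that of S is the norm of the
      -- combination X.
      refine (ENNReal.lintegral_mul_le_Lp_mul_Lq volume Real.HolderConjugate.two_two hB hSm).trans ?_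
      have h5 : (∫⁻ ζ, ‖S ζ‖ₑ ^ (2 : ℝ)) = ‖X‖ₑ ^ 2 := by
        simp only [ENNReal.rpow_ofNat]
        exact (enorm_sum_boxTensor a).symm
      have h6 : ∫⁻ ζ, B ζ ^ (2 : ℝ) ≤ ENNReal.ofReal M ^ 2 := by
        simpa only [ENNReal.rpow_ofNat] using hBM
      have h7 : ∀ b : ENNReal, (b ^ 2) ^ (1 / 2 : ℝ) = b := fun b => by
        rw [← ENNReal.rpow_natCast, ← ENNReal.rpow_mul]; norm_num
      rw [h5, h7]
      refine mul_le_mul_left ((ENNReal.rpow_le_rpow h6 (by norm_num)).trans (h7 _).le) _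
    rw [← ENNReal.ofReal_le_ofReal_iff (by positivity), ENNReal.ofReal_mul hM, ofReal_norm,
      ofReal_norm]
    exact e3
  obtain ⟨f, hf, hfM, hf'⟩ := exists_inner_eq
    (fun j : FinVolSet n × EigenPair g μ => boxTensor μ j.1 j.2.1.2)
    (fun j => ∫ ζ in j.1.1, Φ j.2 ζ) hM key
  exact ⟨f, hf, hfM, fun q => ae_pairing_eq (hΦi q) fun A => hf' (A, q)⟩

end Tensor

/-! ### Extension of relations between spectral components to bounded operators. -/

section Extension

variable {n m : ℕ} {Y : Type*} [TopologicalSpace Y] [CompactSpace Y] [ChartedSpace (Euc m) Y]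
  [MeasurableSpace Y] [BorelSpace Y] {μ : Measure Y} [IsFiniteMeasure μ]
  [IsManifold 𝓘(ℝ, Euc m) ∞ Y] {g : RMetric m Y}

/-- A bounded linear relation between functions on `ℝⁿ × Y`, described by spectral components,
extends to a bounded operator. -/
theorem exists_clm_of_spectral_relation {E : Type*} [AddCommGroup E] [Module ℂ E]
    (Φ Ψ : EigenPair g μ → E →ₗ[ℂ] (Euc n → ℂ)) {C : ℝ} (hC : 0 ≤ C)
    (h : ∀ (u : E) (f : Lp ℂ 2 ((volume : Measure (Euc n)).prod μ)),
      (∀ q : EigenPair g μ, (fun ζ => pairing μ q.1.2.1 fun y => f (ζ, y)) =ᵐ[volume] Φ q u) →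
      ∃ f' ∈ eigenSpan n μ g, ‖f'‖ ≤ C * ‖f‖ ∧
        ∀ q : EigenPair g μ, (fun ζ => pairing μ q.1.2.1 fun y => f' (ζ, y)) =ᵐ[volume] Ψ q u) :
    ∃ T : Lp ℂ 2 ((volume : Measure (Euc n)).prod μ) →L[ℂ]
        Lp ℂ 2 ((volume : Measure (Euc n)).prod μ), ‖T‖ ≤ C ∧
      ∀ (u : E) (f : Lp ℂ 2 ((volume : Measure (Euc n)).prod μ)),
        (∀ q : EigenPair g μ, (fun ζ => pairing μ q.1.2.1 fun y => f (ζ, y)) =ᵐ[volume] Φ q u) →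
        ∀ q : EigenPair g μ, (fun ζ => pairing μ q.1.2.1 fun y => T f (ζ, y)) =ᵐ[volume] Ψ q u := by
  let L := Lp ℂ 2 ((volume : Measure (Euc n)).prod μ)
  -- The graph of triples (u, f, f') is used instead of a map u ↦ f, because f is not determined by
  -- its components; f' is, being in `eigenSpan`.
  let R : Submodule ℂ (E × L × L) :=
    { carrier := {z | (∀ q : EigenPair g μ,
          (fun ζ => pairing μ q.1.2.1 fun y => z.2.1 (ζ, y)) =ᵐ[volume] Φ q z.1) ∧
        z.2.2 ∈ eigenSpan n μ g ∧ ∀ q : EigenPair g μ,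
          (fun ζ => pairing μ q.1.2.1 fun y => z.2.2 (ζ, y)) =ᵐ[volume] Ψ q z.1}
      add_mem' := fun {z z'} hz hz' => by
        refine ⟨fun q => ?_, Submodule.add_mem _ hz.2.1 hz'.2.1, fun q => ?_⟩
        · refine (ae_pairing_add _ _ _).trans (((hz.1 q).add (hz'.1 q)).trans ?_)
          rw [Prod.fst_add, map_add]
        · refine (ae_pairing_add _ _ _).trans (((hz.2.2 q).add (hz'.2.2 q)).trans ?_)
          rw [Prod.fst_add, map_add]
      zero_mem' := by
        have h0 : ∀ q : EigenPair g μ,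
            (fun ζ => pairing μ q.1.2.1 fun y => (0 : L) (ζ, y)) =ᵐ[volume] 0 := fun q => by
          have := ae_pairing_smul (n := n) (μ := μ) q.1.2 0 0
          rw [zero_smul] at this
          refine this.trans (Eventually.of_forall fun ζ => ?_)
          exact zero_mul _
        refine ⟨fun q => ?_, Submodule.zero_mem _, fun q => ?_⟩
        · refine (h0 q).trans ?_
          rw [Prod.fst_zero, map_zero]
        · refine (h0 q).trans ?_
          rw [Prod.fst_zero, map_zero]
      smul_mem' := fun c z hz => by
        refine ⟨fun q => ?_, Submodule.smul_mem _ _ hz.2.1, fun q => ?_⟩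
        · refine (ae_pairing_smul _ _ _).trans (((hz.1 q).const_smul c).trans ?_)
          rw [Prod.smul_fst, map_smul]
        · refine (ae_pairing_smul _ _ _).trans (((hz.2.2 q).const_smul c).trans ?_)
          rw [Prod.smul_fst, map_smul] }
  let e : R →ₗ[ℂ] L := (LinearMap.fst ℂ L L ∘ₗ LinearMap.snd ℂ E (L × L)) ∘ₗ R.subtype
  let f₀ : R →ₗ[ℂ] L := (LinearMap.snd ℂ L L ∘ₗ LinearMap.snd ℂ E (L × L)) ∘ₗ R.subtype
  obtain ⟨T, hT, hTe⟩ := exists_clm_of_norm_le e f₀ hC fun z => by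
    obtain ⟨f', hf', hn, hq⟩ := h z.1.1 z.1.2.1 z.2.1
    have : f' = z.1.2.2 := eq_of_mem_eigenSpan hf' z.2.2.1 fun q =>
      (hq q).trans (z.2.2.2 q).symm
    rw [this] at hn
    exact hn
  refine ⟨T, hT, fun u f hf q => ?_⟩
  obtain ⟨f', hf', hn, hq⟩ := h u f hf
  have : T f = f' := hTe ⟨(u, f, f'), hf, hf', hq⟩
  rw [this]
  exact hq q

end Extension

/-! ### Slices {ζ} × Y of square-integrable functions. -/

section Slices

variable {n m : ℕ} {Y : Type*} [MeasurableSpace Y] {μ : Measure Y}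

/-- `‖f(ζ, ·)‖` in `L²(Y)`. -/
def sliceNorm [SFinite μ] (f : Lp ℂ 2 ((volume : Measure (Euc n)).prod μ)) (ζ : Euc n) : ENNReal :=
  (∫⁻ y, ‖f (ζ, y)‖ₑ ^ 2 ∂μ) ^ (2⁻¹ : ℝ)

theorem ennreal_rpow_half_sq (b : ENNReal) : (b ^ (2⁻¹ : ℝ)) ^ 2 = b := by
  rw [← ENNReal.rpow_natCast, ← ENNReal.rpow_mul]
  norm_num

theorem ennreal_sq_rpow_half (b : ENNReal) : (b ^ 2) ^ (2⁻¹ : ℝ) = b := by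
  rw [← ENNReal.rpow_natCast, ← ENNReal.rpow_mul]
  norm_num

theorem aemeasurable_sliceNorm [SFinite μ] (f : Lp ℂ 2 ((volume : Measure (Euc n)).prod μ)) :
    AEMeasurable (sliceNorm f) :=
  ((Lp.aestronglyMeasurable f).enorm.pow_const 2).lintegral_prod_right'.pow_const _

theorem lintegral_sliceNorm_sq [SFinite μ] (f : Lp ℂ 2 ((volume : Measure (Euc n)).prod μ)) :
    ∫⁻ ζ, sliceNorm f ζ ^ 2 = ‖f‖ₑ ^ 2 := by
  simp only [sliceNorm, ennreal_rpow_half_sq]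
  rw [enorm_sq_eq_lintegral, lintegral_prod _ ((Lp.aestronglyMeasurable f).enorm.pow_const 2)]

variable [TopologicalSpace Y] [CompactSpace Y] [ChartedSpace (Euc m) Y] [BorelSpace Y] [IsFiniteMeasure μ]
  [IsManifold 𝓘(ℝ, Euc m) ∞ Y] {g : RMetric m Y}

/-- L²(Y) is separable, so countably many eigenfunctions test orthogonality to all of them. This
permits moving "almost every ζ" in front of "for all eigenfunctions". -/
theorem exists_countable_eigenVec (g : RMetric m Y) (μ : Measure Y) [IsFiniteMeasure μ] :
    ∃ S : Set (EigenPair g μ), S.Countable ∧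
      ∀ w : Lp ℂ 2 μ, (∀ q ∈ S, inner ℂ (eigenVec q) w = 0) → ∀ q : EigenPair g μ,
        inner ℂ (eigenVec q) w = 0 := by
  have : SecondCountableTopology Y := ChartedSpace.secondCountable_of_sigmaCompact (Euc m) Y
  have : Fact ((2 : ENNReal) ≠ ⊤) := ⟨ENNReal.ofNat_ne_top⟩
  obtain ⟨t, ht, htc, htd⟩ := (TopologicalSpace.IsSeparable.of_separableSpace
    (range (eigenVec : EigenPair g μ → Lp ℂ 2 μ))).exists_countable_dense_subset
  choose σ hσ using fun x : t => ht x.2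
  have := htc.to_subtype
  refine ⟨range σ, countable_range σ, fun w hw q => ?_⟩
  have hcl : IsClosed {x : Lp ℂ 2 μ | inner ℂ x w = 0} :=
    isClosed_eq (by fun_prop) continuous_const
  refine closure_minimal (fun x hx => ?_) hcl (htd ⟨q, rfl⟩)
  have := hw (σ ⟨x, hx⟩) ⟨_, rfl⟩
  rwa [hσ ⟨x, hx⟩] at this

/-- Almost all slices of `f ∈ L²(ℝⁿ × Y)` have the prescribed spectral components. -/
theorem ae_inner_slice_eq {f : Lp ℂ 2 ((volume : Measure (Euc n)).prod μ)}
    (w₀ : Euc n → Lp ℂ 2 μ)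
    (h : ∀ q : EigenPair g μ, ∀ᵐ ζ, pairing μ q.1.2.1 (fun y => f (ζ, y))
      = inner ℂ (eigenVec q) (w₀ ζ)) :
    ∀ᵐ ζ, ∃ w : Lp ℂ 2 μ, ‖w‖ₑ = sliceNorm f ζ ∧
      ∀ q : EigenPair g μ, inner ℂ (eigenVec q) w = inner ℂ (eigenVec q) (w₀ ζ) := by
  obtain ⟨S, hS, hSd⟩ := exists_countable_eigenVec g μ
  filter_upwards [(ae_ball_iff hS).2 fun q _ => h q, ae_memLp_slice f] with ζ h1 h2
  refine ⟨h2.toLp, ?_, fun q => ?_⟩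
  · rw [sliceNorm, ← ennreal_sq_rpow_half ‖_‖ₑ, enorm_sq_eq_lintegral]
    congr 1
    exact lintegral_congr_ae (h2.coeFn_toLp.mono fun y hy => by simp only [hy])
  · rw [← sub_eq_zero, ← inner_sub_right]
    refine hSd _ (fun q hq => ?_) q
    rw [inner_sub_right, sub_eq_zero, ← h1 q hq, inner_eigenVec]
    exact pairing_congr h2.coeFn_toLp

end Slices

/-! ### Test functions in Sobolev spaces -/

section TestFnSobolev

variable {n m : ℕ} {Y : Type*} [TopologicalSpace Y] [CompactSpace Y] [T2Space Y]
  [ChartedSpace (Euc m) Y] [MeasurableSpace Y] [BorelSpace Y] {μ : Measure Y} [IsFiniteMeasure μ]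
  [IsManifold 𝓘(ℝ, Euc m) ∞ Y] {g : RMetric m Y}

/-- The test function (1 + Δ_Y)^k u with k ≥ t has a rapidly decaying transform, and
`exists_laplacePower` loses only (1 + |ξ|²)^{|t|}; hence the decay of order L + |t| that is asked of
it. -/
theorem exists_laplacePower_decay (hμ : IsRiemannianVolume g μ) (u : TestFn m Y n) (t L : ℝ) :
    ∃ C : ℝ, 0 ≤ C ∧ ∀ ξ, ∃ w : Lp ℂ 2 μ, IsLaplacePower g μ t ξ (partialFourier u ξ).1 w ∧
      ‖w‖ ≤ C * (1 + ‖ξ‖ ^ 2) ^ (-L) := by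
  obtain ⟨k, hk⟩ := exists_nat_ge t
  obtain ⟨u', hu'⟩ := exists_testFn_power hμ u 0 k
  obtain ⟨C, hC0, hC⟩ := exists_decay_partialFourier u' (L + |t|)
  refine ⟨μ.real univ ^ (2⁻¹ : ℝ) * C, by positivity, fun ξ => ?_⟩
  have hp : 0 < 1 + ‖ξ‖ ^ 2 := by positivity
  obtain ⟨w, hw, hwn⟩ := exists_laplacePower hμ hk (v := partialFourier u ξ)
    (v' := partialFourier u' ξ) (fun lam e he => by rw [hu' lam e he ξ, pow_zero, one_mul]) ξ
  refine ⟨w, hw, hwn.trans ?_⟩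
  have h1 := norm_smoothToLp_le (μ := μ) (partialFourier u' ξ)
    (mul_nonneg hC0 (Real.rpow_pos_of_pos hp (-(L + |t|))).le) (hC ξ)
  refine (mul_le_mul_of_nonneg_left h1 (Real.rpow_pos_of_pos hp _).le).trans (le_of_eq ?_)
  rw [show -L = |t| + -(L + |t|) by ring, Real.rpow_add hp]
  ring

theorem exists_laplacePower_sub (hμ : IsRiemannianVolume g μ) (u : TestFn m Y n) (t : ℝ) :
    ∃ C : ℝ, 0 ≤ C ∧ ∀ ξ ξ₀, ∃ w : Lp ℂ 2 μ,
      IsLaplacePower g μ t ξ (partialFourier u ξ - partialFourier u ξ₀).1 w ∧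
      ‖w‖ ≤ (1 + ‖ξ‖ ^ 2) ^ |t| * (C * ‖ξ - ξ₀‖) := by
  obtain ⟨k, hk⟩ := exists_nat_ge t
  obtain ⟨u', hu'⟩ := exists_testFn_power hμ u 0 k
  obtain ⟨C, hC0, -, hC⟩ := exists_bound_partialFourier u'
  refine ⟨μ.real univ ^ (2⁻¹ : ℝ) * C, by positivity, fun ξ ξ₀ => ?_⟩
  have hp : 0 < 1 + ‖ξ‖ ^ 2 := by positivity
  have hsub : ∀ (e v v₀ : SmoothFn m Y), pairing μ e.1 (v - v₀).1
      = pairing μ e.1 v.1 - pairing μ e.1 v₀.1 := fun e v v₀ => by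
    rw [← inner_smoothToLp_smoothToLp, ← inner_smoothToLp_smoothToLp,
      ← inner_smoothToLp_smoothToLp, map_sub, inner_sub_right]
  obtain ⟨w, hw, hwn⟩ := exists_laplacePower hμ hk (v := partialFourier u ξ - partialFourier u ξ₀)
    (v' := partialFourier u' ξ - partialFourier u' ξ₀) (fun lam e he => by
      rw [hsub, hsub, hu' lam e he ξ, hu' lam e he ξ₀, pow_zero, pow_zero, one_mul, mul_sub]) ξ
  refine ⟨w, hw, hwn.trans (mul_le_mul_of_nonneg_left ?_ (Real.rpow_pos_of_pos hp _).le)⟩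
  rw [mul_assoc]
  exact norm_smoothToLp_le _ (mul_nonneg hC0 (norm_nonneg _)) (hC ξ ξ₀)

theorem continuous_pairing_partialFourier (e : SmoothFn m Y) (u : TestFn m Y n) :
    Continuous fun ξ => pairing μ e.1 (partialFourier u ξ).1 := by
  have hc : Continuous fun y => conj (e.1 y) := Complex.continuous_conj.comp e.2.continuous
  have : Continuous (Function.uncurry fun (ξ : Euc n) (y : Y) =>
      conj (e.1 y) * (partialFourier u ξ).1 y) :=
    (hc.comp continuous_snd).mul (continuous_partialFourier u)
  simpa [pairing] using continuous_parametric_integral_of_continuous this isCompact_univ (μ := μ)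

/-- The vectors (1 + Δ_Y + |ζ|²)^{s/2} û(ζ) exist for every ζ with a square-integrable bound, and
are assembled by `exists_eigenSpan_pairing_eq`. -/
theorem exists_sobolev_testFn (hμ : IsRiemannianVolume g μ) (u : TestFn m Y n) (s : ℝ) :
    ∃ f : SobolevSpace n μ s, IsSobolevElement g μ s (DistFn.ofFun μ u.1) f := by
  set c : ℝ := (2 * Real.pi) ^ (-(n : ℝ) / 2) with hc
  have hc0 : 0 ≤ c := by positivity
  obtain ⟨C, hC0, hC⟩ := exists_laplacePower_decay hμ u (s / 2) (n + 1)
  have hB : Integrable fun ζ : Euc n => (c * (C * (1 + ‖ζ‖ ^ 2) ^ (-(n + 1) : ℝ))) ^ 2 := by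
    have h := integrable_one_add_norm_sq_rpow (k := n) (r := 2 * (n + 1)) (by
      have : (0 : ℝ) ≤ n := Nat.cast_nonneg n
      linarith)
    refine (h.const_mul (c ^ 2 * C ^ 2)).congr (Eventually.of_forall fun ζ => ?_)
    have hp : 0 < 1 + ‖ζ‖ ^ 2 := by positivity
    have : ((1 + ‖ζ‖ ^ 2) ^ (-(n + 1) : ℝ)) ^ 2 = (1 + ‖ζ‖ ^ 2) ^ (-(2 * (n + 1)) : ℝ) := by
      rw [← Real.rpow_natCast, ← Real.rpow_mul hp.le]
      congr 1
      push_cast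
      ring
    simp only [← this]
    ring
  set Φ : EigenPair g μ → Euc n → ℂ := fun q ζ =>
    ((c * (1 + q.1.1 + ‖ζ‖ ^ 2) ^ (s / 2) : ℝ) : ℂ) *
      pairing μ q.1.2.1 (partialFourier u ζ).1 with hΦ
  set M : ℝ := Real.sqrt (∫ ζ : Euc n, (c * (C * (1 + ‖ζ‖ ^ 2) ^ (-(n + 1) : ℝ))) ^ 2)
  have hm : ∀ q, AEStronglyMeasurable (Φ q) := fun q => by
    refine Measurable.aestronglyMeasurable ?_
    have := (continuous_pairing_partialFourier (μ := μ) q.1.2 u).measurable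
    fun_prop
  have hBM : ∫⁻ ζ : Euc n, ENNReal.ofReal (c * (C * (1 + ‖ζ‖ ^ 2) ^ (-(n + 1) : ℝ))) ^ 2
      ≤ ENNReal.ofReal M ^ 2 := by
    rw [← ENNReal.ofReal_pow (Real.sqrt_nonneg _),
      Real.sq_sqrt (integral_nonneg fun _ => sq_nonneg _),
      ofReal_integral_eq_lintegral_ofReal hB (Eventually.of_forall fun _ => sq_nonneg _)]
    refine le_of_eq (lintegral_congr fun ζ => ?_)
    rw [ENNReal.ofReal_pow (by positivity)]
  have hw : ∀ ζ, ∃ w : Lp ℂ 2 μ, ‖w‖ₑ ≤ ENNReal.ofReal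
      (c * (C * (1 + ‖ζ‖ ^ 2) ^ (-(n + 1) : ℝ))) ∧ ∀ q, inner ℂ (eigenVec q) w = Φ q ζ := by
    intro ζ
    obtain ⟨w, hw, hwn⟩ := hC ζ
    refine ⟨(c : ℂ) • w, ?_, fun q => ?_⟩
    · rw [← ofReal_norm, norm_smul, Complex.norm_real, Real.norm_of_nonneg hc0]
      exact ENNReal.ofReal_le_ofReal (mul_le_mul_of_nonneg_left hwn hc0)
    · rw [inner_smul_right, inner_eigenVec, hw q.1.1 q.1.2 q.2, hΦ]
      push_cast
      ring
  obtain ⟨f, -, -, hf⟩ := exists_eigenSpan_pairing_eq hm (by fun_prop) (Real.sqrt_nonneg _) hBM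
    (Eventually.of_forall hw)
  refine ⟨f, fun lam e he => ?_⟩
  let q : EigenPair g μ := ⟨(lam, e), he⟩
  filter_upwards [hf q] with ζ hζ
  refine hζ.trans ?_
  show _ = _ * fourierR (fun x => pairing μ e.1 fun y => u.1 (x, y)) ζ
  rw [fourierR_pairing]

end TestFnSobolev

/-! ### Estimates of operator-valued symbols -/

section SymbolBounds

theorem norm_fourierInvR_le {k : ℕ} (f : Euc k → ℂ) (x : Euc k) :
    ‖fourierInvR f x‖ ≤ ((2 * Real.pi) ^ k)⁻¹ * ∫ ξ, ‖f ξ‖ := by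
  rw [fourierInvR, norm_mul, norm_inv, Complex.norm_real, Real.norm_of_nonneg (by positivity)]
  refine mul_le_mul_of_nonneg_left ((norm_integral_le_integral_norm _).trans (le_of_eq ?_))
    (by positivity)
  simp only [norm_mul, norm_exp_I_mul, one_mul]

theorem continuous_fourierInvR {k : ℕ} {f : Euc k → ℂ} (hf : Integrable f) :
    Continuous (fourierInvR f) := by
  refine Continuous.mul continuous_const (continuous_of_dominated (bound := fun ξ => ‖f ξ‖)
    (fun x => ?_) (fun x => Eventually.of_forall fun ξ => ?_) hf.norm
    (Eventually.of_forall fun ξ => by fun_prop))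
  · exact (Continuous.aestronglyMeasurable (by fun_prop)).mul hf.1
  · rw [norm_mul, norm_exp_I_mul, one_mul]

theorem fourierInvR_fourierR {k : ℕ} {f : Euc k → ℂ} (hf : Continuous f) (hfi : Integrable f)
    (hfi' : Integrable (fourierR f)) (x : Euc k) : fourierInvR (fourierR f) x = f x := by
  have h1 : (fun θ => fourierR f ((2 * Real.pi) • θ)) = FourierTransform.fourier f := by
    funext θ
    rw [fourier_eq_fourierR]
  rw [fourierInvR_eq, h1, hf.fourierInv_fourier_eq hfi]
  rw [← h1]
  exact hfi'.comp_smul (by positivity)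

variable {n m : ℕ} {Y : Type*} [TopologicalSpace Y] [CompactSpace Y] [T2Space Y]
  [ChartedSpace (Euc m) Y] [MeasurableSpace Y] [BorelSpace Y] {μ : Measure Y} [IsFiniteMeasure μ]
  [IsManifold 𝓘(ℝ, Euc m) ∞ Y] {g : RMetric m Y}
  {p : Euc n → Euc n → SmoothFn m Y →ₗ[ℂ] SmoothFn m Y} {s d N Cp : ℝ} {K : Set (Euc n)}

/-- With ξ ≠ 0 and v frozen, (x, y) ↦ (p(x, ξ)v)(y) is a test function, so the facts on (1 + Δ_X)^N
of test functions apply to the symbol. -/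
theorem exists_symbol_testFn (hp : IsOperatorSymbol μ d p) (hK : IsCompact K)
    (h0 : ∀ x ∉ K, ∀ ξ, ξ ≠ 0 → p x ξ = 0) {ξ : Euc n} (hξ : ξ ≠ 0) (v : SmoothFn m Y) :
    ∃ U : TestFn m Y n, ∀ x y, U.1 (x, y) = (p x ξ v).1 y := by
  refine ⟨testFnOfSmooth (fun q => (p q.1 ξ v).1 q.2) ?_ hK fun x hx y => ?_, fun _ _ => rfl⟩
  · have h : ContMDiff (𝓘(ℝ, Euc n).prod 𝓘(ℝ, Euc m))
        ((𝓘(ℝ, Euc n).prod 𝓘(ℝ, Euc n)).prod 𝓘(ℝ, Euc m)) ∞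
        (fun q : Euc n × Y => ((q.1, ξ), q.2)) :=
      (contMDiff_fst.prodMk contMDiff_const).prodMk contMDiff_snd
    exact (hp.smooth v).comp_contMDiff h fun _ => hξ
  · show (p x ξ v).1 y = 0
    rw [h0 x hx ξ hξ]
    rfl

/-- Decay of the Fourier coefficients of the symbol: `exists_besselKernel` writes them as integrals
of (1 + Δ_X)^N p against κ, whose L¹ norm gives the decay, while the weighted hypothesis bounds the
integrand uniformly. The constant comes from the kernel alone and does not depend on p. -/
theorem exists_fourier_symbol_bound (hN : 0 ≤ N) (hK : IsCompact K) :
    ∃ A : ℝ, 0 ≤ A ∧ ∀ (p : Euc n → Euc n → SmoothFn m Y →ₗ[ℂ] SmoothFn m Y) (Cp : ℝ), 0 ≤ Cp →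
      IsOperatorSymbol μ d p → (∀ x ∉ K, ∀ ξ, ξ ≠ 0 → p x ξ = 0) →
      WeightedBound g μ s d N Cp p → ∀ ξ, ξ ≠ 0 → ∀ (v : SmoothFn m Y) (w : Lp ℂ 2 μ),
      IsLaplacePower g μ (s / 2) ξ v.1 w → ∀ η, ∃ w' : Lp ℂ 2 μ,
        ‖w'‖ ≤ A * Cp * ‖w‖ * (1 + ‖η‖ ^ 2) ^ (-N) ∧
        ∀ q : EigenPair g μ, inner ℂ (eigenVec q) w'
          = (((1 + q.1.1 + ‖ξ‖ ^ 2) ^ ((s - d) / 2) : ℝ) : ℂ) *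
            fourierR (fun x => pairing μ q.1.2.1 (p x ξ v).1) η := by
  obtain ⟨A, hA0, hA⟩ := exists_besselKernel hN hK
  refine ⟨A, hA0, fun p Cp hCp hp h0 hW ξ hξ v w hw η => ?_⟩
  obtain ⟨κ, hκi, hκn, hκ⟩ := hA η
  obtain ⟨U, hU⟩ := exists_symbol_testFn hp hK h0 hξ v
  choose W hW1 hW2 using fun x => hW x ξ hξ v w hw
  set a : EigenPair g μ → Euc n → ℂ := fun q x => pairing μ q.1.2.1 fun y => U.1 (x, y) with ha
  have haU : ∀ q, (fun x => pairing μ q.1.2.1 (p x ξ v).1) = a q := fun q => by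
    funext x
    simp only [ha, hU]
  set b : EigenPair g μ → Euc n → ℂ := fun q => besselPower N (a q) with hb
  set c : EigenPair g μ → ℂ := fun q => (((1 + q.1.1 + ‖ξ‖ ^ 2) ^ ((s - d) / 2) : ℝ) : ℂ) with hc
  have hbi : ∀ q, Integrable fun θ => (((1 + ‖θ‖ ^ 2) ^ N : ℝ) : ℂ) * fourierR (a q) θ :=
    fun q => integrable_besselPower_pairing N q.1.2 U
  have hWb : ∀ q x, inner ℂ (eigenVec q) (W x) = c q * b q x := fun q x => by
    rw [inner_eigenVec, hW1 x q.1.1 q.1.2 q.2]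
    congr 1
    simp only [← hU]
    exact pairing_besselPower N q.1.2 U x
  have haη : ∀ q, fourierR (a q) η = ∫ y, κ y * b q y := fun q =>
    hκ (a q) (continuous_pairing_slice q.1.2 U) (fun x hx => by
      rw [← haU q]
      simp only [h0 x hx ξ hξ]
      simp [pairing]) (hbi q)
  have hint : ∀ q, Integrable fun y => κ y * (c q * b q y) := fun q => by
    have hbc : Continuous (b q) := continuous_fourierInvR (hbi q)
    exact hκi.mul_bdd (c := ‖c q‖ * (((2 * Real.pi) ^ n)⁻¹ *
      ∫ θ, ‖(((1 + ‖θ‖ ^ 2) ^ N : ℝ) : ℂ) * fourierR (a q) θ‖))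
      (continuous_const.mul hbc).aestronglyMeasurable (Eventually.of_forall fun y => by
        rw [norm_mul]
        exact mul_le_mul_of_nonneg_left (norm_fourierInvR_le _ _) (norm_nonneg _))
  -- Formally w' = ∫ κ(y) W(y) dy. As W is merely chosen pointwise, only its inner products with
  -- eigenfunctions, which are continuous in y, are integrated.
  obtain ⟨w', -, hw'n, hw'⟩ := exists_inner_eq (eigenVec : EigenPair g μ → Lp ℂ 2 μ)
    (fun q => c q * fourierR (a q) η) (B := A * Cp * ‖w‖ * (1 + ‖η‖ ^ 2) ^ (-N)) (by positivity)
    fun t => by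
      have h1 : (t.sum fun q z => conj z * (c q * fourierR (a q) η))
          = ∫ y, κ y * inner ℂ (t.sum fun q z => z • eigenVec q) (W y) := by
        simp only [Finsupp.sum, haη, ← integral_const_mul]
        rw [← integral_finsetSum]
        · refine integral_congr_ae (Eventually.of_forall fun y => ?_)
          simp only [sum_inner, inner_smul_left, hWb, Finset.mul_sum]
          exact Finset.sum_congr rfl fun q _ => by ring
        · intro q _
          refine ((hint q).const_mul (conj (t q))).congr (Eventually.of_forall fun y => ?_)
          simp only
          ring
      rw [h1]
      set S := t.sum fun q z => z • eigenVec q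
      have h2 := norm_integral_le_of_norm_le (hκi.norm.mul_const (‖S‖ * (Cp * ‖w‖)))
        (f := fun y => κ y * inner ℂ S (W y)) (Eventually.of_forall fun y => by
          rw [norm_mul]
          exact mul_le_mul_of_nonneg_left ((norm_inner_le_norm _ _).trans
            (mul_le_mul_of_nonneg_left (hW2 y) (norm_nonneg _))) (norm_nonneg _))
      refine h2.trans ?_
      rw [integral_mul_const]
      refine (mul_le_mul_of_nonneg_right hκn (by positivity)).trans (le_of_eq ?_)
      ring
  exact ⟨w', hw'n, fun q => by rw [hw' q, haU q]⟩

/-- Fourier inversion in x, with the coefficients summable because 2N > n, turns the decay of the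
coefficients back into a bound for p(x, ξ) itself at each x. -/
theorem exists_symbol_bound (hN : (n : ℝ) < 2 * N) (hK : IsCompact K) (hCp : 0 ≤ Cp)
    (hp : IsOperatorSymbol μ d p) (h0 : ∀ x ∉ K, ∀ ξ, ξ ≠ 0 → p x ξ = 0)
    (hW : WeightedBound g μ s d N Cp p) :
    ∃ A : ℝ, 0 ≤ A ∧ ∀ ξ, ξ ≠ 0 → ∀ (v : SmoothFn m Y) (w : Lp ℂ 2 μ),
      IsLaplacePower g μ (s / 2) ξ v.1 w → ∀ (q : EigenPair g μ) (x : Euc n),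
        |(1 + q.1.1 + ‖ξ‖ ^ 2) ^ ((s - d) / 2)| * ‖pairing μ q.1.2.1 (p x ξ v).1‖
          ≤ A * ‖eigenVec q‖ * ‖w‖ := by
  have hn : (0 : ℝ) ≤ n := Nat.cast_nonneg n
  obtain ⟨A, hA0, hA⟩ := exists_fourier_symbol_bound (μ := μ) (g := g) (s := s) (d := d)
    (N := N) (by linarith) hK
  have hI := integrable_one_add_norm_sq_rpow hN
  refine ⟨((2 * Real.pi) ^ n)⁻¹ * (A * Cp * ∫ η : Euc n, (1 + ‖η‖ ^ 2) ^ (-N)), by positivity,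
    fun ξ hξ v w hw q x => ?_⟩
  obtain ⟨U, hU⟩ := exists_symbol_testFn hp hK h0 hξ v
  set a : Euc n → ℂ := fun x => pairing μ q.1.2.1 (p x ξ v).1 with ha
  have haU : a = fun x => pairing μ q.1.2.1 fun y => U.1 (x, y) := by
    funext x
    simp only [ha, hU]
  have hac : Continuous a := haU ▸ continuous_pairing_slice q.1.2 U
  have hai : Integrable a := hac.integrable_of_hasCompactSupport
    (HasCompactSupport.intro hK fun x hx => by simp [ha, h0 x hx ξ hξ, pairing])
  have hai' : Integrable (fourierR a) := by
    have := integrable_besselPower_pairing (μ := μ) 0 q.1.2 U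
    simpa [haU] using this
  rw [show pairing μ q.1.2.1 (p x ξ v).1 = a x from rfl, ← fourierInvR_fourierR hac hai hai' x]
  set c : ℝ := (1 + q.1.1 + ‖ξ‖ ^ 2) ^ ((s - d) / 2)
  have h1 : ∀ η, |c| * ‖fourierR a η‖ ≤ A * Cp * ‖w‖ * ‖eigenVec q‖ * (1 + ‖η‖ ^ 2) ^ (-N) := by
    intro η
    obtain ⟨w', hw'n, hw'⟩ := hA p Cp hCp hp h0 hW ξ hξ v w hw η
    have : |c| * ‖fourierR a η‖ = ‖inner ℂ (eigenVec q) w'‖ := by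
      rw [hw' q, norm_mul, Complex.norm_real, Real.norm_eq_abs]
    rw [this]
    refine (norm_inner_le_norm _ _).trans
      ((mul_le_mul_of_nonneg_left hw'n (norm_nonneg _)).trans (le_of_eq ?_))
    ring
  calc _ ≤ |c| * (((2 * Real.pi) ^ n)⁻¹ * ∫ η, ‖fourierR a η‖) :=
        mul_le_mul_of_nonneg_left (norm_fourierInvR_le _ _) (abs_nonneg _)
    _ = ((2 * Real.pi) ^ n)⁻¹ * ∫ η, |c| * ‖fourierR a η‖ := by
        rw [integral_const_mul]
        ring
    _ ≤ ((2 * Real.pi) ^ n)⁻¹ *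
        ∫ η : Euc n, A * Cp * ‖w‖ * ‖eigenVec q‖ * (1 + ‖η‖ ^ 2) ^ (-N) :=
        mul_le_mul_of_nonneg_left (integral_mono (hai'.norm.const_mul _) (hI.const_mul _) h1)
          (by positivity)
    _ = _ := by
        rw [integral_const_mul]
        ring

end SymbolBounds

/-! ### The integral defining the operator -/

section Quantization

variable {n m : ℕ} {Y : Type*} [TopologicalSpace Y] [CompactSpace Y]
  [ChartedSpace (Euc m) Y] [MeasurableSpace Y] [BorelSpace Y] {μ : Measure Y} [IsFiniteMeasure μ]
  [IsManifold 𝓘(ℝ, Euc m) ∞ Y] {g : RMetric m Y}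
  {p : Euc n → Euc n → SmoothFn m Y →ₗ[ℂ] SmoothFn m Y} {s d N Cp : ℝ} {K : Set (Euc n)}

theorem continuousOn_pairing_symbol_apply (hp : IsOperatorSymbol μ d p) (e v : SmoothFn m Y) :
    ContinuousOn (fun z : Euc n × Euc n => pairing μ e.1 (p z.1 z.2 v).1) {z | z.2 ≠ 0} := by
  have hc : Continuous fun y => conj (e.1 y) := Complex.continuous_conj.comp e.2.continuous
  have hloc : LocallyCompactSpace {z : Euc n × Euc n | z.2 ≠ 0} :=
    IsOpen.locallyCompactSpace (isOpen_ne.preimage continuous_snd)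
  rw [continuousOn_iff_continuous_domRestrict]
  have h1 : Continuous (Function.uncurry fun (z : {z : Euc n × Euc n | z.2 ≠ 0}) (y : Y) =>
      conj (e.1 y) * (p z.1.1 z.1.2 v).1 y) := by
    refine (hc.comp continuous_snd).mul ?_
    have h2 : Continuous fun t : {z : Euc n × Euc n | z.2 ≠ 0} × Y => (t.1.1, t.2) := by fun_prop
    exact (hp.smooth v).continuousOn.comp_continuous h2 fun t => t.1.2
  have h2 := continuous_parametric_integral_of_continuous h1 isCompact_univ (μ := μ)
  simp only [Measure.restrict_univ] at h2
  exact h2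

theorem pairing_eq_zero_of_eigenVec {q : EigenPair g μ} (h : eigenVec q = 0) (v : SmoothFn m Y) :
    pairing μ q.1.2.1 v.1 = 0 := by
  rw [← inner_eigenVec_smoothToLp, h, inner_zero_left]

variable [T2Space Y]

/-- Smoothness of the symbol is assumed only on a fixed v, whereas û(ξ) moves with ξ. Split û(ξ)
into û(ξ₀) and û(ξ) - û(ξ₀): the first is a fixed function, and the second is small by the Lipschitz
bound and `exists_symbol_bound`. -/
theorem continuousOn_pairing_symbol (hμ : IsRiemannianVolume g μ) (hN : (n : ℝ) < 2 * N)
    (hK : IsCompact K) (hCp : 0 ≤ Cp) (hp : IsOperatorSymbol μ d p)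
    (h0 : ∀ x ∉ K, ∀ ξ, ξ ≠ 0 → p x ξ = 0) (hW : WeightedBound g μ s d N Cp p)
    (q : EigenPair g μ) (u : TestFn m Y n) :
    ContinuousOn (fun z : Euc n × Euc n =>
      pairing μ q.1.2.1 (p z.1 z.2 (partialFourier u z.2)).1) {z | z.2 ≠ 0} := by
  by_cases hq : eigenVec q = 0
  · simp only [pairing_eq_zero_of_eigenVec hq]
    exact continuousOn_const
  have hl : 0 ≤ q.1.1 := eigenVec_ne_zero hμ hq
  obtain ⟨A, hA0, hA⟩ := exists_symbol_bound hN hK hCp hp h0 hW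
  obtain ⟨C, hC0, hC⟩ := exists_laplacePower_sub hμ u (s / 2)
  have hopen : IsOpen {z : Euc n × Euc n | z.2 ≠ 0} :=
    isOpen_ne.preimage continuous_snd
  intro z₀ hz₀
  refine ContinuousAt.continuousWithinAt ?_
  set G : Euc n × Euc n → ℂ := fun z =>
    pairing μ q.1.2.1 (p z.1 z.2 (partialFourier u z₀.2)).1 with hG
  have hGc : ContinuousAt G z₀ :=
    (continuousOn_pairing_symbol_apply hp _ _).continuousAt (hopen.mem_nhds hz₀)
  set a : Euc n × Euc n → ℝ := fun z => (1 + q.1.1 + ‖z.2‖ ^ 2) ^ ((s - d) / 2) with ha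
  have ha0 : ∀ z, 0 < a z := fun z => by positivity
  have hac : Continuous a := by
    refine Continuous.rpow_const (by fun_prop) fun z => Or.inl ?_
    positivity
  set D : Euc n × Euc n → ℝ := fun z => (a z)⁻¹ * (A * ‖eigenVec q‖ *
    ((1 + ‖z.2‖ ^ 2) ^ |s / 2| * (C * ‖z.2 - z₀.2‖))) + ‖G z - G z₀‖ with hD
  have hDt : Tendsto D (𝓝 z₀) (𝓝 0) := by
    have h1 : Continuous fun z : Euc n × Euc n => (1 + ‖z.2‖ ^ 2) ^ |s / 2| := by
      refine Continuous.rpow_const (by fun_prop) fun z => Or.inl ?_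
      positivity
    have h2 : ContinuousAt D z₀ := by
      refine ContinuousAt.add ?_ (hGc.sub continuousAt_const).norm
      refine Continuous.continuousAt ((hac.inv₀ fun z => (ha0 z).ne').mul ?_)
      fun_prop
    have h3 : D z₀ = 0 := by simp [hD]
    rw [← h3]
    exact h2
  rw [ContinuousAt, tendsto_iff_norm_sub_tendsto_zero]
  refine squeeze_zero' (Eventually.of_forall fun _ => norm_nonneg _) ?_ hDt
  filter_upwards [hopen.mem_nhds hz₀] with z hz
  obtain ⟨w, hw, hwn⟩ := hC z.2 z₀.2
  have h1 := hA z.2 hz _ w hw q z.1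
  rw [abs_of_pos (ha0 z), ← le_inv_mul_iff₀ (ha0 z)] at h1
  have h2 : pairing μ q.1.2.1 (p z.1 z.2 (partialFourier u z.2)).1
      = pairing μ q.1.2.1 (p z.1 z.2 (partialFourier u z.2 - partialFourier u z₀.2)).1 + G z := by
    rw [hG, ← pairing_add, ← map_add, sub_add_cancel]
  rw [h2, hD]
  have h3 : ∀ b c : ℂ, ‖b + G z - c‖ ≤ ‖b‖ + ‖G z - c‖ := fun b c => by
    rw [add_sub_assoc]; exact norm_add_le _ _
  refine (h3 _ _).trans (add_le_add_left (h1.trans ?_) _)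
  refine mul_le_mul_of_nonneg_left ?_ (inv_nonneg.2 (ha0 z).le)
  exact mul_le_mul_of_nonneg_left hwn (by positivity)

theorem exists_decay_pairing_symbol (hμ : IsRiemannianVolume g μ) (hN : (n : ℝ) < 2 * N)
    (hK : IsCompact K) (hCp : 0 ≤ Cp) (hp : IsOperatorSymbol μ d p)
    (h0 : ∀ x ∉ K, ∀ ξ, ξ ≠ 0 → p x ξ = 0) (hW : WeightedBound g μ s d N Cp p)
    (q : EigenPair g μ) (u : TestFn m Y n) (L : ℝ) :
    ∃ C : ℝ, 0 ≤ C ∧ ∀ x ξ, ξ ≠ 0 →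
      ‖pairing μ q.1.2.1 (p x ξ (partialFourier u ξ)).1‖ ≤ C * (1 + ‖ξ‖ ^ 2) ^ (-L) := by
  by_cases hq : eigenVec q = 0
  · exact ⟨0, le_rfl, fun x ξ _ => by simp [pairing_eq_zero_of_eigenVec hq]⟩
  have hl : 0 ≤ q.1.1 := eigenVec_ne_zero hμ hq
  set r : ℝ := (s - d) / 2 with hr
  obtain ⟨A, hA0, hA⟩ := exists_symbol_bound hN hK hCp hp h0 hW
  obtain ⟨C, hC0, hC⟩ := exists_laplacePower_decay hμ u (s / 2) (L + |r|)
  -- The weight at the fixed eigenvalue is inverted: (1 + lam + |ξ|²)^{-r} is at most a constant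
  -- depending on `lam` times (1 + |ξ|²)^{|r|}, and |r| orders of decay of û pay for it.
  obtain ⟨k, hk⟩ := exists_nat_ge (-r)
  refine ⟨(1 + q.1.1) ^ k * (A * ‖eigenVec q‖ * C), by positivity, fun x ξ hξ => ?_⟩
  have hp0 : 0 < 1 + ‖ξ‖ ^ 2 := by positivity
  have hp1 : 0 < 1 + q.1.1 + ‖ξ‖ ^ 2 := by positivity
  obtain ⟨w, hw, hwn⟩ := hC ξ
  have h1 := hA ξ hξ _ w hw q x
  have ha0 := Real.rpow_pos_of_pos hp1 r
  rw [abs_of_pos ha0, ← le_inv_mul_iff₀ ha0, ← Real.rpow_neg hp1.le] at h1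
  have h2 := one_add_add_rpow_mul_le hl (sq_nonneg ‖ξ‖) hk
  have hk0 : 0 < (1 + q.1.1) ^ k := by positivity
  rw [abs_of_nonneg (mul_nonneg (Real.rpow_pos_of_pos hp1 _).le (inv_pos.2 hk0).le),
    ← div_eq_mul_inv, div_le_iff₀ hk0, abs_neg] at h2
  have hr0 := Real.rpow_pos_of_pos hp0 |r|
  refine h1.trans ((mul_le_mul h2 (mul_le_mul_of_nonneg_left hwn (by positivity)) (by positivity)
    (by positivity)).trans (le_of_eq ?_))
  rw [show -L = |r| + -(L + |r|) by ring, Real.rpow_add hp0]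
  ring

theorem integrable_mul_pairing_symbol (hn : 0 < n) (hμ : IsRiemannianVolume g μ)
    (hN : (n : ℝ) < 2 * N)
    (hK : IsCompact K) (hCp : 0 ≤ Cp) (hp : IsOperatorSymbol μ d p)
    (h0 : ∀ x ∉ K, ∀ ξ, ξ ≠ 0 → p x ξ = 0) (hW : WeightedBound g μ s d N Cp p)
    (q : EigenPair g μ) (u : TestFn m Y n) {E : Euc n × Euc n → ℂ} (hE : Continuous E)
    (hE1 : ∀ z, ‖E z‖ = 1) :
    Integrable (fun z : Euc n × Euc n =>
      E z * pairing μ q.1.2.1 (p z.1 z.2 (partialFourier u z.2)).1)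
      ((volume : Measure (Euc n)).prod volume) := by
  -- For n ≥ 1 the origin is a null set, so the unspecified values p(x, 0) do not matter.
  have : Nonempty (Fin n) := ⟨⟨0, hn⟩⟩
  obtain ⟨C, hC0, hC⟩ := exists_decay_pairing_symbol hμ hN hK hCp hp h0 hW q u (n + 1)
  have hopen : IsOpen {z : Euc n × Euc n | z.2 ≠ 0} := isOpen_ne.preimage continuous_snd
  have hae : ∀ᵐ z ∂((volume : Measure (Euc n)).prod (volume : Measure (Euc n))),
      z ∈ {z : Euc n × Euc n | z.2 ≠ 0} :=
    Measure.quasiMeasurePreserving_snd.ae (Measure.ae_ne volume 0)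
  have hdom : Integrable (fun z : Euc n × Euc n => K.indicator (fun _ => (1 : ℝ)) z.1 *
      (C * (1 + ‖z.2‖ ^ 2) ^ (-(n + 1) : ℝ))) ((volume : Measure (Euc n)).prod volume) := by
    refine Integrable.mul_prod ?_ ((integrable_one_add_norm_sq_rpow (by
      have : (0 : ℝ) ≤ n := Nat.cast_nonneg n
      linarith)).const_mul C)
    exact (integrable_indicator_iff hK.measurableSet).2 (integrableOn_const hK.measure_lt_top.ne)
  refine hdom.mono' ?_ ?_
  · have h1 : ContinuousOn (fun z : Euc n × Euc n =>
        E z * pairing μ q.1.2.1 (p z.1 z.2 (partialFourier u z.2)).1) {z | z.2 ≠ 0} :=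
      hE.continuousOn.mul (continuousOn_pairing_symbol hμ hN hK hCp hp h0 hW q u)
    have h2 := h1.aestronglyMeasurable (μ := (volume : Measure (Euc n)).prod volume)
      hopen.measurableSet
    rwa [Measure.restrict_eq_self_of_ae_mem hae] at h2
  · filter_upwards [hae] with z hz
    rw [norm_mul, hE1, one_mul]
    by_cases hx : z.1 ∈ K
    · simpa [hx] using hC z.1 z.2 hz
    · simp [hx, h0 z.1 hx z.2 hz, pairing]

theorem integrable_pairing_symbol (hn : 0 < n) (hμ : IsRiemannianVolume g μ)
    (hN : (n : ℝ) < 2 * N)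
    (hK : IsCompact K) (hCp : 0 ≤ Cp) (hp : IsOperatorSymbol μ d p)
    (h0 : ∀ x ∉ K, ∀ ξ, ξ ≠ 0 → p x ξ = 0) (hW : WeightedBound g μ s d N Cp p)
    (q : EigenPair g μ) (u : TestFn m Y n) (x : Euc n) :
    Integrable fun ξ => pairing μ q.1.2.1 (p x ξ (partialFourier u ξ)).1 := by
  have : Nonempty (Fin n) := ⟨⟨0, hn⟩⟩
  obtain ⟨C, hC0, hC⟩ := exists_decay_pairing_symbol hμ hN hK hCp hp h0 hW q u (n + 1)
  have hae : ∀ᵐ ξ : Euc n, ξ ∈ {ξ : Euc n | ξ ≠ 0} := Measure.ae_ne volume 0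
  refine ((integrable_one_add_norm_sq_rpow (k := n) (r := n + 1) (by
      have : (0 : ℝ) ≤ n := Nat.cast_nonneg n
      linarith)).const_mul C).mono' ?_ ?_
  · have h1 : ContinuousOn (fun ξ => pairing μ q.1.2.1 (p x ξ (partialFourier u ξ)).1)
        {ξ : Euc n | ξ ≠ 0} :=
      (continuousOn_pairing_symbol hμ hN hK hCp hp h0 hW q u).comp
        (f := fun ξ : Euc n => (x, ξ)) (by fun_prop) fun ξ hξ => hξ
    have h2 := h1.aestronglyMeasurable (μ := (volume : Measure (Euc n))) isOpen_ne.measurableSet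
    rwa [Measure.restrict_eq_self_of_ae_mem hae] at h2
  · filter_upwards [hae] with ξ hξ
    exact hC x ξ hξ

theorem integrable_quantize (hn : 0 < n) (hμ : IsRiemannianVolume g μ) (hN : (n : ℝ) < 2 * N)
    (hK : IsCompact K) (hCp : 0 ≤ Cp) (hp : IsOperatorSymbol μ d p)
    (h0 : ∀ x ∉ K, ∀ ξ, ξ ≠ 0 → p x ξ = 0) (hW : WeightedBound g μ s d N Cp p)
    (q : EigenPair g μ) (u : TestFn m Y n) :
    Integrable fun x => quantize μ p u x q.1.2.1 :=
  (integrable_mul_pairing_symbol hn hμ hN hK hCp hp h0 hW q u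
    (E := fun z => Complex.exp (Complex.I * (inner ℝ z.1 z.2 : ℝ))) (by fun_prop)
    (fun z => norm_exp_I_mul _)).integral_prod_left.const_mul _

/-- Fubini, together with e^{-ix·ζ} e^{ix·ξ} = e^{-ix·(ζ-ξ)}: in frequency space the operator is an
integral operator with kernel p̃(ζ - ξ, ξ). -/
theorem fourierR_quantize (hn : 0 < n) (hμ : IsRiemannianVolume g μ) (hN : (n : ℝ) < 2 * N)
    (hK : IsCompact K) (hCp : 0 ≤ Cp) (hp : IsOperatorSymbol μ d p)
    (h0 : ∀ x ∉ K, ∀ ξ, ξ ≠ 0 → p x ξ = 0) (hW : WeightedBound g μ s d N Cp p)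
    (q : EigenPair g μ) (u : TestFn m Y n) (ζ : Euc n) :
    Integrable (fun ξ =>
      fourierR (fun x => pairing μ q.1.2.1 (p x ξ (partialFourier u ξ)).1) (ζ - ξ)) ∧
    fourierR (fun x => quantize μ p u x q.1.2.1) ζ = (((2 * Real.pi) ^ n : ℝ) : ℂ)⁻¹ *
      ∫ ξ, fourierR (fun x => pairing μ q.1.2.1 (p x ξ (partialFourier u ξ)).1) (ζ - ξ) := by
  have h1 := integrable_mul_pairing_symbol hn hμ hN hK hCp hp h0 hW q u
    (E := fun z => Complex.exp (-(Complex.I * (inner ℝ z.1 (ζ - z.2) : ℝ)))) (by fun_prop)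
    (fun z => norm_exp_neg_I_mul _)
  refine ⟨h1.integral_prod_right, ?_⟩
  simp only [fourierR, quantize, fourierInvR]
  simp only [mul_left_comm _ (((2 * Real.pi) ^ n : ℝ) : ℂ)⁻¹, integral_const_mul]
  congr 1
  simp only [← integral_const_mul]
  refine Eq.trans ?_ (integral_integral_swap (f := fun x ξ =>
    Complex.exp (-(Complex.I * (inner ℝ x (ζ - ξ) : ℝ))) *
      pairing μ q.1.2.1 (p x ξ (partialFourier u ξ)).1) h1)
  refine integral_congr_ae (Eventually.of_forall fun x =>
    integral_congr_ae (Eventually.of_forall fun ξ => ?_))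
  show _ * (_ * _) = _ * _
  rw [← mul_assoc, ← Complex.exp_add, inner_sub_right]
  congr 2
  push_cast
  ring

end Quantization

/-! ### Convolution with an integrable kernel -/

section Convolution

variable {n : ℕ}

theorem aemeasurable_conv_integrand {k h : Euc n → ENNReal} (hk : Measurable k)
    (hh : AEMeasurable h) :
    AEMeasurable (fun z : Euc n × Euc n => k (z.1 - z.2) * h z.2)
      ((volume : Measure (Euc n)).prod volume) :=
  (hk.comp (by fun_prop : Measurable fun z : Euc n × Euc n => z.1 - z.2)).aemeasurable.mul
    (hh.comp_quasiMeasurePreserving Measure.quasiMeasurePreserving_snd)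

/-- Young's inequality `‖k ∗ h‖₂ ≤ ‖k‖₁ ‖h‖₂`. -/
theorem lintegral_conv_sq_le {k h : Euc n → ENNReal} (hk : Measurable k) (hh : AEMeasurable h) :
    ∫⁻ ζ, (∫⁻ ξ, k (ζ - ξ) * h ξ) ^ 2 ≤ (∫⁻ ξ, k ξ) ^ 2 * ∫⁻ ξ, h ξ ^ 2 := by
  have hkζ : ∀ ζ : Euc n, Measurable fun ξ => k (ζ - ξ) := fun ζ => hk.comp (by fun_prop)
  have h1 : ∀ ζ, (∫⁻ ξ, k (ζ - ξ) * h ξ) ^ 2 ≤ (∫⁻ ξ, k ξ) * ∫⁻ ξ, k (ζ - ξ) * h ξ ^ 2 := by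
    intro ζ
    -- Cauchy–Schwarz for the factorization k h = k^{1/2} · k^{1/2} h.
    have h2 := ENNReal.lintegral_mul_le_Lp_mul_Lq (volume : Measure (Euc n))
      Real.HolderConjugate.two_two (f := fun ξ => k (ζ - ξ) ^ (2⁻¹ : ℝ))
      (g := fun ξ => k (ζ - ξ) ^ (2⁻¹ : ℝ) * h ξ) ((hkζ ζ).pow_const _).aemeasurable
      (((hkζ ζ).pow_const _).aemeasurable.mul hh)
    have e1 : ∀ b : ENNReal, (b ^ (2⁻¹ : ℝ)) ^ (2 : ℝ) = b := fun b => by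
      rw [← ENNReal.rpow_mul]; norm_num
    have e2 : (fun ξ => k (ζ - ξ)) = (fun ξ => k (ζ - ξ) ^ (2⁻¹ : ℝ))
        * fun ξ => k (ζ - ξ) ^ (2⁻¹ : ℝ) := by
      funext ξ
      rw [Pi.mul_apply, ← sq, ennreal_rpow_half_sq]
    have e3 : ∫⁻ ξ, k (ζ - ξ) * h ξ = ∫⁻ ξ, ((fun ξ => k (ζ - ξ) ^ (2⁻¹ : ℝ))
        * fun ξ => k (ζ - ξ) ^ (2⁻¹ : ℝ) * h ξ) ξ := by
      refine lintegral_congr fun ξ => ?_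
      rw [Pi.mul_apply, ← mul_assoc, ← sq, ennreal_rpow_half_sq]
    rw [e3]
    refine (pow_le_pow_left' h2 2).trans (le_of_eq ?_)
    simp only [ENNReal.mul_rpow_of_nonneg _ _ (zero_le_two : (0 : ℝ) ≤ 2), e1, one_div]
    rw [mul_pow, ennreal_rpow_half_sq, ennreal_rpow_half_sq]
    simp only [ENNReal.rpow_ofNat]
    rw [lintegral_sub_left_eq_self k ζ]
  have hm : AEMeasurable (Function.uncurry fun ζ ξ : Euc n => k (ζ - ξ) * h ξ ^ 2)
      ((volume : Measure (Euc n)).prod volume) :=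
    aemeasurable_conv_integrand hk (hh.pow_const 2)
  calc _ ≤ ∫⁻ ζ, (∫⁻ ξ, k ξ) * ∫⁻ ξ, k (ζ - ξ) * h ξ ^ 2 := lintegral_mono h1
    _ = (∫⁻ ξ, k ξ) * ∫⁻ ζ, ∫⁻ ξ, k (ζ - ξ) * h ξ ^ 2 := by
        exact lintegral_const_mul'' _ hm.lintegral_prod_right'
    _ = (∫⁻ ξ, k ξ) * ∫⁻ ξ, ∫⁻ ζ, k (ζ - ξ) * h ξ ^ 2 := by
        rw [lintegral_lintegral_swap hm]
    _ = (∫⁻ ξ, k ξ) * ∫⁻ ξ, (∫⁻ ζ, k ζ) * h ξ ^ 2 := by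
        congr 1
        refine lintegral_congr fun ξ => ?_
        have hkξ : Measurable fun ζ => k (ζ - ξ) := hk.comp (by fun_prop)
        rw [lintegral_mul_const _ hkξ, lintegral_sub_right_eq_self k ξ]
    _ = _ := by
        rw [lintegral_const_mul'' _ (hh.pow_const 2)]
        ring

theorem continuous_fourierR {f : Euc n → ℂ} (hf : Integrable f) : Continuous (fourierR f) := by
  refine continuous_of_dominated (bound := fun ξ => ‖f ξ‖)
    (fun x => ?_) (fun x => Eventually.of_forall fun ξ => ?_) hf.norm
    (Eventually.of_forall fun ξ => by fun_prop)
  · exact (Continuous.aestronglyMeasurable (by fun_prop)).mul hf.1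
  · rw [norm_mul, norm_exp_neg_I_mul, one_mul]

end Convolution

/-! ### The operator on Sobolev spaces -/

section Boundedness

variable {n m : ℕ} {Y : Type*} [TopologicalSpace Y] [CompactSpace Y]
  [ChartedSpace (Euc m) Y] [MeasurableSpace Y] [BorelSpace Y] {μ : Measure Y} [IsFiniteMeasure μ]
  [IsManifold 𝓘(ℝ, Euc m) ∞ Y] {g : RMetric m Y}
  {p : Euc n → Euc n → SmoothFn m Y →ₗ[ℂ] SmoothFn m Y} {s d N Cp : ℝ} {K : Set (Euc n)}
  [T2Space Y]

/-- The weight at ξ is replaced by the weight at ζ by means of the spectral multiplier ((1 + l +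
|ζ|²)/(1 + l + |ξ|²))^{(s-d)/2}, which Peetre's inequality bounds uniformly in l ≥ 0. -/
theorem exists_fourier_symbol_bound_shift (hμ : IsRiemannianVolume g μ) (hN : 0 ≤ N)
    (hK : IsCompact K) :
    ∃ A : ℝ, 0 ≤ A ∧ ∀ (p : Euc n → Euc n → SmoothFn m Y →ₗ[ℂ] SmoothFn m Y) (Cp : ℝ), 0 ≤ Cp →
      IsOperatorSymbol μ d p → (∀ x ∉ K, ∀ ξ, ξ ≠ 0 → p x ξ = 0) →
      WeightedBound g μ s d N Cp p → ∀ ξ, ξ ≠ 0 → ∀ (v : SmoothFn m Y) (w : Lp ℂ 2 μ),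
      IsLaplacePower g μ (s / 2) ξ v.1 w → ∀ ζ, ∃ w' : Lp ℂ 2 μ,
        ‖w'‖ ≤ A * Cp * (1 + ‖ζ - ξ‖ ^ 2) ^ (-(N - |(s - d) / 2|)) * ‖w‖ ∧
        ∀ q : EigenPair g μ, inner ℂ (eigenVec q) w'
          = (((1 + q.1.1 + ‖ζ‖ ^ 2) ^ ((s - d) / 2) : ℝ) : ℂ) *
            fourierR (fun x => pairing μ q.1.2.1 (p x ξ v).1) (ζ - ξ) := by
  obtain ⟨A, hA0, hA⟩ := exists_fourier_symbol_bound (μ := μ) (g := g) (s := s) (d := d) hN hK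
  set r : ℝ := (s - d) / 2 with hr
  refine ⟨2 ^ |r| * A, by positivity, fun p Cp hCp hp h0 hW ξ hξ v w hw ζ => ?_⟩
  obtain ⟨w₁, hw₁n, hw₁⟩ := hA p Cp hCp hp h0 hW ξ hξ v w hw (ζ - ξ)
  have hp0 : 0 < 1 + ‖ζ - ξ‖ ^ 2 := by positivity
  obtain ⟨w', hw'n, hw'⟩ := exists_spectral_multiplier hμ (g := g)
    (φ := fun l => ((1 + l + ‖ζ‖ ^ 2) / (1 + l + ‖ξ‖ ^ 2)) ^ r)
    (M := (2 * (1 + ‖ζ - ξ‖ ^ 2)) ^ |r|) (by positivity) (fun l hl => by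
      rw [abs_of_nonneg (by positivity)]
      exact peetre hl ζ ξ r) w₁
  refine ⟨w', hw'n.trans ?_, fun q => ?_⟩
  · refine (mul_le_mul_of_nonneg_left hw₁n (by positivity)).trans (le_of_eq ?_)
    rw [Real.mul_rpow zero_le_two hp0.le, show -(N - |r|) = |r| + -N by ring, Real.rpow_add hp0]
    ring
  · rw [hw' q, hw₁ q]
    by_cases hq : eigenVec q = 0
    · simp [pairing_eq_zero_of_eigenVec hq, fourierR]
    · have hl : 0 ≤ q.1.1 := eigenVec_ne_zero hμ hq
      rw [← mul_assoc, ← Complex.ofReal_mul, ← Real.mul_rpow (by positivity) (by positivity),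
        div_mul_cancel₀ _ (by positivity)]

/-- Any representative f of u in H^s has slices that realize (1 + Δ_Y + |ξ|²)^{s/2} û(ξ). The slices
of f itself are used so that the final bound is by ‖f‖. -/
theorem ae_exists_laplacePower (hμ : IsRiemannianVolume g μ) {u : TestFn m Y n}
    {f : SobolevSpace n μ s} (hf : IsSobolevElement g μ s (DistFn.ofFun μ u.1) f) :
    ∀ᵐ ξ, ∃ w : Lp ℂ 2 μ, IsLaplacePower g μ (s / 2) ξ (partialFourier u ξ).1 w ∧
      ENNReal.ofReal ((2 * Real.pi) ^ (-(n : ℝ) / 2)) * ‖w‖ₑ = sliceNorm f ξ := by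
  set c : ℝ := (2 * Real.pi) ^ (-(n : ℝ) / 2) with hc
  have hc0 : 0 < c := by positivity
  have hcc : (c : ℂ) ≠ 0 := by exact_mod_cast hc0.ne'
  obtain ⟨C, -, hC⟩ := exists_laplacePower_decay hμ u (s / 2) 0
  choose w₀ hw₀ _ using hC
  have h1 := ae_inner_slice_eq (g := g) (f := f) (fun ξ => (c : ℂ) • w₀ ξ) fun q => by
    filter_upwards [hf q.1.1 q.1.2 q.2] with ζ hζ
    rw [hζ, inner_smul_right, inner_eigenVec, hw₀ ζ q.1.1 q.1.2 q.2]
    have : fourierR (fun x => DistFn.ofFun μ u.1 x q.1.2.1) ζ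
        = pairing μ q.1.2.1 (partialFourier u ζ).1 := fourierR_pairing _ _ _
    rw [this]
    push_cast
    ring
  filter_upwards [h1] with ξ ⟨w, hwn, hw⟩
  refine ⟨(c : ℂ)⁻¹ • w, fun lam e he => ?_, ?_⟩
  · let q : EigenPair g μ := ⟨(lam, e), he⟩
    have h2 := hw q
    rw [inner_smul_right, inner_eigenVec q (w₀ ξ), hw₀ ξ lam e he] at h2
    have h3 := inner_eigenVec q ((c : ℂ)⁻¹ • w)
    rw [inner_smul_right, h2, inv_mul_cancel_left₀ hcc] at h3
    exact h3.symm
  · rw [← hwn, ← ofReal_norm, ← ENNReal.ofReal_mul hc0.le, norm_smul, norm_inv, Complex.norm_real,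
      Real.norm_of_nonneg hc0.le, mul_inv_cancel_left₀ hc0.ne', ofReal_norm]

end Boundedness

/-! ### The bound from H^s to H^{s-d} and linearity of the spectral components. -/

section Extension

variable {n m : ℕ} {Y : Type*} [TopologicalSpace Y] [CompactSpace Y]
  [ChartedSpace (Euc m) Y] [MeasurableSpace Y] [BorelSpace Y] {μ : Measure Y} [IsFiniteMeasure μ]
  [IsManifold 𝓘(ℝ, Euc m) ∞ Y] {g : RMetric m Y}
  {p : Euc n → Euc n → SmoothFn m Y →ₗ[ℂ] SmoothFn m Y} {s d N Cp : ℝ} {K : Set (Euc n)}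
  [T2Space Y]

/-- The core estimate. At each ζ the weighted transform of Pu is dominated by the convolution B of
(1 + |η|²)^{-(N - |s-d|/2)} with the slice norms of f. Young's inequality bounds B in L², and the
pointwise moment problems are then assembled over ζ. -/
theorem exists_sobolev_quantize (hn : 0 < n) (hμ : IsRiemannianVolume g μ)
    (hN : ((n : ℝ) + |s - d|) / 2 < N) (hK : IsCompact K) :
    ∃ C : ℝ, 0 ≤ C ∧ ∀ (p : Euc n → Euc n → SmoothFn m Y →ₗ[ℂ] SmoothFn m Y) (Cp : ℝ), 0 ≤ Cp →
      IsOperatorSymbol μ d p → (∀ x ∉ K, ∀ ξ, ξ ≠ 0 → p x ξ = 0) →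
      WeightedBound g μ s d N Cp p → ∀ (u : TestFn m Y n) (f : SobolevSpace n μ s),
      IsSobolevElement g μ s (DistFn.ofFun μ u.1) f →
      ∃ f' ∈ eigenSpan n μ g, ‖f'‖ ≤ Cp * C * ‖f‖ ∧ ∀ q : EigenPair g μ,
        (fun ζ => pairing μ q.1.2.1 fun y => f' (ζ, y)) =ᵐ[volume] fun ζ =>
          (((2 * Real.pi) ^ (-(n : ℝ) / 2) * (1 + q.1.1 + ‖ζ‖ ^ 2) ^ ((s - d) / 2) : ℝ) : ℂ) *
            fourierR (fun x => quantize μ p u x q.1.2.1) ζ := by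
  have hn0 : (0 : ℝ) ≤ n := Nat.cast_nonneg n
  have : Nonempty (Fin n) := ⟨⟨0, hn⟩⟩
  have hN0 : 0 ≤ N := by linarith [abs_nonneg (s - d)]
  obtain ⟨A, hA0, hA⟩ := exists_fourier_symbol_bound_shift (s := s) (d := d) hμ hN0 hK
  set r : ℝ := (s - d) / 2 with hr
  have hr2 : |r| = |s - d| / 2 := by rw [hr, abs_div, abs_two]
  have hN2 : (n : ℝ) < 2 * N := by linarith [abs_nonneg (s - d)]
  -- The requirement n < 2(N - |s-d|/2) is the hypothesis on N.
  have hI := integrable_one_add_norm_sq_rpow (k := n) (r := N - |r|) (by linarith)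
  set I : ℝ := ∫ η : Euc n, (1 + ‖η‖ ^ 2) ^ (-(N - |r|)) with hIdef
  have hI0 : 0 ≤ I := integral_nonneg fun η => by positivity
  set P : ℝ := ((2 * Real.pi) ^ n)⁻¹ with hP
  have hP0 : 0 ≤ P := by positivity
  refine ⟨P * A * I, by positivity, fun p Cp hCp hp h0 hW u f hf => ?_⟩
  set c : ℝ := (2 * Real.pi) ^ (-(n : ℝ) / 2) with hc
  have hc0 : 0 < c := by positivity
  set k : Euc n → ENNReal := fun η => ENNReal.ofReal ((1 + ‖η‖ ^ 2) ^ (-(N - |r|))) with hk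
  have hkm : Measurable k := by fun_prop
  have hkI : ∫⁻ η, k η = ENNReal.ofReal I :=
    (ofReal_integral_eq_lintegral_ofReal hI (Eventually.of_forall fun η => by positivity)).symm
  set D : ℝ := P * A * Cp with hD
  have hD0 : 0 ≤ D := by positivity
  set B : Euc n → ENNReal := fun ζ => ENNReal.ofReal D * ∫⁻ ξ, k (ζ - ξ) * sliceNorm f ξ with hB
  have hBm : AEMeasurable B :=
    (aemeasurable_conv_integrand hkm (aemeasurable_sliceNorm f)).lintegral_prod_right'.const_mul _
  set M : ℝ := Cp * (P * A * I) * ‖f‖ with hM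
  have hM0 : 0 ≤ M := by positivity
  have hBM : ∫⁻ ζ, B ζ ^ 2 ≤ ENNReal.ofReal M ^ 2 := by
    simp only [hB, mul_pow]
    rw [lintegral_const_mul'' _ ((aemeasurable_conv_integrand hkm
      (aemeasurable_sliceNorm f)).lintegral_prod_right'.pow_const 2)]
    refine (mul_le_mul_right (lintegral_conv_sq_le hkm (aemeasurable_sliceNorm f)) _).trans
      (le_of_eq ?_)
    rw [lintegral_sliceNorm_sq, hkI, ← mul_pow, ← mul_pow, ← ofReal_norm,
      ← ENNReal.ofReal_mul hI0, ← ENNReal.ofReal_mul hD0]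
    congr 2
    rw [hM, hD]
    ring
  set Φ : EigenPair g μ → Euc n → ℂ := fun q ζ => ((c * (1 + q.1.1 + ‖ζ‖ ^ 2) ^ r : ℝ) : ℂ) *
    fourierR (fun x => quantize μ p u x q.1.2.1) ζ with hΦ
  have hΦm : ∀ q, AEStronglyMeasurable (Φ q) := fun q => by
    refine Measurable.aestronglyMeasurable ?_
    have := (continuous_fourierR (integrable_quantize hn hμ hN2 hK hCp hp h0 hW q u)).measurable
    fun_prop
  have hne : ∀ᵐ ξ : Euc n, ξ ≠ 0 := Measure.ae_ne volume 0
  -- Solvability condition at ζ: a finite combination of components is an integral over ξ of inner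
  -- products with the vectors from the shifted symbol bound. The factor (2π)^{-n/2} enters both f
  -- and f' and cancels.
  have key : ∀ (ζ : Euc n) (a : EigenPair g μ →₀ ℂ),
      ‖a.sum fun q t => conj t * Φ q ζ‖ₑ ≤ B ζ * ‖a.sum fun q t => t • eigenVec q‖ₑ := by
    intro ζ a
    set S := a.sum fun q t => t • eigenVec q with hS
    set G : EigenPair g μ → Euc n → ℂ := fun q ξ =>
      fourierR (fun x => pairing μ q.1.2.1 (p x ξ (partialFourier u ξ)).1) (ζ - ξ) with hG
    set b : EigenPair g μ → ℂ := fun q => (((1 + q.1.1 + ‖ζ‖ ^ 2) ^ r : ℝ) : ℂ) with hb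
    have h1 : (a.sum fun q t => conj t * Φ q ζ) = ((c * P : ℝ) : ℂ) *
        ∫ ξ, a.sum fun q t => conj t * (b q * G q ξ) := by
      simp only [Finsupp.sum]
      rw [integral_finsetSum _ fun q _ =>
        ((fourierR_quantize hn hμ hN2 hK hCp hp h0 hW q u ζ).1.const_mul _).const_mul _,
        Finset.mul_sum]
      refine Finset.sum_congr rfl fun q _ => ?_
      rw [integral_const_mul, integral_const_mul]
      simp only [hΦ, (fourierR_quantize hn hμ hN2 hK hCp hp h0 hW q u ζ).2, hb, hP]
      push_cast
      ring
    have h2 : ∀ᵐ ξ, ‖a.sum fun q t => conj t * (b q * G q ξ)‖ₑ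
        ≤ ENNReal.ofReal (A * Cp * c⁻¹) * ‖S‖ₑ * (k (ζ - ξ) * sliceNorm f ξ) := by
      filter_upwards [ae_exists_laplacePower hμ hf, hne] with ξ ⟨w, hw, hwn⟩ hξ
      obtain ⟨w', hw'n, hw'⟩ := hA p Cp hCp hp h0 hW ξ hξ _ w hw ζ
      have h3 : (a.sum fun q t => conj t * (b q * G q ξ)) = inner ℂ S w' := by
        simp only [hS, Finsupp.sum, sum_inner, inner_smul_left, hw', hb, hG]
      rw [h3, ← hwn, ← ofReal_norm, ← ofReal_norm, ← ofReal_norm,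
        ← ENNReal.ofReal_mul hc0.le, ← ENNReal.ofReal_mul (by positivity),
        ← ENNReal.ofReal_mul (by positivity), ← ENNReal.ofReal_mul (by positivity)]
      refine ENNReal.ofReal_le_ofReal ((norm_inner_le_norm _ _).trans
        ((mul_le_mul_of_nonneg_left hw'n (norm_nonneg _)).trans (le_of_eq ?_)))
      field_simp
    rw [h1, enorm_mul]
    calc _ ≤ ‖((c * P : ℝ) : ℂ)‖ₑ * ∫⁻ ξ, ENNReal.ofReal (A * Cp * c⁻¹) * ‖S‖ₑ *
          (k (ζ - ξ) * sliceNorm f ξ) :=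
          mul_le_mul_right ((enorm_integral_le_lintegral_enorm _).trans (lintegral_mono_ae h2)) _
      _ = _ := by
          have hkζ : Measurable fun ξ => k (ζ - ξ) := hkm.comp (by fun_prop)
          have hm : AEMeasurable fun ξ => k (ζ - ξ) * sliceNorm f ξ :=
            hkζ.aemeasurable.mul (aemeasurable_sliceNorm f)
          rw [lintegral_const_mul'' _ hm,
            ← ofReal_norm, Complex.norm_real, Real.norm_of_nonneg (by positivity), ← mul_assoc,
            ← mul_assoc, ← ENNReal.ofReal_mul (by positivity), hB]
          have : c * P * (A * Cp * c⁻¹) = D := by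
            rw [hD]
            field_simp
          rw [this]
          ring
  -- The moment problem needs a real bound, and B is finite almost everywhere, being square
  -- integrable.
  have hBfin : ∀ᵐ ζ, B ζ ^ 2 < ⊤ :=
    ae_lt_top' (hBm.pow_const 2) (hBM.trans_lt (ENNReal.pow_lt_top ENNReal.ofReal_lt_top)).ne
  obtain ⟨f', hf', hf'n, hf'q⟩ := exists_eigenSpan_pairing_eq hΦm hBm hM0 hBM (by
    filter_upwards [hBfin] with ζ hζ
    have hζ' : B ζ ≠ ⊤ := fun h => by simp [h] at hζ
    obtain ⟨w, -, hwn, hw⟩ := exists_inner_eq (eigenVec : EigenPair g μ → Lp ℂ 2 μ)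
      (fun q => Φ q ζ) (B := (B ζ).toReal) ENNReal.toReal_nonneg fun a => by
        have h1 := key ζ a
        rw [← ENNReal.ofReal_toReal hζ', ← ofReal_norm, ← ofReal_norm,
          ← ENNReal.ofReal_mul ENNReal.toReal_nonneg] at h1
        exact (ENNReal.ofReal_le_ofReal_iff (by positivity)).1 h1
    refine ⟨w, ?_, hw⟩
    rw [← ENNReal.ofReal_toReal hζ', ← ofReal_norm]
    exact ENNReal.ofReal_le_ofReal hwn)
  exact ⟨f', hf', hf'n, hf'q⟩

variable (μ) in
/-- The spectral components of a test function in `H^s`. -/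
def sobolevComponent (s : ℝ) (q : EigenPair g μ) : TestFn m Y n →ₗ[ℂ] (Euc n → ℂ) where
  toFun u ζ := (((2 * Real.pi) ^ (-(n : ℝ) / 2) * (1 + q.1.1 + ‖ζ‖ ^ 2) ^ (s / 2) : ℝ) : ℂ) *
    fourierR (fun x => DistFn.ofFun μ u.1 x q.1.2.1) ζ
  map_add' u u' := by
    funext ζ
    have h : ∀ u : TestFn m Y n, fourierR (fun x => DistFn.ofFun μ u.1 x q.1.2.1) ζ
        = pairing μ q.1.2.1 (partialFourier u ζ).1 := fun u => fourierR_pairing _ _ _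
    rw [Pi.add_apply, h, h, h, partialFourier_add, pairing_add]
    ring
  map_smul' c u := by
    funext ζ
    have h : ∀ u : TestFn m Y n, fourierR (fun x => DistFn.ofFun μ u.1 x q.1.2.1) ζ
        = pairing μ q.1.2.1 (partialFourier u ζ).1 := fun u => fourierR_pairing _ _ _
    rw [Pi.smul_apply, h, h, partialFourier_smul, RingHom.id_apply, smul_eq_mul]
    have : pairing μ q.1.2.1 (c • partialFourier u ζ).1
      = c * pairing μ q.1.2.1 (partialFourier u ζ).1 := pairing_smul _ _ _
    rw [this]
    ring

/-- Additivity of the weak integral requires its absolute convergence, which is known for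
eigenfunctions e. -/
theorem quantize_add (e : SmoothFn m Y) (x : Euc n)
    (hi : ∀ u : TestFn m Y n, Integrable fun ξ => pairing μ e.1 (p x ξ (partialFourier u ξ)).1)
    (u u' : TestFn m Y n) :
    quantize μ p (u + u') x e.1 = quantize μ p u x e.1 + quantize μ p u' x e.1 := by
  have h : ∀ u : TestFn m Y n, Integrable fun ξ => Complex.exp (Complex.I * (inner ℝ x ξ : ℝ)) *
      pairing μ e.1 (p x ξ (partialFourier u ξ)).1 := fun u =>
    (hi u).bdd_mul (c := 1) (Continuous.aestronglyMeasurable (by fun_prop))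
      (Eventually.of_forall fun ξ => (norm_exp_I_mul _).le)
  rw [quantize, quantize, quantize, fourierInvR, fourierInvR, fourierInvR, ← mul_add,
    ← integral_add (h u) (h u')]
  congr 1
  refine integral_congr_ae (Eventually.of_forall fun ξ => ?_)
  simp only [partialFourier_add, map_add]
  rw [pairing_add]
  ring

theorem quantize_smul (e : Y → ℂ) (x : Euc n) (c : ℂ) (u : TestFn m Y n) :
    quantize μ p (c • u) x e = c * quantize μ p u x e := by
  rw [quantize, quantize, fourierInvR, fourierInvR, mul_left_comm c, ← integral_const_mul c]
  congr 1
  refine integral_congr_ae (Eventually.of_forall fun ξ => ?_)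
  simp only [partialFourier_smul, map_smul]
  have : pairing μ e (c • p x ξ (partialFourier u ξ)).1
    = c * pairing μ e (p x ξ (partialFourier u ξ)).1 := pairing_smul _ _ _
  rw [this]
  ring

/-- The spectral components of `Pu` in `H^r`. -/
def quantizeComponent (r : ℝ) (q : EigenPair g μ)
    (hi : ∀ (u : TestFn m Y n) x,
      Integrable fun ξ => pairing μ q.1.2.1 (p x ξ (partialFourier u ξ)).1)
    (hq : ∀ u : TestFn m Y n, Integrable fun x => quantize μ p u x q.1.2.1) :
    TestFn m Y n →ₗ[ℂ] (Euc n → ℂ) where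
  toFun u ζ := (((2 * Real.pi) ^ (-(n : ℝ) / 2) * (1 + q.1.1 + ‖ζ‖ ^ 2) ^ (r / 2) : ℝ) : ℂ) *
    fourierR (fun x => quantize μ p u x q.1.2.1) ζ
  map_add' u u' := by
    funext ζ
    rw [Pi.add_apply, ← mul_add, ← fourierR_add (hq u) (hq u')]
    simp only [fun x => quantize_add q.1.2 x (fun u => hi u x) u u']
  map_smul' c u := by
    funext ζ
    rw [Pi.smul_apply, RingHom.id_apply, smul_eq_mul]
    simp only [quantize_smul]
    rw [fourierR_const_mul]
    ring

end Extension

end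

theorem mainTheorem10 {n m : ℕ} (hn : 0 < n)
    {Y : Type*} [TopologicalSpace Y] [T2Space Y] [CompactSpace Y]
    [ChartedSpace (Euc m) Y] [IsManifold 𝓘(ℝ, Euc m) ∞ Y] [MeasurableSpace Y] [BorelSpace Y]
    (g : RMetric m Y) (μ : Measure Y) (hμ : IsRiemannianVolume g μ)
    (s d N : ℝ) (hN : ((n : ℝ) + |s - d|) / 2 < N)
    (K : Set (Euc n)) (hK : IsCompact K) :
    ∃ C : ℝ, ∀ (p : Euc n → Euc n → SmoothFn m Y →ₗ[ℂ] SmoothFn m Y) (Cp : ℝ), 0 ≤ Cp →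
      IsOperatorSymbol μ d p →
      (∀ x ∉ K, ∀ ξ, ξ ≠ 0 → p x ξ = 0) →
      WeightedBound g μ s d N Cp p →
      -- the integrals that define `Pu` and its Fourier transform converge absolutely
      (∀ (u : TestFn m Y n) (lam : ℝ) (e : SmoothFn m Y), IsEigenfn g μ lam e →
        (∀ x, Integrable fun ξ => pairing μ e.1 (p x ξ (partialFourier u ξ)).1) ∧
        Integrable fun x => quantize μ p u x e.1) ∧
      -- test functions belong to `H^s`
      (∀ u : TestFn m Y n, ∃ f : SobolevSpace n μ s,
        IsSobolevElement g μ s (DistFn.ofFun μ u.1) f) ∧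
      -- `P` extends to a bounded operator `H^s → H^{s-d}`
      ∃ T : SobolevSpace n μ s →L[ℂ] SobolevSpace n μ (s - d),
        ‖T‖ ≤ Cp * C ∧
        ∀ (u : TestFn m Y n) (f : SobolevSpace n μ s),
          IsSobolevElement g μ s (DistFn.ofFun μ u.1) f →
          IsSobolevElement g μ (s - d) (quantize μ p u) (T f) := by
  have hfin := isFiniteMeasure_of_isRiemannianVolume hμ
  have hN2 : (n : ℝ) < 2 * N := by linarith [abs_nonneg (s - d)]
  obtain ⟨C, hC0, hC⟩ := exists_sobolev_quantize (g := g) hn hμ hN hK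
  refine ⟨C, fun p Cp hCp hp h0 hW => ?_⟩
  have hi : ∀ (q : EigenPair g μ) (u : TestFn m Y n) x,
      Integrable fun ξ => pairing μ q.1.2.1 (p x ξ (partialFourier u ξ)).1 :=
    integrable_pairing_symbol hn hμ hN2 hK hCp hp h0 hW
  have hq : ∀ (q : EigenPair g μ) (u : TestFn m Y n),
      Integrable fun x => quantize μ p u x q.1.2.1 :=
    integrable_quantize hn hμ hN2 hK hCp hp h0 hW
  refine ⟨fun u lam e he => ⟨hi ⟨(lam, e), he⟩ u, hq ⟨(lam, e), he⟩ u⟩,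
    fun u => exists_sobolev_testFn hμ u s, ?_⟩
  -- Test functions parametrize the relation between the components of u in H^s and those of Pu in
  -- H^{s-d}; the core estimate is its boundedness.
  obtain ⟨T, hT, hTu⟩ := exists_clm_of_spectral_relation
    (sobolevComponent (n := n) μ s) (fun q : EigenPair g μ => quantizeComponent (s - d) q (hi q) (hq q))
    (mul_nonneg hCp hC0) fun u f hf =>
      hC p Cp hCp hp h0 hW u f fun lam e he => hf ⟨(lam, e), he⟩
  exact ⟨T, hT, fun u f hf lam e he =>
    hTu u f (fun q => hf q.1.1 q.1.2 q.2) ⟨(lam, e), he⟩⟩
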